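/- Let $k$ be a field of characteristic zero. A DGA is a differential non-negatively graded unital associative algebra $(A,d)$ over $k$ with $|d|=+1$; it is *augmented* if it comes with a morphism of DGAs $\epsilon\colon A\to k$, and then $\bar A=\ker\epsilon$; a CDGA is a graded commutative DGA. *Derivations.* For a morphism of DGAs $\varphi\colon A\to B$ and $p\in\mathbb Z$, let $\operatorname{Der}^p(A,B)$ be the space of linear maps $\theta\colon A\to B$ of degree $p$ with $\theta(ab)=\theta(a)\varphi(b)+(-1)^{p|a|}\varphi(a)\theta(b)$, with the differential $\delta\theta=d\theta-(-1)^p\theta d$. Write $\operatorname{Der}(A)=\operatorname{Der}(A,A)$ (for $\varphi=\mathrm{id}$). For complexes $M,N$ let $\operatorname{Hom}^p(M,N)$ be the space of linear maps of degree $p$, with the differential $f\mapsto df-(-1)^pfd$, and $\operatorname{End}(M)=\operatorname{Hom}(M,M)$. With the graded commutator $[f,g]=fg-(-1)^{pq}gf$ ($|f|=p$, $|g|=q$), $\operatorname{Der}(A)$ and $\operatorname{End}(M)$ are dg Lie algebras, so that $H^*(\operatorname{Der}(A))$ and $H^*(\operatorname{End}(M))$ are $\mathbb Z$-graded Lie algebras.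 *Hochschild chains.* For an augmented DGA $A$ let $C_*(A)=A\otimes T(s\bar A)$, where $|sa|=|a|-1$; write $a_0[a_1|\cdots|a_n]$ for $a_0\otimes sa_1\cdots sa_n$, and put $\varepsilon_i=|a_0|+\sum_{j<i}|sa_j|$. The differential of $C_*(A)$ sends $a_0[a_1|\cdots|a_n]$ to $$da_0[a_1|\cdots|a_n]+\sum_{i=1}^n(-1)^{\varepsilon_i+1}a_0[a_1|\cdots|da_i|\cdots|a_n]$$ plus, if $n\ge1$, $$(-1)^{|a_0|}a_0a_1[a_2|\cdots|a_n]+\sum_{0<i<n}(-1)^{\varepsilon_{i+1}}a_0[a_1|\cdots|a_ia_{i+1}|\cdots|a_n]+(-1)^{\varepsilon_n|sa_n|+1}a_na_0[a_1|\cdots|a_{n-1}].$$ An augmentation-preserving morphism $\varphi$ induces the chain map $C_*(\varphi)\colon a_0[a_1|\cdots|a_n]\mapsto\varphi(a_0)[\varphi(a_1)|\cdots|\varphi(a_n)]$. For a derivation $\theta\in\operatorname{Der}(A)$ of degree $p$ define operators $L_\theta$, of degree $p$, and $e_\theta$, of degree $p+1$, on $C_*(A)$ by $$L_\theta(a_0[a_1|\cdots|a_n])=\theta(a_0)[a_1|\cdots|a_n]+\sum_{i=1}^n(-1)^{p(\varepsilon_i+1)}a_0[a_1|\cdots|\theta(a_i)|\cdots|a_n],$$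 $$e_\theta(a_0[\,])=0,\qquad e_\theta(a_0[a_1|\cdots|a_n])=(-1)^{p|a_0|+p+|a_0|}a_0\theta(a_1)[a_2|\cdots|a_n]\quad(n\ge1),$$ where a letter $\theta(a_i)$ is read in $\bar A\cong A/k$, that is, as $\theta(a_i)-\epsilon(\theta(a_i))1$. They satisfy $[d,L_\theta]=L_{\delta\theta}$ and $[d,e_\theta]=-e_{\delta\theta}$, and so induce linear maps $$H(L)\colon H^p(\operatorname{Der}(A))\to H^p(\operatorname{End}(C_*(A))),\qquad H(e)\colon H^p(\operatorname{Der}(A))\to H^{p+1}(\operatorname{End}(C_*(A))).$$ *Sullivan models.* A Sullivan algebra is a CDGA $(\wedge V,d)$, where $\wedge V$ is the free graded commutative algebra on a graded space $V$ ($V^0\neq0$ is allowed), such that $V=\bigcup_{n\ge0}V(n)$ for graded subspaces $V(0)\subseteq V(1)\subseteq\cdots$ with $d(V(0))=0$ and $d(V(n+1))\subseteq\wedge V(n)$ for all $n\ge0$. **Proposition.** Let $(A,d)$ be an augmented CDGA, $(\wedge V,d)$ an augmented Sullivan algebra and $\varphi\colon(\wedge V,d)\to(A,d)$ a quasi-isomorphism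 of DGAs that preserves the augmentations. Then there exist a homomorphism of graded Lie algebras $$F\colon H^*(\operatorname{Der}(A))\to H^*(\operatorname{Der}(\wedge V))$$ and an isomorphism of graded Lie algebras $$G\colon H^*(\operatorname{End}(C_*(A)))\xrightarrow{\ \cong\ }H^*(\operatorname{End}(C_*(\wedge V)))$$ such that $G\circ H(L)=H(L)\circ F$ and $G\circ H(e)=H(e)\circ F$, and which are induced by $\varphi$ in the following sense. For cocycles $\theta\in\operatorname{Der}^p(A)$ and $\eta\in\operatorname{Der}^p(\wedge V)$, $F[\theta]=[\eta]$ if and only if $\varphi\eta-\theta\varphi$ is a coboundary in $\operatorname{Der}(\wedge V,A)$; and for cocycles $f\in\operatorname{End}^p(C_*(A))$ and $g\in\operatorname{End}^p(C_*(\wedge V))$, $G[f]=[g]$ if and only if $C_*(\varphi)g-fC_*(\varphi)$ is a coboundary in $\operatorname{Hom}(C_*(\wedge V),C_*(A))$. -/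

import Mathlib

open scoped TensorProduct DirectSum

noncomputable section

namespace HochCartan

universe u v w

set_option linter.unusedSimpArgs false
set_option linter.unusedVariables false
set_option linter.unreachableTactic false
set_option linter.unusedTactic false

/-- An augmented differential non-negatively graded algebra `(A, d)` over `k`, not necessarily
graded commutative, with the cohomological grading: `d` has degree `+1`. The degree `n` part is
`gr n`; the augmentation `aug` is a morphism of differential graded algebras to `k`. -/
structure AugDGA (k : Type u) [Field k] where
  carrier : Type v
  [ring : Ring carrier]
  [algebra : Algebra k carrier]
  gr : ℤ → Submodule k carrier
  [graded : GradedAlgebra gr]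
  gr_neg : ∀ n : ℤ, n < 0 → gr n = ⊥
  d : carrier →ₗ[k] carrier
  d_mem : ∀ {n : ℤ} {a : carrier}, a ∈ gr n → d a ∈ gr (n + 1)
  d_d : ∀ a : carrier, d (d a) = 0
  leibniz : ∀ {n : ℤ} {a : carrier}, a ∈ gr n → ∀ b : carrier,
    d (a * b) = d a * b + (-1 : k) ^ n • (a * d b)
  aug : carrier →ₐ[k] k
  aug_d : ∀ a : carrier, aug (d a) = 0
  aug_gr : ∀ {n : ℤ} {a : carrier}, n ≠ 0 → a ∈ gr n → aug a = 0

attribute [instance] AugDGA.ring AugDGA.algebra AugDGA.graded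

instance {k : Type u} [Field k] : CoeSort (AugDGA.{u, v} k) (Type v) := ⟨AugDGA.carrier⟩

section

variable {k : Type u} [Field k]

namespace AugDGA

/-- Graded commutativity. -/
def IsGradedComm (A : AugDGA.{u, v} k) : Prop :=
  ∀ (m n : ℤ) (a b : A), a ∈ A.gr m → b ∈ A.gr n → a * b = (-1 : k) ^ (m * n) • (b * a)

/-- The linear map `a ↦ (-1) ^ (p * |a|) a`. -/
def sgn (A : AugDGA.{u, v} k) (p : ℤ) : A →ₗ[k] A :=
  DirectSum.toModule k ℤ A (fun n => (-1 : k) ^ (p * n) • (A.gr n).subtype) ∘ₗ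
    (DirectSum.decomposeLinearEquiv A.gr).toLinearMap

theorem sgn_apply (A : AugDGA.{u, v} k) (p : ℤ) {n : ℤ} {a : A} (ha : a ∈ A.gr n) :
    A.sgn p a = (-1 : k) ^ (p * n) • a := by
  simp only [sgn, LinearMap.comp_apply, LinearEquiv.coe_coe, DirectSum.decomposeLinearEquiv_apply]
  rw [DirectSum.decompose_of_mem _ ha]
  erw [DirectSum.toModule_lof]
  simp

/-- The augmentation ideal. -/
def bar (A : AugDGA.{u, v} k) : Submodule k A := LinearMap.ker A.aug.toLinearMap

/-- The projection `a ↦ a - ε(a) 1` onto the augmentation ideal. -/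
def proj (A : AugDGA.{u, v} k) : A →ₗ[k] A.bar :=
  LinearMap.codRestrict A.bar
    (LinearMap.id - Algebra.linearMap k A ∘ₗ A.aug.toLinearMap) (fun a => by simp [bar])

theorem coe_proj (A : AugDGA.{u, v} k) (a : A) :
    (A.proj a : A) = a - algebraMap k A (A.aug a) := by
  rfl

end AugDGA

/-- The module `A ⊗ T(E)` of words `a₀[e₁|⋯|eₙ] = a₀ ⊗ (e₁ ⋯ eₙ)`. -/
def Words (k : Type u) [Field k] (A E : Type*) [AddCommGroup A] [Module k A] [AddCommGroup E]
    [Module k E] := A ⊗[k] TensorAlgebra k E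

instance {A E : Type*} [AddCommGroup A] [Module k A] [AddCommGroup E] [Module k E] :
    AddCommGroup (Words k A E) := inferInstanceAs (AddCommGroup (A ⊗[k] TensorAlgebra k E))

instance {A E : Type*} [AddCommGroup A] [Module k A] [AddCommGroup E] [Module k E] :
    Module k (Words k A E) := inferInstanceAs (Module k (A ⊗[k] TensorAlgebra k E))

section shortcuts

variable {A E : Type*} [AddCommGroup A] [Module k A] [AddCommGroup E] [Module k E]

instance : AddCommMonoid (Words k A E) := inferInstance
instance : AddGroup (Words k A E) := inferInstance
instance : AddMonoid (Words k A E) := inferInstance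
instance : AddCommSemigroup (Words k A E) := inferInstance
instance : AddSemigroup (Words k A E) := inferInstance
instance : AddZeroClass (Words k A E) := inferInstance
instance : SubNegMonoid (Words k A E) := inferInstance
instance : Zero (Words k A E) := inferInstance
instance : Add (Words k A E) := inferInstance
instance : Neg (Words k A E) := inferInstance
instance : Sub (Words k A E) := inferInstance
instance : SMul ℤ (Words k A E) := inferInstance
instance : SMul ℕ (Words k A E) := inferInstance
instance : MulAction k (Words k A E) := inferInstance
instance : DistribMulAction k (Words k A E) := inferInstance
instance : DistribSMul k (Words k A E) := inferInstance
instance : SMulZeroClass k (Words k A E) := inferInstance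
instance : SMul k (Words k A E) := inferInstance

end shortcuts

/-- The word `a₀[e₁|⋯|eₙ]`, as a function of `a₀` and `e₁ ⋯ eₙ`. -/
def mkWord {A E : Type*} [AddCommGroup A] [Module k A] [AddCommGroup E] [Module k E] :
    A →ₗ[k] TensorAlgebra k E →ₗ[k] Words k A E := TensorProduct.mk k A (TensorAlgebra k E)

/-- Linear maps on words from bilinear maps. -/
def liftWord {A E N : Type*} [AddCommGroup A] [Module k A] [AddCommGroup E] [Module k E]
    [AddCommGroup N] [Module k N] (f : A →ₗ[k] TensorAlgebra k E →ₗ[k] N) : Words k A E →ₗ[k] N :=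
  TensorProduct.lift f

@[simp] theorem liftWord_mk {A E N : Type*} [AddCommGroup A] [Module k A] [AddCommGroup E]
    [Module k E] [AddCommGroup N] [Module k N] (f : A →ₗ[k] TensorAlgebra k E →ₗ[k] N) (a : A)
    (t : TensorAlgebra k E) : liftWord f (mkWord a t) = f a t :=
  TensorProduct.lift.tmul a t

theorem mkWord_induction {A E : Type*} [AddCommGroup A] [Module k A] [AddCommGroup E] [Module k E]
    {P : Words k A E → Prop} (h : ∀ a t, P (mkWord a t)) (hadd : ∀ x y, P x → P y → P (x + y))
    (x : Words k A E) : P x :=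
  TensorProduct.induction_on (motive := fun x => P x) x
    (show P 0 by have := h 0 0; rwa [map_zero] at this) h hadd

/-- Concatenation `a₀[a₁|⋯|aₙ] ↦ a₀[a₁|⋯|aₙ|e₁|⋯|eₘ]`. -/
def appendWord {A E : Type*} [AddCommGroup A] [Module k A] [AddCommGroup E] [Module k E] :
    TensorAlgebra k E →ₗ[k] Words k A E →ₗ[k] Words k A E where
  toFun t := liftWord (mkWord.compl₂ (LinearMap.mulRight k t))
  map_add' s t := LinearMap.ext fun x => by
    induction x using mkWord_induction with
    | h a u => simp [mul_add]
    | hadd x y hx hy => simp only [map_add, hx, hy]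
  map_smul' c t := LinearMap.ext fun x => by
    induction x using mkWord_induction with
    | h a u => simp
    | hadd x y hx hy => simp only [map_add, hx, hy]

@[simp] theorem appendWord_mk {A E : Type*} [AddCommGroup A] [Module k A] [AddCommGroup E]
    [Module k E] (t u : TensorAlgebra k E) (a : A) :
    appendWord t (mkWord a u) = mkWord a (u * t) := by
  simp [appendWord]

/-- Appending a letter: `a₀[a₁|⋯|aₙ] ↦ a₀[a₁|⋯|aₙ|e]`. -/
def snoc {A E : Type*} [AddCommGroup A] [Module k A] [AddCommGroup E] [Module k E] :
    E →ₗ[k] Words k A E →ₗ[k] Words k A E :=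
  appendWord ∘ₗ TensorAlgebra.ι k

section recursor

variable {A E N : Type*} [AddCommGroup A] [Module k A] [AddCommGroup E] [Module k E]
  [AddCommGroup N] [Module k N]

/-- The word `a[]` of length zero. -/
def nil : A →ₗ[k] Words k A E :=
  mkWord.flip 1

/-- Auxiliary to `wordRec`. -/
def recStep (s₁ : E →ₗ[k] Words k A E →ₗ[k] N) (s₂ : E →ₗ[k] N →ₗ[k] N) :
    E →ₗ[k] (Module.End k (Words k A E × N))ᵐᵒᵖ :=
  (MulOpposite.opLinearEquiv k).toLinearMap ∘ₗ
    { toFun := fun e => LinearMap.prod (snoc e ∘ₗ LinearMap.fst k _ _)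
        (s₁ e ∘ₗ LinearMap.fst k _ _ + s₂ e ∘ₗ LinearMap.snd k _ _)
      map_add' := fun e e' => by
        ext <;> simp
      map_smul' := fun c e => by
        ext <;> simp }

/-- Recursion on words: the linear map `f` with `f (a₀[]) = f₀ a₀` and
`f (w[e]) = s₁ e w + s₂ e (f w)`, where `w[e]` is the word `w` with the letter `e` appended. -/
def wordRec (f₀ : A →ₗ[k] N) (s₁ : E →ₗ[k] Words k A E →ₗ[k] N)
    (s₂ : E →ₗ[k] N →ₗ[k] N) : Words k A E →ₗ[k] N :=
  liftWord
    { toFun := fun a => LinearMap.snd k _ _ ∘ₗ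
        LinearMap.applyₗ ((mkWord a (1 : TensorAlgebra k E), f₀ a)) ∘ₗ
        (MulOpposite.opLinearEquiv k).symm.toLinearMap ∘ₗ
        (TensorAlgebra.lift k (recStep s₁ s₂)).toLinearMap
      map_add' := fun a b => by
        ext t
        simp only [LinearMap.comp_apply, LinearMap.add_apply, map_add,
          ← Prod.mk_add_mk]
      map_smul' := fun c a => by
        ext t
        simp only [LinearMap.comp_apply, LinearMap.smul_apply,
          RingHom.id_apply, map_smul, ← Prod.smul_mk] }

theorem snoc_mk (e : E) (a : A) (t : TensorAlgebra k E) :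
    snoc e (mkWord a t) = mkWord a (t * TensorAlgebra.ι k e) := by
  simp [snoc]

/-- Induction on words. -/
theorem word_induction {P : Words k A E → Prop}
    (h₀ : ∀ a : A, P (nil a)) (h₁ : ∀ w e, P w → P (snoc e w))
    (hadd : ∀ x y, P x → P y → P (x + y)) (hsmul : ∀ (c : k) x, P x → P (c • x)) (x) : P x := by
  have key : ∀ t : TensorAlgebra k E, ∀ x : Words k A E, P x → P (appendWord t x) := by
    intro t
    induction t using TensorAlgebra.induction with
    | algebraMap r =>
      intro x hx
      have : appendWord (algebraMap k (TensorAlgebra k E) r) x = r • x := by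
        clear hx
        induction x using mkWord_induction with
        | h a u => simp [Algebra.algebraMap_eq_smul_one]
        | hadd x y hx hy => simp only [map_add, hx, hy, smul_add]
      rw [this]
      exact hsmul r x hx
    | ι e => exact fun x hx => h₁ x e hx
    | mul a b ha hb =>
      intro x hx
      have : appendWord (a * b) x = appendWord b (appendWord a x) := by
        clear hx
        induction x using mkWord_induction with
        | h c u => simp [mul_assoc]
        | hadd x y hx hy => simp only [map_add, hx, hy]
      rw [this]
      exact hb _ (ha _ hx)
    | add a b ha hb =>
      intro x hx
      rw [map_add]
      exact hadd _ _ (ha _ hx) (hb _ hx)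
  induction x using mkWord_induction with
  | hadd x y hx hy => exact hadd _ _ hx hy
  | h a t => simpa [nil] using key t _ (h₀ a)

theorem wordRec_nil (f₀ : A →ₗ[k] N) (s₁ : E →ₗ[k] Words k A E →ₗ[k] N)
    (s₂ : E →ₗ[k] N →ₗ[k] N) (a : A) : wordRec f₀ s₁ s₂ (nil a) = f₀ a := by
  simp [wordRec, nil]

theorem wordRec_snoc (f₀ : A →ₗ[k] N) (s₁ : E →ₗ[k] Words k A E →ₗ[k] N)
    (s₂ : E →ₗ[k] N →ₗ[k] N) (e : E) (w : Words k A E) :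
    wordRec f₀ s₁ s₂ (snoc e w) = s₁ e w + s₂ e (wordRec f₀ s₁ s₂ w) := by
  have fst : ∀ (a : A) (t : TensorAlgebra k E) (n : N) (b : TensorAlgebra k E),
      ((MulOpposite.unop (TensorAlgebra.lift k (recStep s₁ s₂) t)) (mkWord a b, n)).1 =
        mkWord a (b * t) := by
    intro a t
    induction t using TensorAlgebra.induction with
    | algebraMap r => simp [Algebra.algebraMap_eq_smul_one]
    | ι e => simp [recStep, snoc_mk]
    | mul x y hx hy =>
      intro n b
      rw [map_mul, MulOpposite.unop_mul, Module.End.mul_apply, ← mul_assoc, ← hy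
        ((MulOpposite.unop (TensorAlgebra.lift k (recStep s₁ s₂) x)) (mkWord a b, n)).2, ← hx n]
    | add x y hx hy => intro n b; simp [hx, hy, mul_add]
  induction w using mkWord_induction with
  | hadd x y hx hy => simp only [map_add, hx, hy]; abel
  | h a t =>
    rw [snoc_mk]
    have := fst a t (f₀ a) 1
    rw [one_mul] at this
    have hr : recStep s₁ s₂ e = MulOpposite.op (LinearMap.prod (snoc e ∘ₗ LinearMap.fst k _ _)
        (s₁ e ∘ₗ LinearMap.fst k _ _ + s₂ e ∘ₗ LinearMap.snd k _ _)) := rfl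
    simp [wordRec, hr, this]

/-- `HWord gA gE n w`: the element `w` is a word `a₀[a₁|⋯|aᵣ]` with homogeneous `a₀, …, aᵣ` and
`|a₀| + ∑ (|aᵢ| - 1) = n`. -/
inductive HWord (gA : ℤ → Submodule k A) (gE : ℤ → Submodule k E) :
    ℤ → Words k A E → Prop
  | nil {n : ℤ} {a : A} (ha : a ∈ gA n) : HWord gA gE n (nil a)
  | snoc {n m : ℤ} {w : Words k A E} {e : E} (hw : HWord gA gE n w)
      (he : e ∈ gE m) : HWord gA gE (n + m - 1) (snoc e w)

/-- The part of total degree `n` of `A ⊗ T(sE)`. -/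
def wgr (gA : ℤ → Submodule k A) (gE : ℤ → Submodule k E) (n : ℤ) :
    Submodule k (Words k A E) :=
  Submodule.span k {w | HWord gA gE n w}

end recursor

/-- Morphisms of augmented DGAs. -/
structure DGHom (A : AugDGA.{u, v} k) (B : AugDGA.{u, w} k) where
  toAlgHom : A →ₐ[k] B
  map_mem : ∀ {n : ℤ} {a : A}, a ∈ A.gr n → toAlgHom a ∈ B.gr n
  map_d : ∀ a : A, toAlgHom (A.d a) = B.d (toAlgHom a)
  map_aug : ∀ a : A, B.aug (toAlgHom a) = A.aug a

instance (A : AugDGA.{u, v} k) (B : AugDGA.{u, w} k) : CoeFun (DGHom A B) (fun _ => A → B) :=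
  ⟨fun φ => φ.toAlgHom⟩

/-- The identity morphism. -/
def DGHom.id (A : AugDGA.{u, v} k) : DGHom A A where
  toAlgHom := AlgHom.id k A
  map_mem h := h
  map_d _ := rfl
  map_aug _ := rfl

/-- The degree `p` part of `Der(A, B)`, where `B` is an `A`-module through `φ`: linear maps `θ` of
degree `p` with `θ(ab) = θ(a) φ(b) + (-1) ^ (p |a|) φ(a) θ(b)`. -/
def derSub {A : AugDGA.{u, v} k} {B : AugDGA.{u, w} k} (φ : DGHom A B) (p : ℤ) :
    Submodule k (A →ₗ[k] B) where
  carrier := {θ | (∀ (n : ℤ) (a : A), a ∈ A.gr n → θ a ∈ B.gr (n + p)) ∧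
    ∀ (n : ℤ) (a b : A), a ∈ A.gr n → θ (a * b) = θ a * φ b + (-1 : k) ^ (p * n) • (φ a * θ b)}
  add_mem' := by
    rintro θ η ⟨h1, h2⟩ ⟨h3, h4⟩
    refine ⟨fun n a ha => add_mem (h1 n a ha) (h3 n a ha), fun n a b ha => ?_⟩
    simp only [LinearMap.add_apply, h2 n a b ha, h4 n a b ha, add_mul, mul_add, smul_add]
    abel
  zero_mem' := by simp
  smul_mem' := by
    rintro c θ ⟨h1, h2⟩
    refine ⟨fun n a ha => Submodule.smul_mem _ _ (h1 n a ha), fun n a b ha => ?_⟩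
    simp only [LinearMap.smul_apply, h2 n a b ha, smul_add, smul_mul_assoc, mul_smul_comm]
    rw [smul_comm]

/-- `A ⊗ T(sA)`, whose elements `a₀ ⊗ (a₁ ⋯ aₙ)` are written as words `a₀[a₁|⋯|aₙ]`. Here all
letters lie in `A`; the operators on the Hochschild complex `A ⊗ T(sĀ)` below are obtained by
evaluating their formulas here and projecting the letters to the augmentation ideal `Ā`.
The degree of a word is `|a₀[a₁|⋯|aₙ]| = |a₀| + ∑ |saᵢ|` with `|sa| = |a| - 1`. -/
abbrev UHoch (A : AugDGA.{u, v} k) := Words k A A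

section unnormalized

variable (A : AugDGA.{u, v} k)

/-- `w ↦ (-1) ^ (p * |w|) w`. -/
def signU (p : ℤ) : UHoch A →ₗ[k] UHoch A :=
  wordRec (nil ∘ₗ A.sgn p) 0 ((-1 : k) ^ p • (snoc ∘ₗ A.sgn p))

/-- Multiplying the last entry of a word by `a`, with the sign of the Hochschild differential:
`a₀[] ↦ (-1) ^ |a₀| (a₀a)[]` and `w[b] ↦ (-1) ^ (|w| + |sb|) w[ba]`. -/
def mergeU : UHoch A →ₗ[k] A →ₗ[k] UHoch A :=
  wordRec (LinearMap.llcomp k A A (UHoch A) nil ∘ₗ LinearMap.mul k A ∘ₗ A.sgn 1)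
    (LinearMap.mk₂ k (fun b w => (snoc.flip (signU A 1 w)) ∘ₗ (-(LinearMap.mul k A (A.sgn 1 b))))
      (by intros; ext; simp; abel) (by intros; ext; simp)
      (by intros; ext; simp; abel) (by intros; ext; simp)) 0

/-- The part of the Hochschild differential without the cyclic term, determined by
`a₀[] ↦ (d a₀)[]` and `D(w[a]) = D(w)[a] - (-1) ^ |w| w[d a] + w·a`, where `w·a` is `mergeU`.
With `εᵢ = |a₀| + ∑_{j < i} |saⱼ|` this is the sum of `(d a₀)[a₁|⋯|aₙ]`,
`(-1) ^ (εᵢ + 1) a₀[a₁|⋯|d aᵢ|⋯|aₙ]` for `0 < i ≤ n`, `(-1) ^ |a₀| a₀a₁[a₂|⋯|aₙ]` and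
`(-1) ^ ε_{i+1} a₀[a₁|⋯|aᵢaᵢ₊₁|⋯|aₙ]` for `0 < i < n`. -/
def dbarU : UHoch A →ₗ[k] UHoch A :=
  wordRec (nil ∘ₗ A.d) (-((snoc ∘ₗ A.d).compl₂ (signU A 1)) + (mergeU A).flip) snoc

/-- Left multiplication on the zeroth entry. -/
def lmulU : A →ₗ[k] UHoch A →ₗ[k] UHoch A :=
  LinearMap.mk₂ k (fun a w => liftWord (mkWord ∘ₗ LinearMap.mulLeft k a) w)
    (fun a b w => by
      induction w using mkWord_induction with
      | h c u => simp [add_mul]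
      | hadd x y hx hy => simp only [map_add, hx, hy]; abel)
    (fun c a w => by
      induction w using mkWord_induction with
      | h b u => simp
      | hadd x y hx hy => simp only [map_add, hx, hy, smul_add])
    (by intros; simp) (by intros; simp)

/-- The map `a ↦ (w ↦ (-1) ^ (|w| |sa|) a w)`. -/
def rotU : A →ₗ[k] UHoch A →ₗ[k] UHoch A :=
  DirectSum.toModule k ℤ (UHoch A →ₗ[k] UHoch A)
      (fun m => ((lmulU A).compl₂ (signU A (m - 1))) ∘ₗ (A.gr m).subtype) ∘ₗ
    (DirectSum.decomposeLinearEquiv A.gr).toLinearMap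

/-- The cyclic term
`a₀[a₁|⋯|aₙ] ↦ (-1) ^ (εₙ |saₙ| + 1) aₙa₀[a₁|⋯|aₙ₋₁]` of the Hochschild differential, which is zero
on words `a₀[]`. -/
def cycU : UHoch A →ₗ[k] UHoch A := wordRec 0 (-(rotU A)) 0

/-- The Hochschild differential `d = d₁ + d₂` on words with letters in `A`. -/
def dU : UHoch A →ₗ[k] UHoch A := dbarU A + cycU A

/-- The projection `w ↦ a₀` if `w = a₀[]` and `w ↦ 0` on longer words. -/
def headU : UHoch A →ₗ[k] A := wordRec LinearMap.id 0 0

variable {A} {B : AugDGA.{u, w} k} (φ : DGHom A B)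

/-- The map `a₀[a₁|⋯|aₙ] ↦ φ(a₀)[φ(a₁)|⋯|φ(aₙ)]`. -/
def mapU : UHoch A →ₗ[k] UHoch B :=
  wordRec (nil ∘ₗ φ.toAlgHom.toLinearMap) 0 (snoc ∘ₗ φ.toAlgHom.toLinearMap)

/-- The Lie derivative of a derivation `θ` of degree `p`: the sum of `θ(a₀)[φ(a₁)|⋯|φ(aₙ)]` and of
`(-1) ^ (p (εᵢ + 1)) φ(a₀)[φ(a₁)|⋯|θ(aᵢ)|⋯|φ(aₙ)]` for `1 ≤ i ≤ n`. -/
def LU (p : ℤ) (θ : A →ₗ[k] B) : UHoch A →ₗ[k] UHoch B :=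
  wordRec (nil ∘ₗ θ) ((-1 : k) ^ p • ((snoc ∘ₗ θ).compl₂ (mapU φ ∘ₗ signU A p)))
    (snoc ∘ₗ φ.toAlgHom.toLinearMap)

/-- The contraction with a derivation `θ` of degree `p`: zero on words `a₀[]`, and
`a₀[a₁|⋯|aₙ] ↦ (-1) ^ (p |a₀| + p + |a₀|) φ(a₀)θ(a₁)[φ(a₂)|⋯|φ(aₙ)]` for `n ≥ 1`. -/
def eU (p : ℤ) (θ : A →ₗ[k] B) : UHoch A →ₗ[k] UHoch B :=
  wordRec 0
    ((-1 : k) ^ p • ((LinearMap.llcomp k B B (UHoch B) nil ∘ₗ LinearMap.mul k B ∘ₗ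
      φ.toAlgHom.toLinearMap ∘ₗ A.sgn (p + 1) ∘ₗ headU A).compl₂ θ).flip)
    (snoc ∘ₗ φ.toAlgHom.toLinearMap)


section lemmas

variable (A)

@[simp] theorem signU_nil (p : ℤ) (a : A) : signU A p (nil a) = nil (A.sgn p a) := by
  simp [signU, wordRec_nil]

@[simp] theorem signU_snoc (p : ℤ) (e : A) (w : UHoch A) :
    signU A p (snoc e w) = (-1 : k) ^ p • snoc (A.sgn p e) (signU A p w) := by
  simp [signU, wordRec_snoc]

@[simp] theorem mergeU_nil (a b : A) : mergeU A (nil a) b = nil (A.sgn 1 a * b) := by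
  simp [mergeU, wordRec_nil]

@[simp] theorem mergeU_snoc (a b : A) (w : UHoch A) :
    mergeU A (snoc a w) b = -snoc (A.sgn 1 a * b) (signU A 1 w) := by
  simp [mergeU, wordRec_snoc]

@[simp] theorem dbarU_nil (a : A) : dbarU A (nil a) = nil (A.d a) := by
  simp [dbarU, wordRec_nil]

@[simp] theorem dbarU_snoc (a : A) (w : UHoch A) :
    dbarU A (snoc a w) =
      snoc a (dbarU A w) - snoc (A.d a) (signU A 1 w) + mergeU A w a := by
  simp [dbarU, wordRec_snoc]; abel

@[simp] theorem cycU_nil (a : A) : cycU A (nil a) = 0 := by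
  simp [cycU, wordRec_nil]

@[simp] theorem cycU_snoc (a : A) (w : UHoch A) : cycU A (snoc a w) = -rotU A a w := by
  simp [cycU, wordRec_snoc]

@[simp] theorem lmulU_nil (a b : A) : lmulU A a (nil b) = nil (a * b) := by
  simp [lmulU, nil]

@[simp] theorem lmulU_snoc (a b : A) (w : UHoch A) :
    lmulU A a (snoc b w) = snoc b (lmulU A a w) := by
  induction w using mkWord_induction with
  | hadd x y hx hy => simp only [map_add, hx, hy]
  | h x t => simp [lmulU, snoc_mk]

theorem rotU_apply {m : ℤ} {a : A} (ha : a ∈ A.gr m) (w : UHoch A) :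
    rotU A a w = lmulU A a (signU A (m - 1) w) := by
  simp only [rotU, LinearMap.comp_apply, LinearEquiv.coe_coe, DirectSum.decomposeLinearEquiv_apply]
  rw [DirectSum.decompose_of_mem _ ha]
  erw [DirectSum.toModule_lof]
  simp

@[simp] theorem headU_nil (a : A) : headU A (nil a) = a := by simp [headU, wordRec_nil]

@[simp] theorem headU_snoc (a : A) (w : UHoch A) : headU A (snoc a w) = 0 := by
  simp [headU, wordRec_snoc]

variable {A}

@[simp] theorem mapU_nil (a : A) : mapU φ (nil a) = nil (φ a) := by simp [mapU, wordRec_nil]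

@[simp] theorem mapU_snoc (a : A) (w : UHoch A) : mapU φ (snoc a w) = snoc (φ a) (mapU φ w) := by
  simp [mapU, wordRec_snoc]

@[simp] theorem LU_nil (p : ℤ) (θ : A →ₗ[k] B) (a : A) : LU φ p θ (nil a) = nil (θ a) := by
  simp [LU, wordRec_nil]

@[simp] theorem LU_snoc (p : ℤ) (θ : A →ₗ[k] B) (a : A) (w : UHoch A) :
    LU φ p θ (snoc a w) =
      snoc (φ a) (LU φ p θ w) + (-1 : k) ^ p • snoc (θ a) (mapU φ (signU A p w)) := by
  simp [LU, wordRec_snoc]; abel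

@[simp] theorem eU_nil (p : ℤ) (θ : A →ₗ[k] B) (a : A) : eU φ p θ (nil a) = 0 := by
  simp [eU, wordRec_nil]

@[simp] theorem eU_snoc (p : ℤ) (θ : A →ₗ[k] B) (a : A) (w : UHoch A) :
    eU φ p θ (snoc a w) = snoc (φ a) (eU φ p θ w) +
      (-1 : k) ^ p • nil (φ (A.sgn (p + 1) (headU A w)) * θ a) := by
  simp [eU, wordRec_snoc]; abel

/-! ### Degrees -/

theorem nil_mem {n : ℤ} {a : A} (ha : a ∈ A.gr n) : (nil a : UHoch A) ∈ wgr A.gr A.gr n :=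
  Submodule.subset_span (HWord.nil ha)

theorem snoc_mem {n m r : ℤ} {a : A} {w : UHoch A} (ha : a ∈ A.gr m) (hw : w ∈ wgr A.gr A.gr n)
    (hr : n + m - 1 = r) : snoc a w ∈ wgr A.gr A.gr r := by
  subst hr
  refine Submodule.span_induction (p := fun w _ => snoc a w ∈ wgr A.gr A.gr (n + m - 1))
    (fun x hx => Submodule.subset_span (HWord.snoc hx ha)) (by simp) ?_ ?_ hw
  · intro x y _ _ hx hy; rw [map_add]; exact add_mem hx hy
  · intro c x _ hx; rw [map_smul]; exact Submodule.smul_mem _ _ hx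

theorem mem_cast {M : Type*} [AddCommGroup M] [Module k M] {g : ℤ → Submodule k M} {m n : ℤ}
    {x : M} (h : x ∈ g m) (e : m = n) : x ∈ g n := e ▸ h

theorem wgr_map {M : Type*} [AddCommGroup M] [Module k M] {A E : Type*} [AddCommGroup A]
    [Module k A] [AddCommGroup E] [Module k E] {gA : ℤ → Submodule k A} {gE : ℤ → Submodule k E}
    (f : Words k A E →ₗ[k] M) (S : Submodule k M) {n : ℤ}
    (h : ∀ w, HWord gA gE n w → f w ∈ S) {x} (hx : x ∈ wgr gA gE n) : f x ∈ S := by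
  have : wgr gA gE n ≤ S.comap f := Submodule.span_le.2 h
  exact this hx

theorem hword_ext {N : Type*} [AddCommGroup N] [Module k N] {f g : UHoch A →ₗ[k] N}
    (h : ∀ n w, HWord A.gr A.gr n w → f w = g w) : f = g := by
  have top : ∀ x : UHoch A, x ∈ Submodule.span k {w | ∃ n, HWord A.gr A.gr n w} := by
    intro x
    induction x using word_induction with
    | h₀ a =>
      change nil a ∈ _
      induction a using DirectSum.Decomposition.inductionOn A.gr with
      | zero => simp
      | homogeneous a => exact Submodule.subset_span ⟨_, HWord.nil a.2⟩
      | add a b ha hb => rw [map_add]; exact add_mem ha hb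
    | h₁ w e hw =>
      induction e using DirectSum.Decomposition.inductionOn A.gr with
      | zero => simp
      | homogeneous a =>
        refine Submodule.span_induction (p := fun w _ => snoc (a : A) w ∈ _) ?_ (by simp) ?_ ?_ hw
        · rintro x ⟨n, hx⟩; exact Submodule.subset_span ⟨_, HWord.snoc hx a.2⟩
        · intro x y _ _ hx hy; rw [map_add]; exact add_mem hx hy
        · intro c x _ hx; rw [map_smul]; exact Submodule.smul_mem _ _ hx
      | add a b ha hb => rw [map_add]; exact add_mem ha hb
    | hadd x y hx hy => exact add_mem hx hy
    | hsmul c x hx => exact Submodule.smul_mem _ _ hx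
  have hle : Submodule.span k {w | ∃ n, HWord A.gr A.gr n w} ≤ LinearMap.eqLocus f g :=
    Submodule.span_le.2 fun w ⟨n, hw⟩ => h n w hw
  exact LinearMap.ext fun x => hle (top x)


theorem wgr_cast {n m : ℤ} {x : UHoch A} (h : x ∈ wgr A.gr A.gr n) (e : n = m) :
    x ∈ wgr A.gr A.gr m := e ▸ h

theorem gr_cast {n m : ℤ} {x : A} (h : x ∈ A.gr n) (e : n = m) : x ∈ A.gr m := e ▸ h

theorem sgn_mem (p : ℤ) {n : ℤ} {a : A} (ha : a ∈ A.gr n) : A.sgn p a ∈ A.gr n := by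
  rw [A.sgn_apply p ha]; exact Submodule.smul_mem _ _ ha

theorem mul_mem' {n m r : ℤ} {a b : A} (ha : a ∈ A.gr n) (hb : b ∈ A.gr m) (hr : n + m = r) :
    a * b ∈ A.gr r := hr ▸ SetLike.mul_mem_graded ha hb

theorem signU_hword (p : ℤ) {n : ℤ} {w : UHoch A} (hw : HWord A.gr A.gr n w) :
    signU A p w = (-1 : k) ^ (p * n) • w := by
  induction hw with
  | nil ha => rw [signU_nil, A.sgn_apply p ha, map_smul]
  | @snoc n m w e hw he ih =>
    rw [signU_snoc, ih, A.sgn_apply p he]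
    simp only [map_smul, LinearMap.smul_apply, smul_smul]
    congr 1
    by_cases hp : Even p <;> by_cases hn : Even n <;> by_cases hm : Even m <;>
      simp [neg_one_zpow_eq_ite, Int.even_add, Int.even_mul, hp, hn, hm]

theorem signU_wgr (p : ℤ) {n : ℤ} {w : UHoch A} (hw : w ∈ wgr A.gr A.gr n) :
    signU A p w = (-1 : k) ^ (p * n) • w := by
  have : wgr A.gr A.gr n ≤ LinearMap.eqLocus (signU A p) ((-1 : k) ^ (p * n) • LinearMap.id) :=
    Submodule.span_le.2 fun w hw => signU_hword p hw
  exact this hw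

theorem HWord.mem {n : ℤ} {w : UHoch A} (hw : HWord A.gr A.gr n w) : w ∈ wgr A.gr A.gr n :=
  Submodule.subset_span hw

theorem signU_mem (p : ℤ) {n : ℤ} {w : UHoch A} (hw : w ∈ wgr A.gr A.gr n) :
    signU A p w ∈ wgr A.gr A.gr n := by
  rw [signU_wgr p hw]; exact Submodule.smul_mem _ _ hw

theorem lmulU_mem {n m : ℤ} {a : A} {w : UHoch A} (ha : a ∈ A.gr m) (hw : w ∈ wgr A.gr A.gr n) :
    lmulU A a w ∈ wgr A.gr A.gr (m + n) := by
  refine wgr_map (lmulU A a) (wgr A.gr A.gr (m + n)) (fun w hw => ?_) hw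
  clear * - hw ha
  induction hw with
  | nil hb => rw [lmulU_nil]; exact nil_mem (mul_mem' ha hb rfl)
  | snoc hw he ih => rw [lmulU_snoc]; exact snoc_mem he ih (by ring)

theorem rotU_mem {n m : ℤ} {a : A} {w : UHoch A} (ha : a ∈ A.gr m) (hw : w ∈ wgr A.gr A.gr n) :
    rotU A a w ∈ wgr A.gr A.gr (m + n) := by
  rw [rotU_apply A ha]; exact lmulU_mem ha (signU_mem _ hw)

theorem mergeU_mem {n m : ℤ} {a : A} {w : UHoch A} (ha : a ∈ A.gr m) (hw : w ∈ wgr A.gr A.gr n) :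
    mergeU A w a ∈ wgr A.gr A.gr (n + m) := by
  refine wgr_map ((mergeU A).flip a) (wgr A.gr A.gr (n + m)) (fun w hw => ?_) hw
  clear * - hw ha
  rw [LinearMap.flip_apply]
  cases hw with
  | nil hb => rw [mergeU_nil]; exact nil_mem (mul_mem' (sgn_mem _ hb) ha rfl)
  | snoc hw he =>
    rw [mergeU_snoc]
    exact neg_mem (snoc_mem (mul_mem' (sgn_mem _ he) ha rfl) (signU_mem _ hw.mem) (by ring))

theorem dbarU_mem {n : ℤ} {w : UHoch A} (hw : w ∈ wgr A.gr A.gr n) :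
    dbarU A w ∈ wgr A.gr A.gr (n + 1) := by
  refine wgr_map (dbarU A) (wgr A.gr A.gr (n + 1)) (fun w hw => ?_) hw
  clear * - hw
  induction hw with
  | nil hb => rw [dbarU_nil]; exact nil_mem (A.d_mem hb)
  | @snoc n m w e hw he ih =>
    rw [dbarU_snoc]
    exact add_mem (sub_mem (snoc_mem he ih (by ring))
      (snoc_mem (A.d_mem he) (signU_mem _ hw.mem) (by ring)))
      (wgr_cast (mergeU_mem he hw.mem) (by ring))

theorem cycU_mem {n : ℤ} {w : UHoch A} (hw : w ∈ wgr A.gr A.gr n) :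
    cycU A w ∈ wgr A.gr A.gr (n + 1) := by
  refine wgr_map (cycU A) (wgr A.gr A.gr (n + 1)) (fun w hw => ?_) hw
  clear * - hw
  cases hw with
  | nil hb => rw [cycU_nil]; exact zero_mem _
  | snoc hw he =>
    rw [cycU_snoc]
    exact neg_mem (wgr_cast (rotU_mem he hw.mem) (by ring))

theorem dU_mem {n : ℤ} {w : UHoch A} (hw : w ∈ wgr A.gr A.gr n) :
    dU A w ∈ wgr A.gr A.gr (n + 1) :=
  add_mem (dbarU_mem hw) (cycU_mem hw)

theorem mapU_mem {n : ℤ} {w : UHoch A} (hw : w ∈ wgr A.gr A.gr n) :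
    mapU φ w ∈ wgr B.gr B.gr n := by
  refine wgr_map (mapU φ) (wgr B.gr B.gr n) (fun w hw => ?_) hw
  clear * - hw
  induction hw with
  | nil hb => rw [mapU_nil]; exact nil_mem (φ.map_mem hb)
  | snoc hw he ih => rw [mapU_snoc]; exact snoc_mem (φ.map_mem he) ih rfl

theorem LU_mem {p : ℤ} {θ : A →ₗ[k] B} (hθ : θ ∈ derSub φ p) {n : ℤ} {w : UHoch A}
    (hw : w ∈ wgr A.gr A.gr n) : LU φ p θ w ∈ wgr B.gr B.gr (n + p) := by
  refine wgr_map (LU φ p θ) (wgr B.gr B.gr (n + p)) (fun w hw => ?_) hw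
  clear * - hw hθ
  induction hw with
  | nil hb => rw [LU_nil]; exact nil_mem (hθ.1 _ _ hb)
  | snoc hw he ih =>
    rw [LU_snoc]
    exact add_mem (snoc_mem (φ.map_mem he) ih (by ring)) (Submodule.smul_mem _ _
      (snoc_mem (hθ.1 _ _ he) (mapU_mem φ (signU_mem _ hw.mem)) (by ring)))

theorem headU_mem {n : ℤ} {w : UHoch A} (hw : HWord A.gr A.gr n w) : headU A w ∈ A.gr n := by
  cases hw with
  | nil hb => rwa [headU_nil]
  | snoc hw he => rw [headU_snoc]; exact zero_mem _

theorem eU_mem {p : ℤ} {θ : A →ₗ[k] B} (hθ : θ ∈ derSub φ p) {n : ℤ} {w : UHoch A}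
    (hw : w ∈ wgr A.gr A.gr n) : eU φ p θ w ∈ wgr B.gr B.gr (n + (p + 1)) := by
  refine wgr_map (eU φ p θ) (wgr B.gr B.gr (n + (p + 1))) (fun w hw => ?_) hw
  clear * - hw hθ
  induction hw with
  | nil hb => rw [eU_nil]; exact zero_mem _
  | snoc hw he ih =>
    rw [eU_snoc]
    exact add_mem (snoc_mem (φ.map_mem he) ih (by ring)) (Submodule.smul_mem _ _
      (nil_mem (mul_mem' (φ.map_mem (sgn_mem _ (headU_mem hw))) (hθ.1 _ _ he) (by ring))))


theorem sgn_one_map {n : ℤ} {a : A} (ha : a ∈ A.gr n) (p : ℤ) : B.sgn p (φ a) = φ (A.sgn p a) := by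
  rw [B.sgn_apply p (φ.map_mem ha), A.sgn_apply p ha, map_smul]

theorem mergeU_mapU {n m : ℤ} {w : UHoch A} {e : A} (hw : HWord A.gr A.gr n w) (he : e ∈ A.gr m) :
    mergeU B (mapU φ w) (φ e) = mapU φ (mergeU A w e) := by
  cases hw with
  | nil ha => simp [sgn_one_map φ ha]
  | snoc hw ha =>
    simp [sgn_one_map φ ha, signU_hword 1 hw, signU_wgr 1 (mapU_mem φ hw.mem)]

theorem dbarU_mapU {n : ℤ} {w : UHoch A} (hw : HWord A.gr A.gr n w) :
    dbarU B (mapU φ w) = mapU φ (dbarU A w) := by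
  induction hw with
  | nil ha => simp [φ.map_d]
  | snoc hw he ih =>
    simp [ih, mergeU_mapU φ hw he, ← φ.map_d, signU_hword 1 hw, signU_wgr 1 (mapU_mem φ hw.mem)]

theorem lmulU_mapU (a : A) {n : ℤ} {w : UHoch A} (hw : HWord A.gr A.gr n w) :
    lmulU B (φ a) (mapU φ w) = mapU φ (lmulU A a w) := by
  induction hw with
  | nil ha => simp
  | snoc hw he ih => simp [ih]

theorem cycU_mapU {n : ℤ} {w : UHoch A} (hw : HWord A.gr A.gr n w) :
    cycU B (mapU φ w) = mapU φ (cycU A w) := by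
  cases hw with
  | nil ha => simp
  | snoc hw he =>
    simp [rotU_apply A he, rotU_apply B (φ.map_mem he), signU_hword _ hw,
      signU_wgr _ (mapU_mem φ hw.mem), lmulU_mapU φ _ hw]

section L

variable {φ} {p : ℤ} {θ : A →ₗ[k] B}

theorem mergeU_LU (hθ : θ ∈ derSub φ p)
    {n m : ℤ} {w : UHoch A} {e : A} (hw : HWord A.gr A.gr n w) (he : e ∈ A.gr m) :
    mergeU B (LU φ p θ w) (φ e) + (-1 : k) ^ (p + p * n) • mergeU B (mapU φ w) (θ e) =
      (-1 : k) ^ p • LU φ p θ (mergeU A w e) := by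
  cases hw with
  | nil ha =>
    simp only [LU_nil, mergeU_nil, mapU_nil, A.sgn_apply 1 ha, B.sgn_apply 1 (hθ.1 _ _ ha),
      B.sgn_apply 1 (φ.map_mem ha), map_smul, smul_mul_assoc, hθ.2 _ _ _ ha, map_add]
    by_cases hp : Even p <;> by_cases hn : Even n <;>
      simp only [neg_one_zpow_eq_ite, Int.even_add, Int.even_sub, Int.even_mul, Int.not_even_one, ← Int.not_even_iff_odd,
        hp, hn, not_true_eq_false, not_false_eq_true, iff_self, iff_true, true_iff, iff_false, false_iff, true_or,
        or_true, false_or, or_false, ↓reduceIte, neg_smul, one_smul, smul_neg, neg_neg, one_mul, zero_add, smul_zero, smul_add, smul_sub] <;> abel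
  | @snoc n m' w b hw ha =>
    simp only [LU_snoc, mergeU_snoc, mapU_snoc, A.sgn_apply 1 ha, B.sgn_apply 1 (hθ.1 _ _ ha),
      B.sgn_apply 1 (φ.map_mem ha), map_smul, smul_mul_assoc, hθ.2 _ _ _ ha, map_add, map_neg,
      signU_hword _ hw, signU_wgr _ (mapU_mem φ hw.mem), signU_wgr _ (LU_mem φ hθ hw.mem),
      LinearMap.add_apply, LinearMap.smul_apply, map_mul]
    by_cases hp : Even p <;> by_cases hn : Even n <;> by_cases hm : Even m' <;>
      simp only [neg_one_zpow_eq_ite, Int.even_add, Int.even_sub, Int.even_mul, Int.not_even_one, ← Int.not_even_iff_odd,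
        hp, hn, hm, not_true_eq_false, not_false_eq_true, iff_self, iff_true, true_iff, iff_false, false_iff, true_or,
        or_true, false_or, or_false, ↓reduceIte, neg_smul, one_smul, smul_neg, neg_neg, one_mul, zero_add, smul_zero, smul_add, smul_sub] <;> abel

theorem dbarU_LU (hθ : θ ∈ derSub φ p) {n : ℤ} {w : UHoch A} (hw : HWord A.gr A.gr n w) :
    dbarU B (LU φ p θ w) = (-1 : k) ^ p • LU φ p θ (dbarU A w) +
      LU φ (p + 1) (B.d ∘ₗ θ - (-1 : k) ^ p • θ ∘ₗ A.d) w := by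
  induction hw with
  | nil ha => simp
  | @snoc n m w e hw he ih =>
    have h1 := mergeU_LU hθ hw he
    rw [LU_snoc, map_add, dbarU_snoc, ih, map_smul, dbarU_snoc, dbarU_snoc]
    rw [map_add (LU φ p θ), smul_add _ (LU φ p θ _), ← h1]
    simp only [map_smul, LU_snoc, mapU_snoc, map_add, map_neg, 
      signU_hword _ hw, signU_wgr _ (mapU_mem φ hw.mem), signU_wgr _ (LU_mem φ hθ hw.mem),
      signU_wgr _ (dbarU_mem hw.mem), LinearMap.add_apply, LinearMap.smul_apply, LinearMap.sub_apply, LinearMap.comp_apply,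
      dbarU_mapU φ hw, φ.map_d, map_sub]
    by_cases hp : Even p <;> by_cases hn : Even n <;>
      simp only [neg_one_zpow_eq_ite, Int.even_add, Int.even_sub, Int.even_mul, Int.not_even_one, ← Int.not_even_iff_odd,
        hp, hn, not_true_eq_false, not_false_eq_true, iff_self, iff_true, true_iff, iff_false, false_iff, true_or,
        or_true, false_or, or_false, ↓reduceIte, neg_smul, one_smul, smul_neg, neg_neg, one_mul, zero_add, smul_zero, smul_add, smul_sub] <;> abel

theorem LU_lmulU (hθ : θ ∈ derSub φ p)
    {n m : ℤ} {w : UHoch A} {a : A} (hw : HWord A.gr A.gr n w) (ha : a ∈ A.gr m) :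
    LU φ p θ (lmulU A a w) = lmulU B (θ a) (mapU φ w) +
      (-1 : k) ^ (p * m) • lmulU B (φ a) (LU φ p θ w) := by
  induction hw with
  | nil hb => simp [hθ.2 _ _ _ ha]
  | @snoc n m' w b hw hb ih =>
    simp only [lmulU_snoc, LU_snoc, mapU_snoc, ih, map_add, map_smul, smul_add,
      signU_wgr _ (lmulU_mem ha hw.mem), signU_hword _ hw, lmulU_mapU φ a hw, LinearMap.smul_apply]
    rw [← lmulU_mapU φ a hw]
    by_cases hp : Even p <;> by_cases hn : Even n <;> by_cases hm : Even m <;>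
      simp only [neg_one_zpow_eq_ite, Int.even_add, Int.even_sub, Int.even_mul, Int.not_even_one, ← Int.not_even_iff_odd,
        hp, hn, hm, not_true_eq_false, not_false_eq_true, iff_self, iff_true, true_iff, iff_false, false_iff, true_or,
        or_true, false_or, or_false, ↓reduceIte, neg_smul, one_smul, smul_neg, neg_neg, one_mul, zero_add, smul_zero, smul_add, smul_sub] <;> abel

theorem cycU_LU (hθ : θ ∈ derSub φ p) {n : ℤ} {w : UHoch A} (hw : HWord A.gr A.gr n w) :
    cycU B (LU φ p θ w) = (-1 : k) ^ p • LU φ p θ (cycU A w) := by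
  cases hw with
  | nil ha => simp
  | @snoc n m w e hw he =>
    simp only [LU_snoc, cycU_snoc, map_add, map_smul, rotU_apply A he, rotU_apply B (φ.map_mem he),
      rotU_apply B (hθ.1 _ _ he), signU_hword _ hw, signU_wgr _ (mapU_mem φ hw.mem),
      signU_wgr _ (LU_mem φ hθ hw.mem), map_neg, LU_lmulU hθ hw he]
    by_cases hp : Even p <;> by_cases hn : Even n <;> by_cases hm : Even m <;>
      simp only [neg_one_zpow_eq_ite, Int.even_add, Int.even_sub, Int.even_mul, Int.not_even_one, ← Int.not_even_iff_odd,
        hp, hn, hm, not_true_eq_false, not_false_eq_true, iff_self, iff_true, true_iff, iff_false, false_iff, true_or,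
        or_true, false_or, or_false, ↓reduceIte, neg_smul, one_smul, smul_neg, neg_neg, one_mul, zero_add, smul_zero, smul_add, smul_sub] <;> abel

theorem dU_LU (hθ : θ ∈ derSub φ p) : dU B ∘ₗ LU φ p θ - (-1 : k) ^ p • LU φ p θ ∘ₗ dU A =
    LU φ (p + 1) (B.d ∘ₗ θ - (-1 : k) ^ p • θ ∘ₗ A.d) := by
  refine hword_ext fun n w hw => ?_
  simp only [dU, LinearMap.sub_apply, LinearMap.comp_apply, LinearMap.add_apply,
    LinearMap.smul_apply, map_add, dbarU_LU hθ hw, cycU_LU hθ hw, smul_add]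
  abel

end L

theorem head_mergeU {n : ℤ} {w : UHoch A} (hw : HWord A.gr A.gr n w) (a : A) :
    headU A (mergeU A w a) = (-1 : k) ^ n • (headU A w * a) := by
  cases hw with
  | nil ha => simp [A.sgn_apply 1 ha]
  | snoc hw he => simp

section e

variable {φ} {p : ℤ} {θ : A →ₗ[k] B}

theorem dbarU_eU (hθ : θ ∈ derSub φ p) {n : ℤ} {w : UHoch A} (hw : HWord A.gr A.gr n w) :
    dbarU B (eU φ p θ w) = (-1 : k) ^ (p + 1) • eU φ p θ (dbarU A w) -
      eU φ (p + 1) (B.d ∘ₗ θ - (-1 : k) ^ p • θ ∘ₗ A.d) w := by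
  induction hw with
  | nil ha => simp
  | @snoc n m w e hw he ih =>
    cases hw with
    | @nil n a ha =>
      simp only [eU_snoc, eU_nil, dbarU_snoc, dbarU_nil, map_add, map_smul, map_zero, headU_nil,
        mergeU_nil, A.sgn_apply _ ha, A.sgn_apply _ (A.d_mem ha), B.leibniz (φ.map_mem ha),
        signU_nil, smul_mul_assoc, φ.map_d, map_sub, LinearMap.sub_apply, LinearMap.comp_apply,
        LinearMap.smul_apply, mul_sub, mul_smul_comm]
      by_cases hp : Even p <;> by_cases hn : Even n <;>
        simp only [neg_one_zpow_eq_ite, Int.even_add, Int.even_sub, Int.even_mul, Int.not_even_one, ← Int.not_even_iff_odd,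
        hp, hn, not_true_eq_false, not_false_eq_true, iff_self, iff_true, true_iff, iff_false, false_iff, true_or,
        or_true, false_or, or_false, ↓reduceIte, neg_smul, one_smul, smul_neg, neg_neg, one_mul, zero_add, smul_zero, smul_add, smul_sub] <;> abel
    | @snoc n l w b hw hb =>
      have hhead := head_mergeU hw b
      have hdm := B.sgn_apply 1 (mul_mem' (φ.map_mem (headU_mem hw)) (hθ.1 _ _ hb) rfl)
      have hheadX : headU A (dbarU A (snoc b w)) = (-1 : k) ^ n • (headU A w * b) := by
        simp [hhead]
      generalize B.d ∘ₗ θ - (-1 : k) ^ p • θ ∘ₗ A.d = η at ih ⊢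
      have hη : eU φ (p + 1) η (snoc e (snoc b w)) =
          snoc (φ e) (eU φ (p + 1) η (snoc b w)) := by simp
      rw [dbarU_snoc A e, hη, eU_snoc, map_add, dbarU_snoc, ih]
      generalize eU φ (p + 1) η (snoc b w) = Y
      clear ih hη
      generalize dbarU A (snoc b w) = X at hheadX ⊢
      simp only [eU_snoc, map_add, map_smul, map_zero, map_neg, headU_snoc, hheadX,
        mergeU_snoc, mergeU_nil, map_sub, LinearMap.add_apply, LinearMap.smul_apply,
        smul_mul_assoc, zero_mul, A.sgn_apply _ hb, A.sgn_apply _ (headU_mem hw),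
        A.sgn_apply _ (mul_mem' (headU_mem hw) hb rfl), hdm,
        B.sgn_apply _ (φ.map_mem hb), signU_snoc, signU_nil,
        signU_hword _ hw, signU_wgr _ (eU_mem φ hθ hw.mem), hθ.2 _ _ _ hb, mul_add,
        mul_smul_comm, map_mul, φ.map_d]
      by_cases hp : Even p <;> by_cases hn : Even n <;> by_cases hm : Even l <;>
        simp only [neg_one_zpow_eq_ite, Int.even_add, Int.even_sub, Int.even_mul, Int.not_even_one, ← Int.not_even_iff_odd,
        hp, hn, hm, not_true_eq_false, not_false_eq_true, iff_self, iff_true, true_iff, iff_false, false_iff, true_or,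
        or_true, false_or, or_false, ↓reduceIte, neg_smul, one_smul, smul_neg, neg_neg, one_mul, zero_add, smul_zero, smul_add, smul_sub, mul_assoc] <;> abel

theorem eU_lmulU (hθ : θ ∈ derSub φ p)
    {n m : ℤ} {w : UHoch A} {a : A} (hw : HWord A.gr A.gr n w) (ha : a ∈ A.gr m) :
    eU φ p θ (lmulU A a w) = (-1 : k) ^ ((p + 1) * m) • lmulU B (φ a) (eU φ p θ w) := by
  induction hw with
  | nil hb => simp
  | @snoc n m' w b hw hb ih =>
    have hhead : headU A (lmulU A a w) = a * headU A w := by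
      cases hw with
      | nil ha => simp
      | snoc hw he => simp
    rw [lmulU_snoc, eU_snoc, eU_snoc, ih, hhead, A.sgn_apply _ (headU_mem hw),
      A.sgn_apply _ (mul_mem' ha (headU_mem hw) rfl)]
    simp only [map_add, map_smul, smul_mul_assoc, lmulU_snoc, lmulU_nil, map_mul, mul_assoc]
    by_cases hp : Even p <;> by_cases hn : Even n <;> by_cases hm : Even m <;>
      simp [neg_one_zpow_eq_ite, Int.even_add, Int.even_mul, ← Int.not_even_iff_odd, hp, hn, hm]

theorem cycU_eU (hθ : θ ∈ derSub φ p) {n : ℤ} {w : UHoch A} (hw : HWord A.gr A.gr n w) :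
    cycU B (eU φ p θ w) = (-1 : k) ^ (p + 1) • eU φ p θ (cycU A w) := by
  cases hw with
  | nil ha => simp
  | @snoc n m w e hw he =>
    simp only [eU_snoc, cycU_snoc, cycU_nil, map_add, map_smul, rotU_apply A he,
      rotU_apply B (φ.map_mem he), signU_hword _ hw,
      signU_wgr _ (eU_mem φ hθ hw.mem), map_neg, eU_lmulU hθ hw he]
    by_cases hp : Even p <;> by_cases hn : Even n <;> by_cases hm : Even m <;>
      simp [neg_one_zpow_eq_ite, Int.even_add, Int.even_sub, Int.even_mul,
        ← Int.not_even_iff_odd, hp, hn, hm]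

theorem dU_eU (hθ : θ ∈ derSub φ p) : dU B ∘ₗ eU φ p θ - (-1 : k) ^ (p + 1) • eU φ p θ ∘ₗ dU A =
    -eU φ (p + 1) (B.d ∘ₗ θ - (-1 : k) ^ p • θ ∘ₗ A.d) := by
  refine hword_ext fun n w hw => ?_
  simp only [dU, LinearMap.sub_apply, LinearMap.comp_apply, LinearMap.add_apply,
    LinearMap.smul_apply, map_add, dbarU_eU hθ hw, cycU_eU hθ hw, smul_add, LinearMap.neg_apply]
  abel

end e

theorem mergeU_mergeU {n l : ℤ} {w : UHoch A} {b : A} (hw : HWord A.gr A.gr n w)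
    (hb : b ∈ A.gr l) (a : A) :
    mergeU A (mergeU A w b) a = (-1 : k) ^ (l + n) • mergeU A w (b * a) := by
  cases hw with
  | @nil n c hc =>
    simp only [mergeU_nil, A.sgn_apply _ hc, smul_mul_assoc, map_smul]
    rw [LinearMap.smul_apply, mergeU_nil, A.sgn_apply _ (mul_mem' hc hb rfl), smul_mul_assoc,
      map_smul]
    by_cases hp : Even l <;> by_cases hn : Even n <;>
      simp [neg_one_zpow_eq_ite, Int.even_add, hp, hn, mul_assoc]
  | @snoc n m w c hw hc =>
    simp only [mergeU_snoc, map_neg, LinearMap.neg_apply, A.sgn_apply _ hc, smul_mul_assoc,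
      map_smul, LinearMap.smul_apply, A.sgn_apply _ (mul_mem' hc hb rfl),
      signU_hword _ hw]
    by_cases hp : Even l <;> by_cases hn : Even n <;> by_cases hm : Even m <;>
      simp [neg_one_zpow_eq_ite, Int.even_add, Int.even_sub, ← Int.not_even_iff_odd, hp, hn, hm,
        mul_assoc]

theorem dbarU_mergeU {n m : ℤ} {w : UHoch A} {a : A} (hw : HWord A.gr A.gr n w)
    (ha : a ∈ A.gr m) :
    dbarU A (mergeU A w a) = (-1 : k) ^ n • mergeU A w (A.d a) - mergeU A (dbarU A w) a := by
  cases hw with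
  | @nil n c hc =>
    simp only [mergeU_nil, dbarU_nil, A.sgn_apply _ hc, A.sgn_apply _ (A.d_mem hc),
      smul_mul_assoc, map_smul, A.leibniz hc, smul_add, map_add]
    by_cases hn : Even n <;>
      simp only [neg_one_zpow_eq_ite, Int.even_add, Int.even_sub, Int.even_mul, Int.not_even_one, ← Int.not_even_iff_odd,
        hn, not_true_eq_false, not_false_eq_true, iff_self, iff_true, true_iff, iff_false, false_iff, true_or,
        or_true, false_or, or_false, ↓reduceIte, neg_smul, one_smul, smul_neg, neg_neg, one_mul, zero_add, smul_zero, smul_add, smul_sub] <;> abel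
  | @snoc n l w c hw hc =>
    simp only [mergeU_snoc, dbarU_snoc, map_neg, map_add, map_sub, LinearMap.neg_apply,
      A.sgn_apply _ hc, A.sgn_apply _ (A.d_mem hc), smul_mul_assoc, A.leibniz hc,
      map_smul, LinearMap.smul_apply, LinearMap.add_apply, LinearMap.sub_apply,
      mergeU_mergeU hw hc, signU_hword _ hw, signU_wgr _ (dbarU_mem hw.mem)]
    by_cases hn : Even n <;> by_cases hm : Even l <;>
      simp only [neg_one_zpow_eq_ite, Int.even_add, Int.even_sub, Int.even_mul, Int.not_even_one, ← Int.not_even_iff_odd,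
        hn, hm, not_true_eq_false, not_false_eq_true, iff_self, iff_true, true_iff, iff_false, false_iff, true_or,
        or_true, false_or, or_false, ↓reduceIte, neg_smul, one_smul, smul_neg, neg_neg, one_mul, zero_add, smul_zero, smul_add, smul_sub] <;> abel

theorem dbarU_dbarU {n : ℤ} {w : UHoch A} (hw : HWord A.gr A.gr n w) :
    dbarU A (dbarU A w) = 0 := by
  induction hw with
  | nil ha => simp [A.d_d]
  | @snoc n m w e hw he ih =>
    simp only [dbarU_snoc, map_add, map_sub, ih, dbarU_mergeU hw he, signU_hword _ hw,
      signU_wgr _ (dbarU_mem hw.mem), map_smul, A.d_d, map_zero, LinearMap.zero_apply]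
    by_cases hn : Even n <;>
      simp only [neg_one_zpow_eq_ite, Int.even_add, Int.even_sub, Int.even_mul, Int.not_even_one, ← Int.not_even_iff_odd,
        hn, not_true_eq_false, not_false_eq_true, iff_self, iff_true, true_iff, iff_false, false_iff, true_or,
        or_true, false_or, or_false, ↓reduceIte, neg_smul, one_smul, smul_neg, neg_neg, one_mul, zero_add, smul_zero, smul_add, smul_sub] <;> abel

theorem mergeU_lmulU {n m : ℤ} {w : UHoch A} {a : A} (hw : HWord A.gr A.gr n w)
    (ha : a ∈ A.gr m) (b : A) :
    mergeU A (lmulU A a w) b = (-1 : k) ^ m • lmulU A a (mergeU A w b) := by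
  cases hw with
  | @nil n c hc =>
    simp only [lmulU_nil, mergeU_nil, A.sgn_apply _ hc, A.sgn_apply _ (mul_mem' ha hc rfl),
      smul_mul_assoc, map_smul, mul_assoc]
    by_cases hn : Even n <;> by_cases hm : Even m <;>
      simp [neg_one_zpow_eq_ite, Int.even_add, hn, hm]
  | @snoc n l w c hw hc =>
    simp only [lmulU_snoc, mergeU_snoc, signU_hword _ hw, signU_wgr _ (lmulU_mem ha hw.mem),
      map_smul, map_neg]
    by_cases hn : Even n <;> by_cases hm : Even m <;>
      simp [neg_one_zpow_eq_ite, Int.even_add, hn, hm]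

theorem dbarU_lmulU {n m : ℤ} {w : UHoch A} {a : A} (hw : HWord A.gr A.gr n w)
    (ha : a ∈ A.gr m) :
    dbarU A (lmulU A a w) = lmulU A (A.d a) w + (-1 : k) ^ m • lmulU A a (dbarU A w) := by
  induction hw with
  | @nil n c hc => simp [A.leibniz ha]
  | @snoc n l w c hw hc ih =>
    simp only [lmulU_snoc, dbarU_snoc, ih, map_add, map_sub, mergeU_lmulU hw ha, map_smul,
      signU_wgr _ (lmulU_mem ha hw.mem), signU_hword _ hw]
    by_cases hn : Even n <;> by_cases hm : Even m <;>
      simp only [neg_one_zpow_eq_ite, Int.even_add, Int.even_sub, Int.even_mul, Int.not_even_one, ← Int.not_even_iff_odd,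
        hn, hm, not_true_eq_false, not_false_eq_true, iff_self, iff_true, true_iff, iff_false, false_iff, true_or,
        or_true, false_or, or_false, ↓reduceIte, neg_smul, one_smul, smul_neg, neg_neg, one_mul, zero_add, smul_zero, smul_add, smul_sub] <;> abel

theorem lmulU_lmulU (a b : A) {n : ℤ} {w : UHoch A} (hw : HWord A.gr A.gr n w) :
    lmulU A a (lmulU A b w) = lmulU A (a * b) w := by
  induction hw with
  | nil hc => simp [mul_assoc]
  | snoc hw hc ih => simp [ih]

theorem cycU_mergeU {n m : ℤ} {w : UHoch A} {a : A} (hw : HWord A.gr A.gr n w)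
    (ha : a ∈ A.gr m) :
    cycU A (mergeU A w a) = (-1 : k) ^ ((m - 1) * n) • cycU A (lmulU A a w) := by
  cases hw with
  | nil hc => simp
  | @snoc n l w b hw hb =>
    simp only [mergeU_snoc, lmulU_snoc, cycU_snoc, map_neg, signU_hword _ hw, map_smul,
      A.sgn_apply _ hb, smul_mul_assoc, LinearMap.smul_apply, rotU_apply A hb,
      rotU_apply A (mul_mem' hb ha rfl), signU_wgr _ (lmulU_mem ha hw.mem), lmulU_lmulU b a hw]
    by_cases hn : Even n <;> by_cases hm : Even m <;> by_cases hl : Even l <;>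
      simp [neg_one_zpow_eq_ite, Int.even_add, Int.even_sub, Int.even_mul,
        ← Int.not_even_iff_odd, hn, hm, hl]

theorem dU_dU : dU A ∘ₗ dU A = 0 := by
  refine hword_ext fun n w hw => ?_
  simp only [dU, LinearMap.comp_apply, LinearMap.add_apply, map_add, dbarU_dbarU hw,
    LinearMap.zero_apply]
  cases hw with
  | nil hc => simp
  | @snoc n m w a hw ha =>
    simp only [cycU_snoc, dbarU_snoc, map_add, map_sub, map_neg, rotU_apply A ha,
      rotU_apply A (A.d_mem ha), signU_hword _ hw, signU_wgr _ (dbarU_mem hw.mem), map_smul,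
      dbarU_lmulU hw ha, cycU_mergeU hw ha]
    by_cases hn : Even n <;> by_cases hm : Even m <;>
      simp only [neg_one_zpow_eq_ite, Int.even_add, Int.even_sub, Int.even_mul, Int.not_even_one, ← Int.not_even_iff_odd,
        hn, hm, not_true_eq_false, not_false_eq_true, iff_self, iff_true, true_iff, iff_false, false_iff, true_or,
        or_true, false_or, or_false, ↓reduceIte, neg_smul, one_smul, smul_neg, neg_neg, one_mul, zero_add, smul_zero, smul_add, smul_sub] <;> abel


end lemmas

end unnormalized

/-! ### The normalized Hochschild complex -/

section normalized

/-- The underlying graded module `A ⊗ T(sĀ)` of the Hochschild chain complex `C_*(A)`. -/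
abbrev Hoch (A : AugDGA.{u, v} k) := Words k A A.bar

/-- The inclusion `A ⊗ T(sĀ) → A ⊗ T(sA)`. -/
def hochIncl (A : AugDGA.{u, v} k) : Hoch A →ₗ[k] UHoch A :=
  wordRec nil 0 (snoc ∘ₗ A.bar.subtype)

/-- The projection `A ⊗ T(sA) → A ⊗ T(sĀ)` induced by `a ↦ a - ε(a) 1` on every letter. -/
def hochProj (A : AugDGA.{u, v} k) : UHoch A →ₗ[k] Hoch A :=
  wordRec nil 0 (snoc ∘ₗ A.proj)

variable (A : AugDGA.{u, v} k) {B : AugDGA.{u, w} k} (φ : DGHom A B)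

/-- The differential of the Hochschild chain complex `C_*(A)`. All letters of
`dU A w` already lie in `Ā` for words `w` with letters in `Ā`, so that the projection only
restricts the codomain. -/
def hochD : Hoch A →ₗ[k] Hoch A := hochProj A ∘ₗ dU A ∘ₗ hochIncl A

/-- The degree `n` part of the augmentation ideal. -/
def barGr (n : ℤ) : Submodule k A.bar := (A.gr n).comap A.bar.subtype

/-- The degree `n` part of `C_*(A)`, where `a₀[a₁|⋯|aᵣ]` has degree `|a₀| + ∑ (|aᵢ| - 1)`. -/
def hochGr (n : ℤ) : Submodule k (Hoch A) := wgr A.gr (barGr A) n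

variable {A}

/-- The map `C_*(φ) : C_*(A) → C_*(B)`, `a₀[a₁|⋯|aₙ] ↦ φ(a₀)[φ(a₁)|⋯|φ(aₙ)]`. -/
def hochMap : Hoch A →ₗ[k] Hoch B := hochProj B ∘ₗ mapU φ ∘ₗ hochIncl A

/-- The Lie derivative `L_θ` on Hochschild chains, for a derivation `θ` of degree `p`. The values
`θ(aᵢ)` of `θ` on letters are projected to `Ā`, which is identified with `A / k` in this way. -/
def hochL (p : ℤ) (θ : A →ₗ[k] B) : Hoch A →ₗ[k] Hoch B :=
  hochProj B ∘ₗ LU φ p θ ∘ₗ hochIncl A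

/-- The contraction `e_θ` on Hochschild chains, for a derivation `θ` of degree `p`. -/
def hochE (p : ℤ) (θ : A →ₗ[k] B) : Hoch A →ₗ[k] Hoch B :=
  hochProj B ∘ₗ eU φ p θ ∘ₗ hochIncl A

@[simp] theorem hochIncl_nil (a : A) : hochIncl A (nil a) = nil a := by
  simp [hochIncl, wordRec_nil]

@[simp] theorem hochIncl_snoc (a : A.bar) (w : Hoch A) :
    hochIncl A (snoc a w) = snoc (a : A) (hochIncl A w) := by
  simp [hochIncl, wordRec_snoc]

@[simp] theorem hochProj_nil (a : A) : hochProj A (nil a) = nil a := by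
  simp [hochProj, wordRec_nil]

@[simp] theorem hochProj_snoc (a : A) (w : UHoch A) :
    hochProj A (snoc a w) = snoc (A.proj a) (hochProj A w) := by
  simp [hochProj, wordRec_snoc]

theorem proj_coe (a : A.bar) : A.proj a = a := by
  ext
  have : A.aug (a : A) = 0 := a.2
  simp [A.coe_proj, this]

theorem coe_proj' (a : A) : (A.proj a : A) = a - A.aug a • 1 := by
  rw [A.coe_proj, Algebra.algebraMap_eq_smul_one]

@[simp] theorem proj_one : A.proj 1 = 0 := by
  ext; simp [A.coe_proj]

@[simp] theorem d_one : A.d 1 = 0 := by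
  have h := A.leibniz (SetLike.GradedOne.one_mem : (1 : A) ∈ A.gr 0) 1
  simpa using h

@[simp] theorem sgn_one (p : ℤ) : A.sgn p 1 = 1 := by
  rw [A.sgn_apply p (SetLike.GradedOne.one_mem : (1 : A) ∈ A.gr 0)]; simp

theorem der_one {p : ℤ} {θ : A →ₗ[k] B} (hθ : θ ∈ derSub φ p) : θ 1 = 0 := by
  have h := hθ.2 0 1 1 SetLike.GradedOne.one_mem
  simpa using h

theorem hochProj_incl (w : Hoch A) : hochProj A (hochIncl A w) = w := by
  induction w using word_induction with
  | h₀ a => simp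
  | h₁ w e ih => simp [ih, proj_coe]
  | hadd x y hx hy => simp [hx, hy]
  | hsmul c x hx => simp [hx]

theorem norm_sign (p : ℤ) (w : UHoch A) :
    hochProj A (signU A p (hochIncl A (hochProj A w))) = hochProj A (signU A p w) := by
  induction w using word_induction with
  | h₀ a => simp
  | h₁ w e ih => simp [ih, coe_proj']
  | hadd x y hx hy => simp only [map_add, hx, hy]
  | hsmul c x hx => simp only [map_smul, hx]

theorem norm_map (w : UHoch A) :
    hochProj B (mapU φ (hochIncl A (hochProj A w))) = hochProj B (mapU φ w) := by
  induction w using word_induction with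
  | h₀ a => simp
  | h₁ w e ih => simp [ih, coe_proj']
  | hadd x y hx hy => simp only [map_add, hx, hy]
  | hsmul c x hx => simp only [map_smul, hx]

theorem norm_lmul (a : A) (w : UHoch A) :
    hochProj A (lmulU A a (hochIncl A (hochProj A w))) = hochProj A (lmulU A a w) := by
  induction w using word_induction with
  | h₀ b => simp
  | h₁ w e ih => simp [ih, proj_coe]
  | hadd x y hx hy => simp only [map_add, hx, hy]
  | hsmul c x hx => simp only [map_smul, hx]

theorem norm_rot (a : A) (w : UHoch A) :
    hochProj A (rotU A a (hochIncl A (hochProj A w))) = hochProj A (rotU A a w) := by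
  induction a using DirectSum.Decomposition.inductionOn A.gr with
  | zero => simp
  | homogeneous a =>
    rw [rotU_apply A a.2, rotU_apply A a.2, ← norm_lmul, norm_sign, norm_lmul]
  | add a b ha hb => simp only [map_add, LinearMap.add_apply, ha, hb]

theorem rot_one (w : UHoch A) : rotU A 1 w = signU A 1 w := by
  have h : rotU A 1 = signU A 1 := hword_ext fun n w hw => by
    rw [rotU_apply A (SetLike.GradedOne.one_mem : (1 : A) ∈ A.gr 0), signU_hword _ hw,
      signU_hword _ hw]
    have : lmulU A 1 w = w := by
      clear hw
      induction w using word_induction with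
      | h₀ b => simp
      | h₁ w e ih => simp [ih]
      | hadd x y hx hy => simp only [map_add, hx, hy]
      | hsmul c x hx => simp only [map_smul, hx]
    rw [map_smul, this]
    by_cases hn : Even n <;> simp [neg_one_zpow_eq_ite, hn]
  rw [h]

theorem merge_one (w : UHoch A) : mergeU A w 1 = signU A 1 w := by
  induction w using word_induction with
  | h₀ b => simp
  | h₁ w e ih => simp
  | hadd x y hx hy => simp only [map_add, LinearMap.add_apply, hx, hy]
  | hsmul c x hx => simp only [map_smul, LinearMap.smul_apply, hx]

theorem norm_aux (w : UHoch A) : ∀ a : A,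
    snoc (A.proj a) (hochProj A (dbarU A (hochIncl A (hochProj A w)))) +
      hochProj A (mergeU A (hochIncl A (hochProj A w)) a) =
    snoc (A.proj a) (hochProj A (dbarU A w)) + hochProj A (mergeU A w a) := by
  induction w using word_induction with
  | h₀ b =>
    intro a
    simp only [hochProj_nil, hochIncl_nil]
  | h₁ w b ih =>
    intro a
    have h := ih (A.proj b)
    have h1 : hochProj A (mergeU A w 1) = hochProj A (signU A 1 w) := by rw [merge_one]
    simp only [hochProj_snoc, hochIncl_snoc, dbarU_snoc, mergeU_snoc, map_add, map_sub, map_neg]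
    simp only [proj_coe] at h ⊢
    rw [sub_add_eq_add_sub, ← map_add, h]
    simp only [coe_proj', map_sub, map_smul, norm_sign, LinearMap.sub_apply, h1,
      LinearMap.smul_apply, d_one, sgn_one, sub_mul, smul_mul_assoc, one_mul, map_add, map_zero,
      smul_zero, sub_zero]
    abel
  | hadd x y hx hy =>
    intro a
    have h1 := hx a
    have h2 := hy a
    simp only [map_add, LinearMap.add_apply]
    rw [add_add_add_comm, h1, h2]; abel
  | hsmul c x hx =>
    intro a
    have h1 := hx a
    simp only [map_smul, LinearMap.smul_apply]
    rw [← smul_add, h1, smul_add]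

theorem norm_d (w : UHoch A) :
    hochProj A (dU A (hochIncl A (hochProj A w))) = hochProj A (dU A w) := by
  induction w using word_induction with
  | h₀ b => simp
  | h₁ w a _ =>
    have h := norm_aux w (A.proj a)
    have h1 : hochProj A (mergeU A w 1) = hochProj A (signU A 1 w) := by rw [merge_one]
    simp only [dU, LinearMap.add_apply, hochProj_snoc, hochIncl_snoc, dbarU_snoc, cycU_snoc,
      map_add, map_sub, map_neg]
    simp only [proj_coe] at h ⊢
    rw [sub_add_eq_add_sub, h]
    simp only [coe_proj', map_sub, map_smul, norm_sign, LinearMap.sub_apply, h1, norm_rot, rot_one,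
      LinearMap.smul_apply, d_one, map_zero, smul_zero, sub_zero]
    abel
  | hadd x y hx hy => simp only [map_add, hx, hy]
  | hsmul c x hx => simp only [map_smul, hx]

theorem norm_L {p : ℤ} {θ : A →ₗ[k] B} (hθ : θ ∈ derSub φ p) (w : UHoch A) :
    hochProj B (LU φ p θ (hochIncl A (hochProj A w))) = hochProj B (LU φ p θ w) := by
  induction w using word_induction with
  | h₀ b => simp
  | h₁ w a ih =>
    simp only [LU_snoc, hochProj_snoc, hochIncl_snoc, map_add, map_smul, ih]
    rw [← norm_map, norm_sign, norm_map]
    simp [coe_proj', der_one φ hθ]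
  | hadd x y hx hy => simp only [map_add, hx, hy]
  | hsmul c x hx => simp only [map_smul, hx]

theorem head_norm (w : UHoch A) : headU A (hochIncl A (hochProj A w)) = headU A w := by
  induction w using word_induction with
  | h₀ b => simp
  | h₁ w a ih => simp
  | hadd x y hx hy => simp only [map_add, hx, hy]
  | hsmul c x hx => simp only [map_smul, hx]

theorem norm_e {p : ℤ} {θ : A →ₗ[k] B} (hθ : θ ∈ derSub φ p) (w : UHoch A) :
    hochProj B (eU φ p θ (hochIncl A (hochProj A w))) = hochProj B (eU φ p θ w) := by
  induction w using word_induction with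
  | h₀ b => simp
  | h₁ w a ih =>
    simp only [eU_snoc, hochProj_snoc, hochIncl_snoc, map_add, map_smul, ih, head_norm]
    simp [coe_proj', der_one φ hθ]
  | hadd x y hx hy => simp only [map_add, hx, hy]
  | hsmul c x hx => simp only [map_smul, hx]

theorem hochD_hochD : hochD A ∘ₗ hochD A = 0 := by
  refine LinearMap.ext fun x => ?_
  have h := LinearMap.congr_fun (dU_dU (A := A)) (hochIncl A x)
  simp only [LinearMap.comp_apply, LinearMap.zero_apply] at h
  simp only [hochD, LinearMap.comp_apply, norm_d, h, map_zero, LinearMap.zero_apply]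

theorem hochD_hochL {p : ℤ} {θ : A →ₗ[k] B} (hθ : θ ∈ derSub φ p) :
    hochD B ∘ₗ hochL φ p θ - (-1 : k) ^ p • hochL φ p θ ∘ₗ hochD A =
      hochL φ (p + 1) (B.d ∘ₗ θ - (-1 : k) ^ p • θ ∘ₗ A.d) := by
  refine LinearMap.ext fun x => ?_
  have h := congrArg (hochProj B) (LinearMap.congr_fun (dU_LU hθ) (hochIncl A x))
  simp only [LinearMap.comp_apply, LinearMap.sub_apply, LinearMap.smul_apply, map_sub,
    map_smul] at h
  simp only [hochD, hochL, LinearMap.comp_apply, LinearMap.sub_apply, LinearMap.smul_apply, norm_d,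
    norm_L φ hθ, h]

theorem hochD_hochE {p : ℤ} {θ : A →ₗ[k] B} (hθ : θ ∈ derSub φ p) :
    hochD B ∘ₗ hochE φ p θ - (-1 : k) ^ (p + 1) • hochE φ p θ ∘ₗ hochD A =
      -hochE φ (p + 1) (B.d ∘ₗ θ - (-1 : k) ^ p • θ ∘ₗ A.d) := by
  refine LinearMap.ext fun x => ?_
  have h := congrArg (hochProj B) (LinearMap.congr_fun (dU_eU hθ) (hochIncl A x))
  simp only [LinearMap.comp_apply, LinearMap.sub_apply, LinearMap.smul_apply, map_sub,
    map_smul, LinearMap.neg_apply, map_neg] at h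
  simp only [hochD, hochE, LinearMap.comp_apply, LinearMap.sub_apply, LinearMap.smul_apply, norm_d,
    norm_e φ hθ, h, LinearMap.neg_apply]

/-! Degrees -/

theorem hochIncl_mem {n : ℤ} {x : Hoch A} (hx : x ∈ hochGr A n) :
    hochIncl A x ∈ wgr A.gr A.gr n := by
  refine wgr_map (hochIncl A) (wgr A.gr A.gr n) (fun w hw => ?_) hx
  clear * - hw
  induction hw with
  | nil hb => rw [hochIncl_nil]; exact nil_mem hb
  | snoc hw he ih => rw [hochIncl_snoc]; exact snoc_mem he ih rfl

theorem proj_mem {n : ℤ} {a : A} (ha : a ∈ A.gr n) : A.proj a ∈ barGr A n := by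
  change (A.proj a : A) ∈ A.gr n
  rw [coe_proj']
  by_cases hn : n = 0
  · subst hn
    exact sub_mem ha (Submodule.smul_mem _ _ SetLike.GradedOne.one_mem)
  · rw [A.aug_gr hn ha, zero_smul, sub_zero]; exact ha

theorem hochProj_mem {n : ℤ} {x : UHoch A} (hx : x ∈ wgr A.gr A.gr n) :
    hochProj A x ∈ hochGr A n := by
  refine wgr_map (hochProj A) (hochGr A n) (fun w hw => ?_) hx
  clear * - hw
  have : HWord A.gr (barGr A) n (hochProj A w) := by
    induction hw with
    | nil hb => rw [hochProj_nil]; exact HWord.nil hb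
    | snoc hw he ih => rw [hochProj_snoc]; exact HWord.snoc ih (proj_mem he)
  exact Submodule.subset_span this

theorem hochD_mem {n : ℤ} {x : Hoch A} (hx : x ∈ hochGr A n) : hochD A x ∈ hochGr A (n + 1) :=
  hochProj_mem (dU_mem (hochIncl_mem hx))

theorem hochL_mem {p : ℤ} {θ : A →ₗ[k] B} (hθ : θ ∈ derSub φ p) {n : ℤ} {x : Hoch A}
    (hx : x ∈ hochGr A n) : hochL φ p θ x ∈ hochGr B (n + p) :=
  hochProj_mem (LU_mem φ hθ (hochIncl_mem hx))

theorem hochE_mem {p : ℤ} {θ : A →ₗ[k] B} (hθ : θ ∈ derSub φ p) {n : ℤ} {x : Hoch A}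
    (hx : x ∈ hochGr A n) : hochE φ p θ x ∈ hochGr B (n + (p + 1)) :=
  hochProj_mem (eU_mem φ hθ (hochIncl_mem hx))

theorem LU_add (p : ℤ) (θ η : A →ₗ[k] B) : LU φ p (θ + η) = LU φ p θ + LU φ p η := by
  refine LinearMap.ext fun w => ?_
  induction w using word_induction with
  | h₀ b => simp
  | h₁ w a ih => simp [ih]; abel
  | hadd x y hx hy => simp only [map_add, hx, hy]
  | hsmul c x hx => simp only [map_smul, hx]

theorem LU_smul (p : ℤ) (c : k) (θ : A →ₗ[k] B) : LU φ p (c • θ) = c • LU φ p θ := by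
  refine LinearMap.ext fun w => ?_
  induction w using word_induction with
  | h₀ b => simp
  | h₁ w a ih => simp [ih, smul_comm c]
  | hadd x y hx hy => simp only [map_add, hx, hy]
  | hsmul c x hx => simp only [map_smul, hx]

theorem eU_add (p : ℤ) (θ η : A →ₗ[k] B) : eU φ p (θ + η) = eU φ p θ + eU φ p η := by
  refine LinearMap.ext fun w => ?_
  induction w using word_induction with
  | h₀ b => simp
  | h₁ w a ih => simp [ih, mul_add]; abel
  | hadd x y hx hy => simp only [map_add, hx, hy]
  | hsmul c x hx => simp only [map_smul, hx]

theorem eU_smul (p : ℤ) (c : k) (θ : A →ₗ[k] B) : eU φ p (c • θ) = c • eU φ p θ := by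
  refine LinearMap.ext fun w => ?_
  induction w using word_induction with
  | h₀ b => simp
  | h₁ w a ih => simp [ih, smul_comm c]
  | hadd x y hx hy => simp only [map_add, hx, hy]
  | hsmul c x hx => simp only [map_smul, hx]

end normalized

/-! ### dg Lie algebras of operators and their homology -/

section operators

/-- The differential `f ↦ d f - (-1) ^ p f d` on linear maps `f` of degree `p`. -/
def homDiff {M N : Type*} [AddCommGroup M] [Module k M] [AddCommGroup N] [Module k N]
    (dM : M →ₗ[k] M) (dN : N →ₗ[k] N) (p : ℤ) : (M →ₗ[k] N) →ₗ[k] (M →ₗ[k] N) where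
  toFun f := dN ∘ₗ f - (-1 : k) ^ p • f ∘ₗ dM
  map_add' f g := by
    simp only [LinearMap.comp_add, LinearMap.add_comp, smul_add]; abel
  map_smul' c f := by
    simp only [LinearMap.comp_smul, LinearMap.smul_comp, smul_sub, RingHom.id_apply]
    rw [smul_comm]

/-- The linear maps of degree `p` between graded modules. -/
def homDeg {M N : Type*} [AddCommGroup M] [Module k M] [AddCommGroup N] [Module k N]
    (gM : ℤ → Submodule k M) (gN : ℤ → Submodule k N) (p : ℤ) : Submodule k (M →ₗ[k] N) where
  carrier := {f | ∀ (n : ℤ) (x : M), x ∈ gM n → f x ∈ gN (n + p)}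
  add_mem' h1 h2 n x hx := add_mem (h1 n x hx) (h2 n x hx)
  zero_mem' _ _ _ := zero_mem _
  smul_mem' c _ h n x hx := Submodule.smul_mem _ c (h n x hx)

/-- The graded commutator `[f, g] = f g - (-1) ^ (p q) g f` of operators of degrees `p`, `q`. -/
def bracket {M : Type*} [AddCommGroup M] [Module k M] (p q : ℤ) (f g : Module.End k M) :
    Module.End k M := f * g - (-1 : k) ^ (p * q) • (g * f)

/-- A dg Lie algebra of operators: a differential `d` on a module `M` and, for every integer `p`,
a space `S p` of operators on `M` (those of degree `p`), closed under the graded commutator and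
under the differential `[d, -]`. -/
structure OperatorDGLie (k : Type u) [Field k] where
  M : Type v
  [grp : AddCommGroup M]
  [mod : Module k M]
  d : Module.End k M
  S : ℤ → Submodule k (Module.End k M)
  d_d : d ∘ₗ d = 0
  bracket_mem : ∀ {p q : ℤ} {f g : Module.End k M}, f ∈ S p → g ∈ S q → bracket p q f g ∈ S (p + q)
  diff_mem : ∀ {p : ℤ} {f : Module.End k M}, f ∈ S p → homDiff d d p f ∈ S (p + 1)

attribute [instance] OperatorDGLie.grp OperatorDGLie.mod

namespace OperatorDGLie

variable (G : OperatorDGLie.{u, v} k)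

/-- The cocycles of degree `p`. -/
def Z (p : ℤ) : Submodule k (Module.End k G.M) := G.S p ⊓ LinearMap.ker (homDiff G.d G.d p)

/-- The coboundaries of degree `p`. -/
def bd (p : ℤ) : Submodule k (Module.End k G.M) :=
  (G.S (p - 1)).map (homDiff G.d G.d (p - 1))

/-- The homology `H^p`. -/
abbrev H (p : ℤ) := G.Z p ⧸ (G.bd p).submoduleOf (G.Z p)

/-- The class of a cocycle. -/
abbrev cls (p : ℤ) : G.Z p →ₗ[k] G.H p := ((G.bd p).submoduleOf (G.Z p)).mkQ

theorem diff_bracket (p q : ℤ) (f g : Module.End k G.M) :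
    homDiff G.d G.d (p + q) (bracket p q f g) =
      bracket (p + 1) q (homDiff G.d G.d p f) g +
        (-1 : k) ^ p • bracket p (q + 1) f (homDiff G.d G.d q g) := by
  simp only [homDiff, bracket, ← Module.End.mul_eq_comp, LinearMap.coe_mk, AddHom.coe_mk,
    mul_sub, sub_mul, smul_sub, mul_smul_comm, smul_mul_assoc, smul_smul, mul_assoc]
  by_cases hp : Even p <;> by_cases hq : Even q <;>
    simp [neg_one_zpow_eq_ite, Int.even_add, Int.even_mul, ← Int.not_even_iff_odd, hp, hq] <;>
      abel

theorem mem_Z {p : ℤ} {f : Module.End k G.M} :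
    f ∈ G.Z p ↔ f ∈ G.S p ∧ homDiff G.d G.d p f = 0 := Iff.rfl

theorem S_cast {p q : ℤ} {f : Module.End k G.M} (h : f ∈ G.S p) (e : p = q) : f ∈ G.S q := e ▸ h

/-- The bracket of cocycles. -/
def bracketZ (p q : ℤ) : G.Z p →ₗ[k] G.Z q →ₗ[k] G.Z (p + q) :=
  LinearMap.mk₂ k
    (fun f g => ⟨bracket p q f g, (G.mem_Z).2 ⟨G.bracket_mem f.2.1 g.2.1, by
      rw [diff_bracket, ((G.mem_Z).1 f.2).2, ((G.mem_Z).1 g.2).2]; simp [bracket]⟩⟩)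
    (by intros; ext1; simp [bracket, add_mul, mul_add]; abel)
    (by intro c f g; ext1; simp [bracket, smul_sub, smul_comm c])
    (by intros; ext1; simp [bracket, add_mul, mul_add]; abel)
    (by intro c f g; ext1; simp [bracket, smul_sub, smul_comm c])

theorem cls_bracketZ_left {p q : ℤ} (f : G.Z p) (g : G.Z q) (hf : (f : Module.End k G.M) ∈ G.bd p) :
    G.cls (p + q) (G.bracketZ p q f g) = 0 := by
  obtain ⟨h, hh, hf⟩ := hf
  refine (Submodule.Quotient.mk_eq_zero _).2 ?_
  have e : p - 1 + q = p + q - 1 := by ring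
  refine ⟨bracket (p - 1) q h g, G.S_cast (G.bracket_mem hh g.2.1) e, ?_⟩
  rw [← e, diff_bracket, hf, ((G.mem_Z).1 g.2).2, sub_add_cancel]
  simp [bracket, bracketZ]

theorem cls_bracketZ_right {p q : ℤ} (f : G.Z p) (g : G.Z q)
    (hg : (g : Module.End k G.M) ∈ G.bd q) : G.cls (p + q) (G.bracketZ p q f g) = 0 := by
  obtain ⟨h, hh, hg⟩ := hg
  refine (Submodule.Quotient.mk_eq_zero _).2 ?_
  have e : p + (q - 1) = p + q - 1 := by ring
  refine ⟨(-1 : k) ^ p • bracket p (q - 1) f h,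
    Submodule.smul_mem _ _ (G.S_cast (G.bracket_mem f.2.1 hh) e), ?_⟩
  rw [map_smul, ← e, diff_bracket, hg, ((G.mem_Z).1 f.2).2, sub_add_cancel]
  by_cases hp : Even p <;> simp [bracket, bracketZ, neg_one_zpow_eq_ite, hp]

/-- The Lie bracket on homology, `[cls f, cls g] = cls [f, g]`. -/
def lie (p q : ℤ) : G.H p →ₗ[k] G.H q →ₗ[k] G.H (p + q) :=
  (Submodule.liftQ _ (Submodule.liftQ _ ((G.bracketZ p q).compr₂ (G.cls (p + q)))
    (fun f hf => LinearMap.ext fun g => G.cls_bracketZ_left f g hf)).flip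
    (fun g hg => LinearMap.ext fun x => by
      obtain ⟨f, rfl⟩ := Submodule.mkQ_surjective _ x
      exact G.cls_bracketZ_right f g hg)).flip

theorem lie_cls {p q : ℤ} (f : G.Z p) (g : G.Z q) :
    G.lie p q (G.cls p f) (G.cls q g) = G.cls (p + q) (G.bracketZ p q f g) := rfl

end OperatorDGLie

/-! ### `Der(A)` and `End(C_*(A))` -/

theorem der_bracket_mem {A : AugDGA.{u, v} k} {p q : ℤ} {f g : Module.End k A}
    (hf : f ∈ derSub (DGHom.id A) p) (hg : g ∈ derSub (DGHom.id A) q) :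
    bracket p q f g ∈ derSub (DGHom.id A) (p + q) := by
  refine ⟨fun n a ha => ?_, fun n a b ha => ?_⟩
  · exact sub_mem (gr_cast (hf.1 _ _ (hg.1 _ _ ha)) (by ring))
      (Submodule.smul_mem _ _ (gr_cast (hg.1 _ _ (hf.1 _ _ ha)) (by ring)))
  · have id_apply : ∀ a : A, (DGHom.id A) a = a := fun _ => rfl
    simp only [bracket, LinearMap.sub_apply, LinearMap.smul_apply, Module.End.mul_apply,
      hf.2 _ _ _ ha, hg.2 _ _ _ ha, map_add, map_smul, hf.2 _ _ _ (hg.1 _ _ ha),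
      hg.2 _ _ _ (hf.1 _ _ ha), id_apply, mul_sub, sub_mul, smul_mul_assoc, mul_smul_comm]
    by_cases hp : Even p <;> by_cases hq : Even q <;> by_cases hn : Even n <;>
      simp only [neg_one_zpow_eq_ite, Int.even_add, Int.even_sub, Int.even_mul, Int.not_even_one, ← Int.not_even_iff_odd,
        hp, hq, hn, not_true_eq_false, not_false_eq_true, iff_self, iff_true, true_iff, iff_false, false_iff, true_or,
        or_true, false_or, or_false, ↓reduceIte, neg_smul, one_smul, smul_neg, neg_neg, one_mul, zero_add, smul_zero, smul_add, smul_sub] <;> abel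

theorem d_mem_der (A : AugDGA.{u, v} k) : A.d ∈ derSub (DGHom.id A) 1 :=
  ⟨fun _ _ ha => A.d_mem ha, fun n a b ha => by rw [A.leibniz ha b, one_mul]; rfl⟩

/-- The dg Lie algebra `Der(A)` of derivations of `A` of all degrees. -/
def derLie (A : AugDGA.{u, v} k) : OperatorDGLie.{u, v} k where
  M := A
  d := A.d
  S := derSub (DGHom.id A)
  d_d := LinearMap.ext A.d_d
  bracket_mem := der_bracket_mem
  diff_mem {p f} hf := by
    have h := der_bracket_mem (d_mem_der A) hf
    rw [add_comm 1 p] at h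
    have e : homDiff A.d A.d p f = bracket 1 p A.d f := by
      simp [homDiff, bracket, Module.End.mul_eq_comp]
    rw [e]; exact h

/-- The dg Lie algebra `End(C_*(A))` of linear endomorphisms of all degrees of the Hochschild chain
complex. -/
def endLie (A : AugDGA.{u, v} k) : OperatorDGLie.{u, max u v} k where
  M := Hoch A
  d := hochD A
  S := homDeg (hochGr A) (hochGr A)
  d_d := hochD_hochD
  bracket_mem {p q f g} hf hg := fun n x hx =>
    sub_mem (by
      have := hf _ _ (hg _ _ hx)
      rwa [show n + q + p = n + (p + q) by ring] at this)
      (Submodule.smul_mem _ _ (by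
      have := hg _ _ (hf _ _ hx)
      rwa [show n + p + q = n + (p + q) by ring] at this))
  diff_mem {p f} hf := fun n x hx =>
    sub_mem (by
      have := hochD_mem (hf _ _ hx)
      rwa [show n + p + 1 = n + (p + 1) by ring] at this)
      (Submodule.smul_mem _ _ (by
      have := hf _ _ (hochD_mem hx)
      rwa [show n + 1 + p = n + (p + 1) by ring] at this))

/-- The map `A → A` underlying a cocycle of `Der(A)`. -/
def derMap (A : AugDGA.{u, v} k) {p : ℤ} (θ : (derLie A).Z p) : A →ₗ[k] A := θ.1

/-- The map `C_*(A) → C_*(A)` underlying a cocycle of `End(C_*(A))`. -/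
def endMap (A : AugDGA.{u, v} k) {p : ℤ} (f : (endLie A).Z p) : Hoch A →ₗ[k] Hoch A := f.1

/-- The Lie derivative `L : Der(A) → End(C_*(A))` in degree `p`. -/
def lieDer (A : AugDGA.{u, v} k) (p : ℤ) : Module.End k A →ₗ[k] Module.End k (Hoch A) where
  toFun θ := hochL (DGHom.id A) p θ
  map_add' θ η := by simp only [hochL, LU_add, LinearMap.add_comp, LinearMap.comp_add]
  map_smul' c θ := by
    simp only [hochL, LU_smul, LinearMap.smul_comp, LinearMap.comp_smul, RingHom.id_apply]

/-- The contraction `e : Der(A) → End(C_*(A))` in degree `p`. -/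
def contr (A : AugDGA.{u, v} k) (p : ℤ) : Module.End k A →ₗ[k] Module.End k (Hoch A) where
  toFun θ := hochE (DGHom.id A) p θ
  map_add' θ η := by simp only [hochE, eU_add, LinearMap.add_comp, LinearMap.comp_add]
  map_smul' c θ := by
    simp only [hochE, eU_smul, LinearMap.smul_comp, LinearMap.comp_smul, RingHom.id_apply]

/-- `H(L) : H^p(Der A) → H^p(End C_*(A))`. -/
def HL (A : AugDGA.{u, v} k) (p : ℤ) : (derLie A).H p →ₗ[k] (endLie A).H p :=
  Submodule.mapQ _ _
    ((lieDer A p).restrict (p := (derLie A).Z p) (q := (endLie A).Z p) fun x hx =>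
      ⟨fun n y hy => hochL_mem _ hx.1 hy, by
        refine (hochD_hochL (DGHom.id A) hx.1).trans ?_
        have h := ((derLie A).mem_Z.1 hx).2
        exact (congrArg (lieDer A (p + 1)) h).trans (map_zero _)⟩)
    (by
      rintro ⟨x, hx⟩ ⟨y, hy, hxy⟩
      refine ⟨lieDer A (p - 1) y, fun n z hz => hochL_mem _ hy hz, ?_⟩
      refine (hochD_hochL (DGHom.id A) hy).trans ?_
      rw [sub_add_cancel]
      exact congrArg (lieDer A p) hxy)

/-- `H(e) : H^p(Der A) → H^{p+1}(End C_*(A))`. -/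
def He (A : AugDGA.{u, v} k) (p : ℤ) : (derLie A).H p →ₗ[k] (endLie A).H (p + 1) :=
  Submodule.mapQ _ _
    ((contr A p).restrict (p := (derLie A).Z p) (q := (endLie A).Z (p + 1)) fun x hx =>
      ⟨fun n y hy => hochE_mem _ hx.1 hy, by
        refine (hochD_hochE (DGHom.id A) hx.1).trans ?_
        have h := ((derLie A).mem_Z.1 hx).2
        exact neg_eq_zero.2 ((congrArg (contr A (p + 1)) h).trans (map_zero _))⟩)
    (by
      rintro ⟨x, hx⟩ ⟨y, hy, hxy⟩
      have e : p - 1 + 1 = p + 1 - 1 := by ring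
      refine ⟨-contr A (p - 1) y, neg_mem fun n z hz => ?_, ?_⟩
      · rw [← e]; exact hochE_mem _ hy hz
      · refine (map_neg (homDiff (hochD A) (hochD A) (p + 1 - 1)) (contr A (p - 1) y)).trans ?_
        rw [← e]
        refine (congrArg Neg.neg (hochD_hochE (DGHom.id A) hy)).trans ?_
        rw [neg_neg, sub_add_cancel]
        exact congrArg (contr A p) hxy)

end operators

/-! ### Sullivan models -/

namespace AugDGA

variable (A : AugDGA.{u, v} k)

/-- Graded subspaces. -/
def IsGradedSub (V : Submodule k A) : Prop :=
  ∀ v ∈ V, ∀ n : ℤ, (DirectSum.decompose A.gr v n : A) ∈ V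

/-- The relations `v w = (-1) ^ (|v| |w|) w v` in the tensor algebra of a graded subspace `V`. -/
inductive CommRel (V : Submodule k A) : TensorAlgebra k V → TensorAlgebra k V → Prop
  | comm {m n : ℤ} (v w : V) (hv : (v : A) ∈ A.gr m) (hw : (w : A) ∈ A.gr n) :
      CommRel V (TensorAlgebra.ι k v * TensorAlgebra.ι k w)
        ((-1 : k) ^ (m * n) • (TensorAlgebra.ι k w * TensorAlgebra.ι k v))

/-- `A = ∧V` as a graded algebra: `A` is the free graded commutative algebra on its graded
subspace `V`. -/
def IsFreeGCOn (V : Submodule k A) : Prop :=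
  A.IsGradedSub V ∧ ∃ e : RingQuot (A.CommRel V) ≃ₐ[k] A,
    ∀ v : V, e (RingQuot.mkAlgHom k (A.CommRel V) (TensorAlgebra.ι k v)) = v

/-- `A` is a Sullivan algebra `(∧V, d)`: `V` is the union of an increasing sequence of graded
subspaces `V(0) ⊆ V(1) ⊆ ⋯` with `d = 0` on `V(0)` and `d V(n+1) ⊆ ∧V(n)`. Generators of degree
zero are allowed. -/
def IsSullivan : Prop :=
  ∃ (V : Submodule k A) (F : ℕ → Submodule k A), A.IsFreeGCOn V ∧ (∀ n, A.IsGradedSub (F n)) ∧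
    Monotone F ∧ (∀ v : A, v ∈ V ↔ ∃ n, v ∈ F n) ∧ (∀ v ∈ F 0, A.d v = 0) ∧
    ∀ n, ∀ v ∈ F (n + 1), A.d v ∈ Algebra.adjoin k (F n : Set A)

end AugDGA

/-- `φ` induces a bijection on homology. -/
def DGHom.IsQuasiIso {A : AugDGA.{u, v} k} {B : AugDGA.{u, w} k} (φ : DGHom A B) : Prop :=
  (∀ a : A, A.d a = 0 → (∃ b : B, φ a = B.d b) → ∃ a' : A, a = A.d a') ∧
    ∀ b : B, B.d b = 0 → ∃ a : A, A.d a = 0 ∧ ∃ b' : B, b - φ a = B.d b'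


end

end HochCartan

end

open HochCartan

noncomputable section

namespace HochCartan

universe u v w x

/-! ### Complexes over a field -/

section complexes

variable {k : Type u} [Field k] {M N P : Type*} [AddCommGroup M] [Module k M] [AddCommGroup N]
  [Module k N] [AddCommGroup P] [Module k P]

/-! Over a field, a quasi-isomorphism φ : ∧V → A is a homotopy equivalence of complexes, and its
mapping cone has a linear contraction (`ConeContraction`). Everything is derived from such
contractions, although their entries, a homotopy inverse and homotopies, are merely linear and need
not respect products, units or augmentations.

For F, the point is that φ_* : Der(∧V) → Der(∧V, A) has an acyclic mapping cone
(`DerConeCocycle.exists_primitive`). Derivations out of ∧V may be prescribed freely on V, so a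
cocycle of the cone can be corrected on V(0), V(1), … in turn: once it vanishes on ∧V(n-1), its
value at a generator in V(n) is a cocycle of the cone of φ, and the contraction supplies a
primitive. The corrections form a locally finite sum. F is then θ ↦ θφ followed by the inverse of
H(φ_*).

For G, the cone of C_*(φ) is shown to be acyclic, hence contractible. The Hochschild differential is
the differential of the tensor product A ⊗ T(sĀ) plus terms that shorten words. The tensor trick
extends the contraction of φ to words (`wDer_homotopy`), and induction on the length of words takes
care of the other terms (`acyclic_of_filtered_contraction`, `hochMap_coneAcyclic`). Composition with
the homotopy equivalence C_*(φ) on either side then identifies both homologies of endomorphisms with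
that of Hom(C_*(∧V), C_*(A)).

Both maps are obtained from a linear relation: two cocycles are related if their images in Der(∧V,
A), respectively in Hom(C_*(∧V), C_*(A)), differ by a coboundary (`exists_quotient_map_of_rel`).
Compatibility with L and e is then naturality: these operators along φ turn a homotopy of
derivations into a homotopy of operators.

For brackets, let φη_i - θ_iφ = δh_i. An explicit X satisfies δX = φ[η₁,η₂] - [θ₁,θ₂]φ, which is
enough for G. For F the homotopy must be a derivation, and X is not one in general. Its defect is
cancelled by (-1)^p δZ, where Z obeys a product rule of second order with cross terms in h₁ and h₂;
such a Z exists because ∧V is free (`IsFreeGCOn.exists_secondOrder`), and X + (-1)^p δZ is the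
required homotopy (`exists_bracket_homotopy`). -/

theorem homDiff_apply (dM : M →ₗ[k] M) (dN : N →ₗ[k] N) (p : ℤ) (f : M →ₗ[k] N) (x : M) :
    homDiff dM dN p f x = dN (f x) - (-1 : k) ^ p • f (dM x) := rfl

theorem homDiff_def (dM : M →ₗ[k] M) (dN : N →ₗ[k] N) (p : ℤ) (f : M →ₗ[k] N) :
    homDiff dM dN p f = dN ∘ₗ f - (-1 : k) ^ p • f ∘ₗ dM := rfl

theorem negOnePow_mul_self (p : ℤ) : (-1 : k) ^ p * (-1 : k) ^ p = 1 := by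
  by_cases hp : Even p <;> simp [neg_one_zpow_eq_ite, hp]

theorem negOnePow_add (p q : ℤ) : (-1 : k) ^ (p + q) = (-1 : k) ^ p * (-1 : k) ^ q :=
  zpow_add₀ (by simp) p q

theorem negOnePow_sub_one (p : ℤ) : (-1 : k) ^ (p - 1) = -(-1 : k) ^ p := by
  rw [sub_eq_add_neg, negOnePow_add]; simp

theorem negOnePow_add_one (p : ℤ) : (-1 : k) ^ (p + 1) = -(-1 : k) ^ p := by
  rw [negOnePow_add]; simp

/-- The Leibniz rule for compositions. -/
theorem homDiff_comp (dM : M →ₗ[k] M) (dN : N →ₗ[k] N) (dP : P →ₗ[k] P) {p q r : ℤ}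
    (hr : q + p = r) (g : N →ₗ[k] P) (f : M →ₗ[k] N) :
    homDiff dM dP r (g ∘ₗ f) =
      homDiff dN dP q g ∘ₗ f + (-1 : k) ^ q • g ∘ₗ homDiff dM dN p f := by
  subst hr
  ext x
  simp only [homDiff_apply, LinearMap.comp_apply, LinearMap.add_apply, LinearMap.smul_apply,
    map_sub, map_smul, smul_sub, smul_smul, negOnePow_add]
  abel

theorem homDiff_homDiff {dM : M →ₗ[k] M} {dN : N →ₗ[k] N} (hM : ∀ x, dM (dM x) = 0)
    (hN : ∀ x, dN (dN x) = 0) {p q : ℤ} (hq : p + 1 = q) (f : M →ₗ[k] N) :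
    homDiff dM dN q (homDiff dM dN p f) = 0 := by
  subst hq
  ext x
  simp [homDiff_apply, hM, hN, negOnePow_add_one]

theorem homDeg_comp {gM : ℤ → Submodule k M} {gN : ℤ → Submodule k N} {gP : ℤ → Submodule k P}
    {p q r : ℤ} {g : N →ₗ[k] P} {f : M →ₗ[k] N} (hg : g ∈ homDeg gN gP q)
    (hf : f ∈ homDeg gM gN p) (hr : p + q = r) : g ∘ₗ f ∈ homDeg gM gP r := by
  subst hr
  intro n x hx
  have := hg _ _ (hf _ _ hx)
  rwa [add_assoc] at this

/-- Linear maps prescribed on the homogeneous parts of a graded module. -/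
theorem exists_linearMap_of_graded (g : ℤ → Submodule k M) [DirectSum.Decomposition g]
    (t : ℤ → M →ₗ[k] N) : ∃ s : M →ₗ[k] N, ∀ n, ∀ x ∈ g n, s x = t n x := by
  refine ⟨DirectSum.toModule k ℤ N (fun n => t n ∘ₗ (g n).subtype) ∘ₗ
    (DirectSum.decomposeLinearEquiv g).toLinearMap, fun n x hx => ?_⟩
  simp only [LinearMap.comp_apply, LinearEquiv.coe_coe, DirectSum.decomposeLinearEquiv_apply]
  rw [DirectSum.decompose_of_mem _ hx]
  erw [DirectSum.toModule_lof]
  simp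

theorem linearMap_ext_of_graded (g : ℤ → Submodule k M) [DirectSum.Decomposition g]
    {s t : M →ₗ[k] N} (h : ∀ n, ∀ x ∈ g n, s x = t x) : s = t := by
  ext x
  induction x using DirectSum.Decomposition.inductionOn g with
  | zero => simp
  | homogeneous a => exact h _ _ a.2
  | add a b ha hb => simp [ha, hb]

/-- A linear map `D` has a pseudo-inverse with values in a given submodule on the image of that
submodule. -/
theorem exists_pseudoInverse (D : M →ₗ[k] N) (Q : Submodule k M) :
    ∃ t : N →ₗ[k] M, (∀ x, t x ∈ Q) ∧ ∀ x ∈ Q, D (t (D x)) = D x := by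
  -- Over a field the restriction of `D` to `Q` has a linear section over its range, and the section
  -- extends to all of `N`.
  obtain ⟨r, hr⟩ := (D ∘ₗ Q.subtype).rangeRestrict.exists_rightInverse_of_surjective
    (LinearMap.range_rangeRestrict _)
  obtain ⟨t, ht⟩ := LinearMap.exists_extend r
  refine ⟨Q.subtype ∘ₗ t, fun x => (t x).2, fun x hx => ?_⟩
  have hx' : D x ∈ LinearMap.range (D ∘ₗ Q.subtype) := ⟨⟨x, hx⟩, rfl⟩
  have h1 : t (D x) = r ⟨D x, hx'⟩ := by rw [← ht]; rfl
  have h2 := LinearMap.congr_fun hr ⟨D x, hx'⟩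
  have h3 := congrArg Subtype.val h2
  simp only [LinearMap.comp_apply] at h3 ⊢
  rw [h1]
  exact h3

/-- The differential of the mapping cone of `f`. -/
def coneD (dM : M →ₗ[k] M) (dN : N →ₗ[k] N) (f : M →ₗ[k] N) : M × N →ₗ[k] M × N :=
  LinearMap.prod (-(dM ∘ₗ LinearMap.fst k M N)) (f ∘ₗ LinearMap.fst k M N + dN ∘ₗ LinearMap.snd k M N)

@[simp] theorem coneD_apply (dM : M →ₗ[k] M) (dN : N →ₗ[k] N) (f : M →ₗ[k] N) (z : M × N) :
    coneD dM dN f z = (-dM z.1, f z.1 + dN z.2) := rfl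

/-- The mapping cone of `f` is acyclic. -/
def ConeAcyclic (dM : M →ₗ[k] M) (dN : N →ₗ[k] N) (f : M →ₗ[k] N) : Prop :=
  ∀ z, coneD dM dN f z = 0 → ∃ y, z = coneD dM dN f y

/-- A contraction of the mapping cone of `f`, in terms of its matrix entries: a homotopy inverse
`inv` of `f`, homotopies `hM` and `hN`, and a secondary homotopy `hh`. -/
structure ConeContraction (gM : ℤ → Submodule k M) (gN : ℤ → Submodule k N) (dM : M →ₗ[k] M)
    (dN : N →ₗ[k] N) (f : M →ₗ[k] N) where
  inv : N →ₗ[k] M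
  hM : M →ₗ[k] M
  hN : N →ₗ[k] N
  hh : M →ₗ[k] N
  inv_mem : inv ∈ homDeg gN gM 0
  hM_mem : hM ∈ homDeg gM gM (-1)
  hN_mem : hN ∈ homDeg gN gN (-1)
  hh_mem : hh ∈ homDeg gM gN (-2)
  inv_d : ∀ x, inv (dN x) = dM (inv x)
  inv_f : ∀ x, inv (f x) = x + dM (hM x) + hM (dM x)
  f_inv : ∀ x, f (inv x) = x - dN (hN x) - hN (dN x)
  hh_d : ∀ x, hh (dM x) = f (hM x) + dN (hh x) + hN (f x)

/-- Over a field, acyclic mapping cones are contractible. -/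
theorem ConeAcyclic.exists_contraction {gM : ℤ → Submodule k M} {gN : ℤ → Submodule k N}
    [DirectSum.Decomposition gM] [DirectSum.Decomposition gN] {dM : M →ₗ[k] M} {dN : N →ₗ[k] N}
    {f : M →ₗ[k] N} (hdM : dM ∈ homDeg gM gM 1) (hdN : dN ∈ homDeg gN gN 1)
    (hf : f ∈ homDeg gM gN 0) (hdd : ∀ x, dM (dM x) = 0) (hdd' : ∀ x, dN (dN x) = 0)
    (hfd : ∀ x, f (dM x) = dN (f x)) (h : ConeAcyclic dM dN f) :
    Nonempty (ConeContraction gM gN dM dN f) := by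
  set D := coneD dM dN f with hD
  have hDD : ∀ z, D (D z) = 0 := fun z => by
    simp [hD, hdd, hdd', hfd]
  -- The degree `n` part of the cone. The copy of `M` is shifted by one, so that `D` has degree `1`;
  -- in particular `gM n` sits in `Q (n - 1)`, whence the index in `sM` below.
  let Q : ℤ → Submodule k (M × N) := fun n => (gM (n + 1)).prod (gN n)
  choose t htQ htD using fun n : ℤ => exists_pseudoInverse D (Q (n - 1))
  obtain ⟨sM, hsM⟩ := exists_linearMap_of_graded gM
    (fun n => t (n - 1) ∘ₗ LinearMap.inl k M N)
  obtain ⟨sN, hsN⟩ := exists_linearMap_of_graded gN (fun n => t n ∘ₗ LinearMap.inr k M N)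
  let s : M × N →ₗ[k] M × N := LinearMap.coprod sM sN
  have hs : ∀ n, ∀ z ∈ Q n, s z = t n z := by
    rintro n ⟨c, x⟩ ⟨hc, hx⟩
    have h1 : s (c, x) = sM c + sN x := rfl
    rw [h1, hsM _ _ hc, hsN _ _ hx]
    simp [← map_add]
  have hsQ : ∀ n, ∀ z ∈ Q n, s z ∈ Q (n - 1) := fun n z hz => by
    rw [hs n z hz]; exact htQ _ _
  have hDQ : ∀ n, ∀ z ∈ Q n, D z ∈ Q (n + 1) := by
    rintro n ⟨c, x⟩ ⟨hc, hx⟩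
    refine ⟨neg_mem (hdM _ _ hc), add_mem ?_ (hdN _ _ hx)⟩
    have := hf _ _ hc
    rwa [add_zero] at this
  have hDsD' : ∀ n, ∀ z ∈ Q n, D (s (D z)) = D z := fun n z hz => by
    rw [hs _ _ (hDQ n z hz)]
    exact htD _ _ (by rwa [add_sub_cancel_right])
  have hDsD : ∀ z, D (s (D z)) = D z := by
    have : D ∘ₗ s ∘ₗ D = D := by
      refine LinearMap.prod_ext (linearMap_ext_of_graded gM fun n x hx => ?_)
        (linearMap_ext_of_graded gN fun n x hx => ?_)
      · exact hDsD' (n - 1) (x, 0) ⟨by simpa using hx, zero_mem _⟩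
      · exact hDsD' n (0, x) ⟨zero_mem _, hx⟩
    exact fun z => LinearMap.congr_fun this z
  -- The pseudo-inverse `s` satisfies `D s D = D` but need not be a contraction. By acyclicity the
  -- cocycle `z - s (D z)` is in the range of `D`, so that `D s (1 - s D) = 1 - s D`. With `K = s (1
  -- - s D)` and `K D = s D` this reads `D K + K D = 1`.
  let K : M × N →ₗ[k] M × N := s - s ∘ₗ s ∘ₗ D
  have hKQ : ∀ n, ∀ z ∈ Q n, K z ∈ Q (n - 1) := fun n z hz => by
    refine sub_mem (hsQ n z hz) (hsQ n _ ?_)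
    have := hsQ _ _ (hDQ n z hz)
    rwa [add_sub_cancel_right] at this
  have hK : ∀ z, D (K z) + K (D z) = z := fun z => by
    have h1 : D (z - s (D z)) = 0 := by rw [map_sub, hDsD, sub_self]
    obtain ⟨y, hy⟩ := h _ h1
    have h2 : D (s (z - s (D z))) = z - s (D z) := by rw [hy, hDsD]
    have h3 : K z = s z - s (s (D z)) := rfl
    have h4 : K (D z) = s (D z) := by
      have : K (D z) = s (D z) - s (s (D (D z))) := rfl
      rw [this, hDD, map_zero, map_zero, sub_zero]
    rw [h3, h4, ← map_sub, h2, sub_add_cancel]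
  have key1 : ∀ x, D (K (0, x)) + K (0, dN x) = (0, x) := fun x => by
    have := hK (0, x)
    rwa [show D (0, x) = (0, dN x) by simp [hD]] at this
  have key2 : ∀ x, D (K (x, 0)) + K (-dM x, f x) = (x, 0) := fun x => by
    have := hK (x, 0)
    rwa [show D (x, 0) = (-dM x, f x) by simp [hD]] at this
  have hsplit : ∀ x y, K (x, y) = K (x, 0) + K (0, y) := fun x y => by
    rw [← map_add]; simp
  have hneg : ∀ x : M, K (-x, 0) = -K (x, 0) := fun x => by
    rw [← map_neg]; simp
  have e1 := fun x => congrArg Prod.fst (key1 x)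
  have e2 := fun x => congrArg Prod.snd (key1 x)
  have e3 := fun x => congrArg Prod.fst (key2 x)
  have e4 := fun x => congrArg Prod.snd (key2 x)
  simp only [hD, coneD_apply, Prod.fst_add, Prod.snd_add] at e1 e2
  simp only [hD, coneD_apply, hsplit (-dM _) (f _), hneg, Prod.fst_add, Prod.snd_add, Prod.fst_neg,
    Prod.snd_neg] at e3 e4
  -- The four matrix entries of `K`. The required identities are the components of `D K + K D = 1`
  -- on the two summands.
  refine ⟨⟨LinearMap.fst k M N ∘ₗ K ∘ₗ LinearMap.inr k M N,
    LinearMap.fst k M N ∘ₗ K ∘ₗ LinearMap.inl k M N,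
    LinearMap.snd k M N ∘ₗ K ∘ₗ LinearMap.inr k M N,
    LinearMap.snd k M N ∘ₗ K ∘ₗ LinearMap.inl k M N, ?_, ?_, ?_, ?_, fun x => ?_, fun x => ?_,
    fun x => ?_, fun x => ?_⟩⟩
  · intro n x hx
    have := (hKQ n (0, x) ⟨zero_mem _, hx⟩).1
    simpa using this
  · intro n x hx
    have := (hKQ (n - 1) (x, 0) ⟨by simpa using hx, zero_mem _⟩).1
    rwa [show n - 1 - 1 + 1 = n + -1 by ring] at this
  · intro n x hx
    exact (hKQ n (0, x) ⟨zero_mem _, hx⟩).2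
  · intro n x hx
    have := (hKQ (n - 1) (x, 0) ⟨by simpa using hx, zero_mem _⟩).2
    rwa [show n - 1 - 1 = n + -2 by ring] at this
  · exact (neg_add_eq_zero.1 (e1 x)).symm
  · have := e3 x
    simp only [LinearMap.comp_apply, LinearMap.inl_apply, LinearMap.inr_apply,
      LinearMap.fst_apply]
    rw [← sub_eq_zero] at this ⊢
    refine Eq.trans ?_ this; abel
  · have := e2 x
    simp only [LinearMap.comp_apply, LinearMap.inr_apply, LinearMap.fst_apply,
      LinearMap.snd_apply]
    rw [← sub_eq_zero] at this ⊢
    refine Eq.trans ?_ this; abel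
  · have := e4 x
    simp only [LinearMap.comp_apply, LinearMap.inl_apply, LinearMap.inr_apply,
      LinearMap.fst_apply, LinearMap.snd_apply]
    rw [← sub_eq_zero, ← neg_eq_zero]
    refine Eq.trans ?_ this; abel

/-- A homotopy equivalence has an acyclic mapping cone. More precisely, the mapping cone has a
contraction whose entries are composites of the given maps. -/
theorem coneD_contraction_of_homotopyEquiv {dM : M →ₗ[k] M} {dN : N →ₗ[k] N}
    {f : M →ₗ[k] N} (hfd : ∀ x, f (dM x) = dN (f x))
    (g : N →ₗ[k] M) (a : M →ₗ[k] M) (c : N →ₗ[k] N) (hgd : ∀ x, g (dN x) = dM (g x))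
    (hgf : ∀ x, g (f x) = x + dM (a x) + a (dM x)) (hfg : ∀ x, f (g x) = x - dN (c x) - c (dN x))
    (z : M × N) :
    let u : M →ₗ[k] N := -(c ∘ₗ f + f ∘ₗ a)
    let K : M × N →ₗ[k] M × N := LinearMap.prod
      ((a + g ∘ₗ u) ∘ₗ LinearMap.fst k M N + g ∘ₗ LinearMap.snd k M N)
      ((c ∘ₗ u) ∘ₗ LinearMap.fst k M N + c ∘ₗ LinearMap.snd k M N)
    coneD dM dN f (K z) + K (coneD dM dN f z) = z := by
  -- Without `u`, the matrix `K₀` with entries `a`, `g`, `0`, `c` satisfies `D K₀ + K₀ D = 1 + E`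
  -- with `E (x, y) = (0, -u x)`. Since `E ∘ E = 0` and `E` commutes with `D` by `hu`, the map `K =
  -- K₀ (1 - E)` is a contraction.
  intro u K
  obtain ⟨x, y⟩ := z
  have hu : ∀ x, dN (u x) + u (dM x) = 0 := fun x => by
    have h1 := congrArg f (hgf x)
    rw [hfg (f x)] at h1
    simp only [u, LinearMap.neg_apply, LinearMap.add_apply, LinearMap.comp_apply, map_add,
      map_neg, hfd] at h1 ⊢
    rw [← sub_eq_zero] at h1
    rw [← h1]; abel
  have hKe : ∀ x y, K (x, y) = (a x + g (u x) + g y, c (u x) + c y) := fun x y => rfl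
  rw [coneD_apply, coneD_apply, hKe, hKe]
  have h2 : u (-dM x) = dN (u x) := by
    rw [map_neg, ← sub_eq_zero, ← neg_eq_zero, ← hu x]; abel
  have h3 : f x = f (g (f x)) - f (dM (a x)) - f (a (dM x)) := by
    rw [hgf, map_add, map_add]; abel
  have hux : u x = -(c (f x) + f (a x)) := rfl
  rw [h2]
  ext
  · simp only [Prod.mk_add_mk, map_add, map_neg, hgd, hgf]; abel
  · simp only [Prod.mk_add_mk, map_add, hfg]
    rw [hux]
    simp only [map_neg, map_add]; abel

end complexes

/-! ### Maps on homology from relations -/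

section relations

variable {k : Type u} [Field k] {X Y : Type*} [AddCommGroup X] [Module k X] [AddCommGroup Y]
  [Module k Y]

/-- A linear relation that is defined everywhere and relates `0` exactly to `C` is single-valued
modulo `C`. As it relates `B` to `0`, it descends to the quotients, and nothing is lost: the graph
of the quotient map gives back the relation. -/
theorem exists_quotient_map_of_rel (B : Submodule k X) (C : Submodule k Y) (R : Submodule k (X × Y))
    (total : ∀ x, ∃ y, (x, y) ∈ R) (right : ∀ y, ((0 : X), y) ∈ R ↔ y ∈ C)
    (left : ∀ x ∈ B, (x, (0 : Y)) ∈ R) :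
    ∃ F : (X ⧸ B) →ₗ[k] (Y ⧸ C), ∀ x y, F (B.mkQ x) = C.mkQ y ↔ (x, y) ∈ R := by
  choose s hs using total
  have key : ∀ x y, (x, y) ∈ R → C.mkQ (s x) = C.mkQ y := fun x y h => by
    rw [Submodule.mkQ_apply, Submodule.mkQ_apply, Submodule.Quotient.eq, ← right]
    simpa using sub_mem (hs x) h
  let F₀ : X →ₗ[k] Y ⧸ C :=
    { toFun := fun x => C.mkQ (s x)
      map_add' := fun x y => by rw [← map_add]; exact key _ _ (add_mem (hs x) (hs y))
      map_smul' := fun c x => by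
        rw [RingHom.id_apply, ← map_smul]; exact key _ _ (R.smul_mem c (hs x)) }
  refine ⟨B.liftQ F₀ fun x hx => ?_, fun x y => ?_⟩
  · have := key x 0 (left x hx)
    rwa [map_zero] at this
  · change C.mkQ (s x) = C.mkQ y ↔ _
    refine ⟨fun h => ?_, key x y⟩
    rw [Submodule.mkQ_apply, Submodule.mkQ_apply, eq_comm, Submodule.Quotient.eq, ← right] at h
    simpa using add_mem h (hs x)

/-- If the conditions also hold for the converse relation, the induced map is bijective. -/
theorem exists_quotient_equiv_of_rel (B : Submodule k X) (C : Submodule k Y)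
    (R : Submodule k (X × Y)) (total : ∀ x, ∃ y, (x, y) ∈ R) (surj : ∀ y, ∃ x, (x, y) ∈ R)
    (right : ∀ y, ((0 : X), y) ∈ R ↔ y ∈ C) (left : ∀ x, (x, (0 : Y)) ∈ R ↔ x ∈ B) :
    ∃ F : (X ⧸ B) ≃ₗ[k] (Y ⧸ C), ∀ x y, F (B.mkQ x) = C.mkQ y ↔ (x, y) ∈ R := by
  obtain ⟨F, hF⟩ := exists_quotient_map_of_rel B C R total right fun x hx => (left x).2 hx
  refine ⟨LinearEquiv.ofBijective F ⟨?_, ?_⟩, hF⟩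
  · rw [← LinearMap.ker_eq_bot, eq_bot_iff]
    intro x hx
    obtain ⟨x, rfl⟩ := B.mkQ_surjective x
    have h := (hF x 0).1 (by rw [map_zero]; exact hx)
    exact (Submodule.Quotient.mk_eq_zero _).2 ((left x).1 h)
  · intro y
    obtain ⟨y, rfl⟩ := C.mkQ_surjective y
    obtain ⟨x, hx⟩ := surj y
    exact ⟨B.mkQ x, (hF x y).2 hx⟩

end relations

/-! ### Sign automorphisms and derivations along a morphism -/

section signs

variable {k : Type u} [Field k]

namespace AugDGA

variable (A : AugDGA.{u, v} k)

theorem sgn_mul (p : ℤ) (a b : A) : A.sgn p (a * b) = A.sgn p a * A.sgn p b := by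
  induction a using DirectSum.Decomposition.inductionOn A.gr with
  | zero => simp
  | add a a' ha ha' => simp [add_mul, ha, ha']
  | @homogeneous m a =>
    induction b using DirectSum.Decomposition.inductionOn A.gr with
    | zero => simp
    | add b b' hb hb' => simp [mul_add, hb, hb']
    | @homogeneous n b =>
      rw [A.sgn_apply p a.2, A.sgn_apply p b.2, A.sgn_apply p (mul_mem' a.2 b.2 rfl), mul_add,
        negOnePow_add, smul_mul_smul_comm]

/-- The sign automorphism `a ↦ (-1) ^ (p * |a|) a`. -/
def sgnHom (p : ℤ) : A →ₐ[k] A :=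
  AlgHom.ofLinearMap (A.sgn p) (sgn_one p) (A.sgn_mul p)

@[simp] theorem sgnHom_apply (p : ℤ) (a : A) : A.sgnHom p a = A.sgn p a := rfl

theorem sgn_sgn (p q : ℤ) (a : A) : A.sgn p (A.sgn q a) = A.sgn (p + q) a := by
  have : A.sgn p ∘ₗ A.sgn q = A.sgn (p + q) := linearMap_ext_of_graded A.gr fun n x hx => by
    rw [LinearMap.comp_apply, A.sgn_apply q hx, map_smul, A.sgn_apply p hx, A.sgn_apply _ hx,
      smul_smul, add_mul, negOnePow_add, mul_comm]
  exact LinearMap.congr_fun this a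

theorem sgn_even {p : ℤ} (hp : Even p) (a : A) : A.sgn p a = a := by
  have : A.sgn p = LinearMap.id := linearMap_ext_of_graded A.gr fun n x hx => by
    rw [A.sgn_apply _ hx, (hp.mul_right n).neg_one_zpow, one_smul, LinearMap.id_apply]
  exact LinearMap.congr_fun this a

/-- The projection to the degree `n` part. -/
def comp (n : ℤ) : A →ₗ[k] A :=
  (A.gr n).subtype ∘ₗ DirectSum.component k ℤ (fun i => A.gr i) n ∘ₗ
    (DirectSum.decomposeLinearEquiv A.gr).toLinearMap

theorem comp_apply (n : ℤ) (a : A) : A.comp n a = (DirectSum.decompose A.gr a n : A) := rfl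

theorem comp_mem (n : ℤ) (a : A) : A.comp n a ∈ A.gr n := by rw [comp_apply]; exact Subtype.mem _

theorem comp_of_mem {n : ℤ} {a : A} (ha : a ∈ A.gr n) : A.comp n a = a := by
  rw [comp_apply, DirectSum.decompose_of_mem_same _ ha]

theorem comp_mul_right {m : ℤ} (n : ℤ) (a : A) {b : A} (hb : b ∈ A.gr m) :
    A.comp (n + m) (a * b) = A.comp n a * b :=
  DirectSum.coe_decompose_mul_add_of_right_mem A.gr hb

theorem comp_mul_left {m : ℤ} (n : ℤ) {a : A} (ha : a ∈ A.gr m) (b : A) :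
    A.comp (m + n) (a * b) = a * A.comp n b :=
  DirectSum.coe_decompose_mul_add_of_left_mem A.gr ha

theorem sum_comp (a : A) : ∃ s : Finset ℤ, a = ∑ n ∈ s, A.comp n a := by
  classical exact ⟨_, (DirectSum.sum_support_decompose A.gr a).symm⟩

theorem d_mul (a b : A) : A.d (a * b) = A.d a * b + A.sgn 1 a * A.d b := by
  induction a using DirectSum.Decomposition.inductionOn A.gr with
  | zero => simp
  | add a a' ha ha' => simp only [add_mul, map_add, ha, ha']; abel
  | @homogeneous m a => rw [A.leibniz a.2, A.sgn_apply _ a.2, one_mul, smul_mul_assoc]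

end AugDGA

variable {A : AugDGA.{u, v} k} {B : AugDGA.{u, w} k}

theorem homDeg_sgn {q : ℤ} {f : A →ₗ[k] B} (hf : f ∈ homDeg A.gr B.gr q) (p : ℤ) (a : A) :
    B.sgn p (f a) = (-1 : k) ^ (p * q) • f (A.sgn p a) := by
  have : B.sgn p ∘ₗ f = (-1 : k) ^ (p * q) • f ∘ₗ A.sgn p :=
    linearMap_ext_of_graded A.gr fun n x hx => by
      rw [LinearMap.comp_apply, LinearMap.smul_apply, LinearMap.comp_apply, A.sgn_apply p hx,
        B.sgn_apply p (hf _ _ hx), map_smul, smul_smul, mul_add, negOnePow_add, mul_comm]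
  exact LinearMap.congr_fun this a

theorem DGHom.toLinearMap_mem (φ : DGHom A B) : φ.toAlgHom.toLinearMap ∈ homDeg A.gr B.gr 0 :=
  fun n x hx => by rw [add_zero]; exact φ.map_mem hx

theorem DGHom.map_sgn (φ : DGHom A B) (p : ℤ) (a : A) : B.sgn p (φ a) = φ (A.sgn p a) := by
  have := homDeg_sgn φ.toLinearMap_mem p a
  simpa using this

theorem d_mem_homDeg (A : AugDGA.{u, v} k) : A.d ∈ homDeg A.gr A.gr 1 := fun _ _ ha => A.d_mem ha

theorem derSub_homDeg {φ : DGHom A B} {p : ℤ} {θ : A →ₗ[k] B} (hθ : θ ∈ derSub φ p) :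
    θ ∈ homDeg A.gr B.gr p := hθ.1

/-- Writing the sign as the automorphism `sgn p` frees the Leibniz rule from homogeneity
assumptions. Long sign computations can then be done by rewriting, followed by a case distinction on
the parities of degrees. -/
theorem derSub_mul {φ : DGHom A B} {p : ℤ} {θ : A →ₗ[k] B} (hθ : θ ∈ derSub φ p) (a b : A) :
    θ (a * b) = θ a * φ b + φ (A.sgn p a) * θ b := by
  induction a using DirectSum.Decomposition.inductionOn A.gr with
  | zero => simp
  | add a a' ha ha' => simp only [add_mul, map_add, ha, ha']; abel
  | @homogeneous m a => rw [hθ.2 _ _ _ a.2, A.sgn_apply _ a.2, map_smul, smul_mul_assoc]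

theorem mem_derSub {φ : DGHom A B} {p : ℤ} {θ : A →ₗ[k] B} (h : θ ∈ homDeg A.gr B.gr p)
    (h' : ∀ a b, θ (a * b) = θ a * φ b + φ (A.sgn p a) * θ b) : θ ∈ derSub φ p :=
  ⟨h, fun n a b ha => by rw [h', A.sgn_apply _ ha, map_smul, smul_mul_assoc]⟩

theorem derSub_cast {φ : DGHom A B} {p q : ℤ} {θ : A →ₗ[k] B} (hθ : θ ∈ derSub φ p) (h : p = q) :
    θ ∈ derSub φ q := h ▸ hθ

theorem derSub_comp_left {φ : DGHom A B} {p : ℤ} {θ : A →ₗ[k] A}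
    (hθ : θ ∈ derSub (DGHom.id A) p) : φ.toAlgHom.toLinearMap ∘ₗ θ ∈ derSub φ p :=
  mem_derSub (homDeg_comp φ.toLinearMap_mem (derSub_homDeg hθ) (add_zero p)) fun a b => by
    simp only [LinearMap.comp_apply, derSub_mul hθ, map_add]
    simp [DGHom.id]

theorem derSub_comp_right {φ : DGHom A B} {p : ℤ} {θ : B →ₗ[k] B}
    (hθ : θ ∈ derSub (DGHom.id B) p) : θ ∘ₗ φ.toAlgHom.toLinearMap ∈ derSub φ p :=
  mem_derSub (homDeg_comp (derSub_homDeg hθ) φ.toLinearMap_mem (zero_add p)) fun a b => by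
    have := derSub_mul hθ (φ a) (φ b)
    simp only [LinearMap.comp_apply]
    simpa [DGHom.id, φ.map_sgn] using this

theorem homDiff_mem_derSub {φ : DGHom A B} {p : ℤ} {θ : A →ₗ[k] B} (hθ : θ ∈ derSub φ p) :
    homDiff A.d B.d p θ ∈ derSub φ (p + 1) := by
  refine mem_derSub (sub_mem ?_ (Submodule.smul_mem _ _ ?_)) fun a b => ?_
  · exact homDeg_comp (d_mem_homDeg B) (derSub_homDeg hθ) rfl
  · exact homDeg_comp (derSub_homDeg hθ) (d_mem_homDeg A) (add_comm 1 p)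
  · simp only [homDiff_apply, derSub_mul hθ, A.d_mul, B.d_mul, map_add, φ.map_sgn,
      homDeg_sgn (derSub_homDeg hθ), ← φ.map_d, homDeg_sgn (d_mem_homDeg A), A.sgn_sgn]
    rw [add_comm 1 p]
    by_cases hp : Even p <;> simp [neg_one_zpow_eq_ite, hp, mul_sub, sub_mul, mul_add, add_mul] <;> abel

/-- The homogeneous part of degree `p` of a linear map. -/
theorem exists_homogeneous_part (p : ℤ) (θ : A →ₗ[k] B) :
    ∃ θ' : A →ₗ[k] B, ∀ n, ∀ a ∈ A.gr n, θ' a = B.comp (n + p) (θ a) :=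
  exists_linearMap_of_graded A.gr fun n => B.comp (n + p) ∘ₗ θ

/-- For homogeneous `a` and `b`, multiplication by `φ a` or `φ b` shifts degrees by a fixed amount,
so the components of degree `|a| + |b| + p` satisfy the Leibniz rule on their own. The constructions
from matrices below yield a Leibniz rule without control of degrees; this restores the degree. -/
theorem homogeneous_part_mem_derSub {φ : DGHom A B} {p : ℤ} {θ θ' : A →ₗ[k] B}
    (hθ' : ∀ n, ∀ a ∈ A.gr n, θ' a = B.comp (n + p) (θ a))
    (hθ : ∀ a b, θ (a * b) = θ a * φ b + φ (A.sgn p a) * θ b) : θ' ∈ derSub φ p := by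
  refine ⟨fun n a ha => by rw [hθ' n a ha]; exact B.comp_mem _ _, fun n a b ha => ?_⟩
  induction b using DirectSum.Decomposition.inductionOn A.gr with
  | zero => simp
  | add b b' hb hb' => simp only [mul_add, map_add, hb, hb', smul_add]; abel
  | @homogeneous m b =>
    rw [hθ' _ _ (mul_mem' ha b.2 rfl), hθ' _ _ ha, hθ' _ _ b.2, hθ, A.sgn_apply _ ha, map_add,
      map_smul, smul_mul_assoc, map_smul, ← B.comp_mul_right _ _ (φ.map_mem b.2),
      ← B.comp_mul_left _ (φ.map_mem ha), show n + m + p = n + p + m by ring,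
      show n + (m + p) = n + p + m by ring]

end signs

/-! ### Free graded commutative algebras -/

section free

variable {k : Type u} [Field k] {A : AugDGA.{u, v} k} {V : Submodule k A}

namespace AugDGA

theorem IsFreeGCOn.adjoin_eq_top (hV : A.IsFreeGCOn V) : Algebra.adjoin k (V : Set A) = ⊤ := by
  obtain ⟨-, e, he⟩ := hV
  rw [eq_top_iff]
  intro a _
  obtain ⟨x, rfl⟩ := e.surjective a
  obtain ⟨t, rfl⟩ := RingQuot.mkAlgHom_surjective k (A.CommRel V) x
  induction t using TensorAlgebra.induction with
  | algebraMap r => rw [AlgHom.commutes, AlgEquiv.commutes]; exact Subalgebra.algebraMap_mem _ _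
  | ι v => rw [he]; exact Algebra.subset_adjoin v.2
  | mul a b ha hb => rw [map_mul, map_mul]; exact mul_mem (ha trivial) (hb trivial)
  | add a b ha hb => rw [map_add, map_add]; exact add_mem (ha trivial) (hb trivial)

theorem IsFreeGCOn.induction (hV : A.IsFreeGCOn V) {P : A → Prop} (hv : ∀ v ∈ V, P v)
    (hr : ∀ r : k, P (algebraMap k A r)) (ha : ∀ a b, P a → P b → P (a + b))
    (hm : ∀ a b, P a → P b → P (a * b)) (a : A) : P a := by
  have h : a ∈ Algebra.adjoin k (V : Set A) := by rw [hV.adjoin_eq_top]; trivial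
  induction h using Algebra.adjoin_induction with
  | mem x hx => exact hv x hx
  | algebraMap r => exact hr r
  | add x y _ _ hx hy => exact ha x y hx hy
  | mul x y _ _ hx hy => exact hm x y hx hy

theorem IsFreeGCOn.induction_homogeneous (hV : A.IsFreeGCOn V) {P : A → Prop}
    (hv : ∀ n, ∀ v ∈ V, v ∈ A.gr n → P v)
    (hr : ∀ r : k, P (algebraMap k A r)) (ha : ∀ a b, P a → P b → P (a + b))
    (hm : ∀ a b, P a → P b → P (a * b)) (a : A) : P a := by
  refine hV.induction (fun v hv' => ?_) hr ha hm a
  obtain ⟨s, hs⟩ := A.sum_comp v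
  rw [hs]
  exact Finset.sum_induction _ P ha (by simpa using hr 0)
    fun n _ => hv n _ (hV.1 v hv' n) (A.comp_mem n v)

/-- The defining relations concern pairs of generators only. For fixed `b`, the elements that
commute with `b` up to sign form a subalgebra, so testing generators is enough. This is used twice:
first with a generator as `b`, then with an arbitrary homogeneous element. -/
theorem IsFreeGCOn.isGradedComm (hV : A.IsFreeGCOn V) : A.IsGradedComm := by
  have closed : ∀ (n : ℤ) (b : A),
      (∀ m, ∀ v ∈ V, v ∈ A.gr m → v * b = (-1 : k) ^ (m * n) • (b * v)) →
      ∀ a : A, a * b = b * A.sgn n a := by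
    intro n b h a
    induction a using hV.induction_homogeneous with
    | hv m v hv hm =>
      rw [h m v hv hm, A.sgn_apply n hm, mul_smul_comm, mul_comm]
    | hr r => simp [Algebra.algebraMap_eq_smul_one]
    | ha x y hx hy => rw [add_mul, hx, hy, map_add, mul_add]
    | hm x y hx hy => rw [mul_assoc, hy, ← mul_assoc, hx, A.sgn_mul, mul_assoc]
  have h1 : ∀ n, ∀ w ∈ V, w ∈ A.gr n → ∀ a : A, a * w = w * A.sgn n a := fun n w hw hwn =>
    closed n w fun m v hv hvm => by
      obtain ⟨-, e, he⟩ := hV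
      have := RingQuot.mkAlgHom_rel k (CommRel.comm (A := A) (⟨v, hv⟩ : V) ⟨w, hw⟩ hvm hwn)
      simpa [he] using congrArg e this
  intro m n a b ha hb
  have h2 := closed m a (fun n' w hw hwn => by
    rw [h1 n' w hw hwn a, A.sgn_apply _ ha, mul_smul_comm, smul_smul, negOnePow_mul_self,
      one_smul]) b
  rw [A.sgn_apply _ hb, mul_smul_comm] at h2
  rw [h2, smul_smul, negOnePow_mul_self, one_smul]

/-- The universal property of free graded commutative algebras. -/
theorem IsFreeGCOn.exists_lift (hV : A.IsFreeGCOn V) {C : Type*} [Ring C] [Algebra k C]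
    (f : A →ₗ[k] C) (hf : ∀ m n, ∀ v ∈ V, ∀ w ∈ V, v ∈ A.gr m → w ∈ A.gr n →
      f v * f w = (-1 : k) ^ (m * n) • (f w * f v)) :
    ∃ Φ : A →ₐ[k] C, ∀ v ∈ V, Φ v = f v := by
  obtain ⟨-, e, he⟩ := hV
  let Φ₀ : RingQuot (A.CommRel V) →ₐ[k] C := RingQuot.liftAlgHom k
    ⟨TensorAlgebra.lift k (f ∘ₗ V.subtype), by
      rintro _ _ ⟨v, w, hv, hw⟩
      simpa using hf _ _ v v.2 w w.2 hv hw⟩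
  refine ⟨Φ₀.comp e.symm, fun v hv => ?_⟩
  have h : e.symm v = _ := (AlgEquiv.symm_apply_eq e).2 (he ⟨v, hv⟩).symm
  rw [AlgHom.comp_apply, AlgEquiv.coe_toAlgHom, h]
  simp [Φ₀]

/-- Extension of linear maps on generators to skew derivations. -/
theorem IsFreeGCOn.exists_skewDerivation (hV : A.IsFreeGCOn V) {C : Type*} [Ring C] [Algebra k C]
    (l r : A →ₐ[k] C) (f : A →ₗ[k] C)
    (hf : ∀ m n, ∀ v ∈ V, ∀ w ∈ V, v ∈ A.gr m → w ∈ A.gr n →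
      l v * f w + f v * r w = (-1 : k) ^ (m * n) • (l w * f v + f w * r v)) :
    ∃ θ : A →ₗ[k] C, (∀ a b, θ (a * b) = l a * θ b + θ a * r b) ∧ ∀ v ∈ V, θ v = f v := by
  -- A map `θ` obeys the skew Leibniz rule if and only if `a ↦ !![l a, θ a; 0, r a]` is
  -- multiplicative. It is therefore found as the upper right entry of an algebra map prescribed on
  -- generators; `hf` is the commutation relation in that entry.
  let F : A →ₗ[k] Matrix (Fin 2) (Fin 2) C :=
    { toFun := fun a => !![l a, f a; 0, r a]
      map_add' := fun a b => by ext i j; fin_cases i <;> fin_cases j <;> simp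
      map_smul' := fun c a => by ext i j; fin_cases i <;> fin_cases j <;> simp }
  have hF : ∀ a, F a = !![l a, f a; 0, r a] := fun _ => rfl
  obtain ⟨Φ, hΦ⟩ := hV.exists_lift F fun m n v hv w hw hvm hwn => by
    have h := hV.isGradedComm m n v w hvm hwn
    have h1 := congrArg l h
    have h2 := congrArg r h
    rw [map_mul, map_smul, map_mul] at h1 h2
    rw [hF, hF]
    ext i j
    fin_cases i <;> fin_cases j <;>
      simp [Matrix.mul_apply, Fin.sum_univ_two, h1, h2, hf m n v hv w hw hvm hwn]
  have key : ∀ a, Φ a 0 0 = l a ∧ Φ a 1 0 = 0 ∧ Φ a 1 1 = r a := by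
    intro a
    induction a using hV.induction with
    | hv v hv => rw [hΦ v hv, hF]; simp
    | hr c => simp [Matrix.algebraMap_matrix_apply]
    | ha x y hx hy => simp [hx, hy]
    | hm x y hx hy => simp [Matrix.mul_apply, Fin.sum_univ_two, hx, hy]
  refine ⟨{ toFun := fun a => Φ a 0 1, map_add' := fun a b => by simp,
            map_smul' := fun c a => by simp }, fun a b => ?_, fun v hv => ?_⟩
  · simp [Matrix.mul_apply, Fin.sum_univ_two, key]
  · change Φ v 0 1 = _
    rw [hΦ v hv, hF]; simp

variable {B : AugDGA.{u, w} k}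

/-- Extension of linear maps on generators to derivations. -/
theorem IsFreeGCOn.exists_derivation (hV : A.IsFreeGCOn V) (hB : B.IsGradedComm) (φ : DGHom A B)
    {p : ℤ} {f : A →ₗ[k] B} (hf : f ∈ homDeg A.gr B.gr p) :
    ∃ θ ∈ derSub φ p, ∀ v ∈ V, θ v = f v := by
  -- The Leibniz rule in degree `p` is the skew one with `l = φ ∘ sgn p` and `r = φ`.
  obtain ⟨θ, h1, h2⟩ := hV.exists_skewDerivation (φ.toAlgHom.comp (A.sgnHom p)) φ.toAlgHom f
    fun m n v hv w hw hvm hwn => by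
      have e1 := hB _ _ _ _ (φ.map_mem hvm) (hf _ _ hwn)
      have e2 := hB _ _ _ _ (hf _ _ hvm) (φ.map_mem hwn)
      simp only [AlgHom.comp_apply, sgnHom_apply, A.sgn_apply p hvm, A.sgn_apply p hwn, map_smul,
        smul_mul_assoc, e1, e2]
      by_cases hp : Even p <;> by_cases hm : Even m <;> by_cases hn : Even n <;>
        simp [neg_one_zpow_eq_ite, Int.even_add, Int.even_mul, hp, hm, hn] <;> abel
  -- No degree is known for `θ`. Its component of degree `p` has the same values on `V`, because `V`
  -- is graded and `f` has degree `p`.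
  obtain ⟨θ', h'⟩ := exists_homogeneous_part p θ
  refine ⟨θ', homogeneous_part_mem_derSub h' fun a b => ?_, fun v hv => ?_⟩
  · rw [h1, add_comm]; rfl
  · obtain ⟨s, hs⟩ := A.sum_comp v
    rw [hs, map_sum, map_sum]
    refine Finset.sum_congr rfl fun n _ => ?_
    have hvn : A.comp n v ∈ V := hV.1 v hv n
    rw [h' n _ (A.comp_mem n v), h2 _ hvn, B.comp_of_mem (hf _ _ (A.comp_mem n v))]

set_option maxHeartbeats 2000000 in
/-- Two derivations have a product of second order: the coefficient of `ε₁ε₂` in a multiplicative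
extension of `φ + ε₁h₁ + ε₂h₂`. -/
theorem IsFreeGCOn.exists_secondOrder (hV : A.IsFreeGCOn V) (hB : B.IsGradedComm) (φ : DGHom A B)
    {p q : ℤ} {h₁ h₂ : A →ₗ[k] B} (hh₁ : h₁ ∈ derSub φ p) (hh₂ : h₂ ∈ derSub φ q) :
    ∃ Z ∈ homDeg A.gr B.gr (p + q), ∀ a b, Z (a * b) = Z a * φ b + φ (A.sgn (p + q) a) * Z b +
      h₁ (A.sgn q a) * h₂ b + (-1 : k) ^ (p * q) • (h₂ (A.sgn p a) * h₁ b) := by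
  -- This is multiplicative because `h₁` is a derivation. A skew derivation into matrices, from `r ∘
  -- sgn q` to `r`, that has `h₂` (up to sign) on the diagonal acquires cross terms of `h₁` and `h₂`
  -- in the product rule of its upper right entry. That entry is taken to be zero on generators.
  let r : A →ₐ[k] Matrix (Fin 2) (Fin 2) B := AlgHom.ofLinearMap
    { toFun := fun a => !![φ (A.sgn p a), h₁ a; 0, φ a]
      map_add' := fun a b => by ext i j; fin_cases i <;> fin_cases j <;> simp
      map_smul' := fun c a => by ext i j; fin_cases i <;> fin_cases j <;> simp }
    (by ext i j; fin_cases i <;> fin_cases j <;> simp [der_one φ hh₁])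
    (fun a b => by
      ext i j; fin_cases i <;> fin_cases j <;>
        simp [Matrix.mul_apply, Fin.sum_univ_two, A.sgn_mul, derSub_mul hh₁, add_comm])
  have hr : ∀ a, r a = !![φ (A.sgn p a), h₁ a; 0, φ a] := fun _ => rfl
  let F : A →ₗ[k] Matrix (Fin 2) (Fin 2) B :=
    { toFun := fun a => !![(-1 : k) ^ (p * q) • h₂ (A.sgn p a), 0; 0, h₂ a]
      map_add' := fun a b => by ext i j; fin_cases i <;> fin_cases j <;> simp
      map_smul' := fun c a => by
        ext i j; fin_cases i <;> fin_cases j <;> simp [smul_comm c] }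
  have hF : ∀ a, F a = !![(-1 : k) ^ (p * q) • h₂ (A.sgn p a), 0; 0, h₂ a] := fun _ => rfl
  obtain ⟨θ, h1, h2⟩ := hV.exists_skewDerivation (r.comp (A.sgnHom q)) r F
    fun m n v hv w hw hvm hwn => by
      have e1 := hB _ _ _ _ (φ.map_mem hvm) (hh₂.1 _ _ hwn)
      have e2 := hB _ _ _ _ (hh₂.1 _ _ hvm) (φ.map_mem hwn)
      have e3 := hB _ _ _ _ (hh₁.1 _ _ hvm) (hh₂.1 _ _ hwn)
      have e4 := hB _ _ _ _ (hh₂.1 _ _ hvm) (hh₁.1 _ _ hwn)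
      rw [AlgHom.comp_apply, AlgHom.comp_apply, hr, hr, hr, hr, hF, hF]
      simp only [sgnHom_apply, A.sgn_apply _ hvm, A.sgn_apply _ hwn, map_smul]
      ext i j
      fin_cases i <;> fin_cases j <;>
        simp only [Matrix.mul_apply, Fin.sum_univ_two, Matrix.add_apply, Matrix.smul_apply,
          Matrix.of_apply, Matrix.cons_val', Matrix.cons_val_zero, Matrix.cons_val_one,
          Fin.zero_eta, Fin.mk_one, Fin.isValue, smul_mul_assoc, mul_smul_comm, e1, e2, e3, e4,
          mul_zero, zero_mul, add_zero, zero_add, smul_zero, Matrix.cons_val_fin_one] <;>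
        by_cases hp : Even p <;> by_cases hq : Even q <;> by_cases hm : Even m <;>
          by_cases hn : Even n <;>
        simp [neg_one_zpow_eq_ite, Int.even_add, Int.even_mul, hp, hq, hm, hn] <;> abel
  -- The other three entries are forced on all of `A`: both sides obey the same product rule and
  -- agree on generators.
  have key : ∀ a, θ a 1 0 = 0 ∧ θ a 0 0 = (-1 : k) ^ (p * q) • h₂ (A.sgn p a) ∧
      θ a 1 1 = h₂ a := by
    intro a
    induction a using hV.induction with
    | hv v hv => rw [h2 v hv, hF]; simp
    | hr c =>
      have e : θ 1 = 0 := by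
        have := h1 1 1
        simpa using this
      simp [Algebra.algebraMap_eq_smul_one, e, der_one φ hh₂]
    | ha x y hx hy => simp [hx, hy]
    | hm x y hx hy =>
      have e := h1 x y
      rw [AlgHom.comp_apply, hr, hr] at e
      rw [e]
      simp only [Matrix.mul_apply, Fin.sum_univ_two, Matrix.add_apply, Matrix.of_apply,
        Matrix.cons_val', Matrix.cons_val_zero, Matrix.cons_val_one, Matrix.cons_val_fin_one,
        Fin.isValue, hx, hy, A.sgn_mul, derSub_mul hh₂, sgnHom_apply, A.sgn_sgn, mul_zero, zero_mul,
        add_zero, zero_add, smul_add, mul_smul_comm, smul_mul_assoc, add_comm p q]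
      exact ⟨smul_zero _, add_comm _ _, add_comm _ _⟩
  let Z₀ : A →ₗ[k] B :=
    { toFun := fun a => θ a 0 1, map_add' := fun a b => by simp, map_smul' := fun c a => by simp }
  have hZ₀ : ∀ a b, Z₀ (a * b) = Z₀ a * φ b + φ (A.sgn (p + q) a) * Z₀ b +
      h₁ (A.sgn q a) * h₂ b + (-1 : k) ^ (p * q) • (h₂ (A.sgn p a) * h₁ b) := fun a b => by
    have e := h1 a b
    rw [AlgHom.comp_apply, hr, hr] at e
    change θ (a * b) 0 1 = _
    rw [e]
    simp only [Matrix.mul_apply, Fin.sum_univ_two, Matrix.add_apply, Matrix.of_apply,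
      Matrix.cons_val', Matrix.cons_val_zero, Matrix.cons_val_one, Matrix.cons_val_fin_one,
      Fin.isValue, key, sgnHom_apply, A.sgn_sgn, smul_mul_assoc, LinearMap.coe_mk, AddHom.coe_mk,
      Z₀]
    abel
  -- Passing to the component of degree `p + q` leaves the cross terms unchanged, since for
  -- homogeneous `a` and `b` they already have the right degree (`m1`, `m2`).
  obtain ⟨Z, hZ⟩ := exists_homogeneous_part (p + q) Z₀
  refine ⟨Z, fun n a ha => by rw [hZ n a ha]; exact B.comp_mem _ _, fun a b => ?_⟩
  induction a using DirectSum.Decomposition.inductionOn A.gr with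
  | zero => simp
  | add a a' ha ha' => simp only [add_mul, map_add, ha, ha', smul_add]; abel
  | @homogeneous n a =>
    induction b using DirectSum.Decomposition.inductionOn A.gr with
    | zero => simp
    | add b b' hb hb' => simp only [mul_add, map_add, hb, hb', smul_add]; abel
    | @homogeneous m b =>
      have m1 : h₁ (A.sgn q a) * h₂ b ∈ B.gr (n + m + (p + q)) :=
        mul_mem' (hh₁.1 _ _ (sgn_mem _ a.2)) (hh₂.1 _ _ b.2) (by ring)
      have m2 : h₂ (A.sgn p a) * h₁ b ∈ B.gr (n + m + (p + q)) :=
        mul_mem' (hh₂.1 _ _ (sgn_mem _ a.2)) (hh₁.1 _ _ b.2) (by ring)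
      rw [hZ _ _ (mul_mem' a.2 b.2 rfl), hZ _ _ a.2, hZ _ _ b.2, hZ₀, map_add, map_add, map_add,
        map_smul, B.comp_of_mem m1, B.comp_of_mem m2, ← B.comp_mul_right _ _ (φ.map_mem b.2),
        ← B.comp_mul_left _ (φ.map_mem (sgn_mem _ a.2)),
        show n + m + (p + q) = n + (p + q) + m by ring,
        show n + (m + (p + q)) = n + (p + q) + m by ring]

end AugDGA

end free

/-! ### Locally finite sums and pointwise limits of derivations -/

section limits

variable {k : Type u} [Field k] {M N : Type*} [AddCommGroup M] [Module k M] [AddCommGroup N]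
  [Module k N]

open Filter in
/-- Pointwise finite sums of linear maps. -/
theorem exists_locallyFinite_sum (T : ℕ → M →ₗ[k] N) (hT : ∀ x, ∀ᶠ n in atTop, T n x = 0) :
    ∃ S : M →ₗ[k] N, ∀ x, ∀ᶠ n in atTop, S x = (∑ i ∈ Finset.range n, T i) x := by
  have hfin : ∀ x, (Function.support fun n => T n x).Finite := fun x => by
    obtain ⟨n, hn⟩ := eventually_atTop.1 (hT x)
    refine (Set.finite_lt_nat n).subset fun i hi => ?_
    by_contra h
    exact hi (hn i (not_lt.1 h))
  refine ⟨{ toFun := fun x => ∑ᶠ n, T n x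
            map_add' := fun x y => by
              simp only [map_add]; exact finsum_add_distrib (hfin x) (hfin y)
            map_smul' := fun c x => by
              simp only [map_smul, RingHom.id_apply]; exact (smul_finsum' c (hfin x)).symm },
    fun x => ?_⟩
  obtain ⟨n, hn⟩ := eventually_atTop.1 (hT x)
  refine eventually_atTop.2 ⟨n, fun m hm => ?_⟩
  rw [LinearMap.sum_apply]
  refine finsum_eq_sum_of_support_subset _ fun i hi => ?_
  rw [Finset.coe_range, Set.mem_Iio]
  by_contra h
  exact hi (hn i (hm.trans (not_lt.1 h)))

variable {A : AugDGA.{u, v} k} {B : AugDGA.{u, w} k}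

open Filter in
-- Degrees and the Leibniz rule involve at most three values at a time, and finitely many values of
-- `S` are those of a single `T n`.
theorem derSub_of_eventually {φ : DGHom A B} {p : ℤ} {S : A →ₗ[k] B} {T : ℕ → A →ₗ[k] B}
    (hT : ∀ n, T n ∈ derSub φ p) (hS : ∀ x, ∀ᶠ n in atTop, S x = T n x) : S ∈ derSub φ p := by
  refine ⟨fun n a ha => ?_, fun n a b ha => ?_⟩
  · obtain ⟨i, hi⟩ := (hS a).exists
    rw [hi]; exact (hT i).1 n a ha
  · obtain ⟨i, h1, h2, h3⟩ := ((hS (a * b)).and ((hS a).and (hS b))).exists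
    rw [h1, h2, h3, (hT i).2 n a b ha]

theorem derSub_eq_zero_of_adjoin {φ : DGHom A B} {p : ℤ} {θ : A →ₗ[k] B} (hθ : θ ∈ derSub φ p)
    {s : Set A} (h : ∀ v ∈ s, θ v = 0) {a : A} (ha : a ∈ Algebra.adjoin k s) : θ a = 0 := by
  induction ha using Algebra.adjoin_induction with
  | mem x hx => exact h x hx
  | algebraMap r => rw [Algebra.algebraMap_eq_smul_one, map_smul, der_one φ hθ, smul_zero]
  | add x y _ _ hx hy => rw [map_add, hx, hy, add_zero]
  | mul x y _ _ hx hy => rw [derSub_mul hθ, hx, hy, zero_mul, mul_zero, add_zero]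

end limits

/-! ### Acyclicity of the mapping cone of Der(W) → Der(W, A) -/

section derivations

variable {k : Type u} [Field k] {W : AugDGA.{u, v} k} {A : AugDGA.{u, w} k} (φ : DGHom W A)

/-- Cocycles of degree `p` in the mapping cone of `φ_* : Der(W) → Der(W, A)`. -/
structure DerConeCocycle (p : ℤ) (ζ : W →ₗ[k] W) (h : W →ₗ[k] A) : Prop where
  fst_mem : ζ ∈ derSub (DGHom.id W) (p + 1)
  snd_mem : h ∈ derSub φ p
  fst_d : homDiff W.d W.d (p + 1) ζ = 0
  snd_d : homDiff W.d A.d p h = φ.toAlgHom.toLinearMap ∘ₗ ζ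

variable {φ}

/-- A boundary of the cone is subtracted. The signs are such that the new pair is zero exactly when
`κ` and `m` form a primitive in the sense of `DerConeCocycle.exists_primitive`. -/
theorem DerConeCocycle.sub {p : ℤ} {ζ κ : W →ₗ[k] W} {h m : W →ₗ[k] A}
    (H : DerConeCocycle φ p ζ h) (hκ : κ ∈ derSub (DGHom.id W) p) (hm : m ∈ derSub φ (p - 1)) :
    DerConeCocycle φ p (ζ - homDiff W.d W.d p κ)
      (h - φ.toAlgHom.toLinearMap ∘ₗ κ + homDiff W.d A.d (p - 1) m) where
  fst_mem := sub_mem H.fst_mem (homDiff_mem_derSub hκ)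
  snd_mem := add_mem (sub_mem H.snd_mem (derSub_comp_left hκ))
    (derSub_cast (homDiff_mem_derSub hm) (sub_add_cancel p 1))
  fst_d := by rw [map_sub, H.fst_d, homDiff_homDiff W.d_d W.d_d rfl, sub_zero]
  snd_d := by
    rw [map_add, homDiff_homDiff W.d_d A.d_d (sub_add_cancel p 1), map_sub, H.snd_d, add_zero]
    ext x
    simp [homDiff_apply, φ.map_d]

/-- One step in the construction of a primitive of a cocycle, along the filtration of the
generators of a Sullivan algebra. -/
theorem DerConeCocycle.exists_step {V : Submodule k W} {F : ℕ → Submodule k W}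
    (hV : W.IsFreeGCOn V) (hFV : ∀ n, F n ≤ V) (hF0 : ∀ v ∈ F 0, W.d v = 0)
    (hFd : ∀ n, ∀ v ∈ F (n + 1), W.d v ∈ Algebra.adjoin k (F n : Set W)) (hA : A.IsGradedComm)
    (c : ConeContraction W.gr A.gr W.d A.d φ.toAlgHom.toLinearMap) {p : ℤ} (n : ℕ)
    {ζ : W →ₗ[k] W} {h : W →ₗ[k] A} (H : DerConeCocycle φ p ζ h)
    (hζ : ∀ i < n, ∀ x ∈ Algebra.adjoin k (F i : Set W), ζ x = 0 ∧ h x = 0) :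
    ∃ κ ∈ derSub (DGHom.id W) p, ∃ m ∈ derSub φ (p - 1),
      (∀ i < n, ∀ x ∈ Algebra.adjoin k (F i : Set W), κ x = 0 ∧ m x = 0) ∧
      ∀ i < n + 1, ∀ x ∈ Algebra.adjoin k (F i : Set W), (ζ - homDiff W.d W.d p κ) x = 0 ∧
        (h - φ.toAlgHom.toLinearMap ∘ₗ κ + homDiff W.d A.d (p - 1) m) x = 0 := by
  -- For a generator `v` in `F n`, the pair `(ζ v, -h v)` will be a cocycle of the cone of `φ`. The
  -- contraction sends it to `(-κ v, m v)`, which explains the values prescribed for `κ` and `m`.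
  obtain ⟨κ, hκ, hκv⟩ := hV.exists_derivation hV.isGradedComm (DGHom.id W)
    (f := c.inv ∘ₗ h - c.hM ∘ₗ ζ) (p := p)
    (sub_mem (homDeg_comp c.inv_mem (derSub_homDeg H.snd_mem) (add_zero p))
      (homDeg_comp c.hM_mem (derSub_homDeg H.fst_mem) (by ring)))
  obtain ⟨m, hm, hmv⟩ := hV.exists_derivation hA φ
    (f := c.hh ∘ₗ ζ - c.hN ∘ₗ h) (p := p - 1)
    (sub_mem (homDeg_comp c.hh_mem (derSub_homDeg H.fst_mem) (by ring))
      (homDeg_comp c.hN_mem (derSub_homDeg H.snd_mem) (by ring)))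
  have hvan : ∀ i < n, ∀ x ∈ Algebra.adjoin k (F i : Set W), κ x = 0 ∧ m x = 0 := by
    intro i hi x hx
    have hgen : ∀ v ∈ F i, ζ v = 0 ∧ h v = 0 := fun v hv => hζ i hi v (Algebra.subset_adjoin hv)
    refine ⟨derSub_eq_zero_of_adjoin hκ (fun v hv => ?_) hx,
      derSub_eq_zero_of_adjoin hm (fun v hv => ?_) hx⟩
    · rw [hκv v (hFV i hv)]; simp [hgen v hv]
    · rw [hmv v (hFV i hv)]; simp [hgen v hv]
  refine ⟨κ, hκ, m, hm, hvan, fun i hi x hx => ?_⟩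
  -- The Sullivan condition enters here: `W.d v` is zero or lies in a subalgebra on which all four
  -- maps vanish. At generators in `F i`, each `homDiff` thus reduces to the differential of the
  -- target.
  have hd : ∀ v ∈ F i, ζ (W.d v) = 0 ∧ h (W.d v) = 0 ∧ κ (W.d v) = 0 ∧ m (W.d v) = 0 := by
    intro v hv
    cases i with
    | zero => simp [hF0 v hv]
    | succ i =>
      have h1 := hζ i (by omega) _ (hFd i v hv)
      have h2 := hvan i (by omega) _ (hFd i v hv)
      exact ⟨h1.1, h1.2, h2.1, h2.2⟩
  have H' := H.sub hκ hm
  refine ⟨derSub_eq_zero_of_adjoin H'.fst_mem (fun v hv => ?_) hx,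
    derSub_eq_zero_of_adjoin H'.snd_mem (fun v hv => ?_) hx⟩
  all_goals
    obtain ⟨d1, d2, d3, d4⟩ := hd v hv
    have e1 : W.d (ζ v) = 0 := by
      have := LinearMap.congr_fun H.fst_d v
      simpa [homDiff_apply, d1] using this
    have e2 : A.d (h v) = φ.toAlgHom.toLinearMap (ζ v) := by
      have := LinearMap.congr_fun H.snd_d v
      simpa [homDiff_apply, d2] using this
    have e3 : κ v = c.inv (h v) - c.hM (ζ v) := by rw [hκv v (hFV i hv)]; rfl
    have e4 : m v = c.hh (ζ v) - c.hN (h v) := by rw [hmv v (hFV i hv)]; rfl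
  · have e5 := c.inv_f (ζ v)
    rw [e1, map_zero, add_zero, ← e2, c.inv_d] at e5
    rw [LinearMap.sub_apply, homDiff_apply, d3, e3, map_sub, e5, smul_zero, sub_zero]
    abel
  · have e6 := c.f_inv (h v)
    have e7 := c.hh_d (ζ v)
    rw [e2] at e6
    rw [e1, map_zero] at e7
    rw [LinearMap.add_apply, LinearMap.sub_apply, LinearMap.comp_apply, homDiff_apply, d4, e3, e4,
      map_sub, map_sub, e6, smul_zero, sub_zero, e7]
    abel

open Filter in
/-- The mapping cone of `φ_* : Der(W) → Der(W, A)` is acyclic for Sullivan algebras `W` and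
quasi-isomorphisms `φ`. -/
theorem DerConeCocycle.exists_primitive (hW : W.IsSullivan) (hA : A.IsGradedComm)
    (c : ConeContraction W.gr A.gr W.d A.d φ.toAlgHom.toLinearMap) {p : ℤ}
    {ζ : W →ₗ[k] W} {h : W →ₗ[k] A} (H : DerConeCocycle φ p ζ h) :
    ∃ κ ∈ derSub (DGHom.id W) p, ∃ m ∈ derSub φ (p - 1), homDiff W.d W.d p κ = ζ ∧
      φ.toAlgHom.toLinearMap ∘ₗ κ - h = homDiff W.d A.d (p - 1) m := by
  obtain ⟨V, F, hV, -, hmono, hVF, hF0, hFd⟩ := hW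
  have hFV : ∀ n, F n ≤ V := fun n v hv => (hVF v).2 ⟨n, hv⟩
  have hexh : ∀ x : W, ∀ᶠ n in atTop, x ∈ Algebra.adjoin k (F n : Set W) := by
    intro x
    have up : ∀ {n m : ℕ}, n ≤ m → Algebra.adjoin k (F n : Set W) ≤ Algebra.adjoin k (F m : Set W) :=
      fun h => Algebra.adjoin_mono (hmono h)
    induction x using hV.induction with
    | hv v hv =>
      obtain ⟨n, hn⟩ := (hVF v).1 hv
      exact eventually_atTop.2 ⟨n, fun m hm => up hm (Algebra.subset_adjoin hn)⟩
    | hr r => exact Eventually.of_forall fun n => Subalgebra.algebraMap_mem _ r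
    | ha x y hx hy => filter_upwards [hx, hy] with n h1 h2 using add_mem h1 h2
    | hm x y hx hy => filter_upwards [hx, hy] with n h1 h2 using mul_mem h1 h2
  -- The recursion carries what is left of the cocycle after `n` corrections; it vanishes on the
  -- subalgebras generated by the `F i` with `i < n`.
  let Good : ℕ → (W →ₗ[k] W) × (W →ₗ[k] A) → Prop := fun n z => DerConeCocycle φ p z.1 z.2 ∧
    ∀ i < n, ∀ x ∈ Algebra.adjoin k (F i : Set W), z.1 x = 0 ∧ z.2 x = 0
  choose κ hκ m hm hvan hstep using fun (n : ℕ) (z : {z // Good n z}) =>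
    z.2.1.exists_step hV hFV hF0 hFd hA c n z.2.2
  let s : ∀ n, {z // Good n z} := fun n => Nat.rec ⟨(ζ, h), H, fun i hi => absurd hi (Nat.not_lt_zero i)⟩
    (fun n z => ⟨(_, _), z.2.1.sub (hκ n z) (hm n z), hstep n z⟩) n
  have hs : ∀ n, (s (n + 1)).1 = ((s n).1.1 - homDiff W.d W.d p (κ n (s n)),
    (s n).1.2 - φ.toAlgHom.toLinearMap ∘ₗ κ n (s n) + homDiff W.d A.d (p - 1) (m n (s n))) :=
    fun n => rfl
  have hsum : ∀ n, (s n).1 =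
      (ζ - homDiff W.d W.d p (∑ i ∈ Finset.range n, κ i (s i)),
        h - φ.toAlgHom.toLinearMap ∘ₗ (∑ i ∈ Finset.range n, κ i (s i)) +
          homDiff W.d A.d (p - 1) (∑ i ∈ Finset.range n, m i (s i))) := by
    intro n
    induction n with
    | zero => simp [s]
    | succ n ih =>
      rw [hs, ih, Finset.sum_range_succ, Finset.sum_range_succ, map_add, map_add,
        LinearMap.comp_add]
      ext x <;> simp <;> abel
  -- A correction vanishes on the subalgebras where the cocycle was already zero, so only finitely
  -- many of them matter at a given element.
  have hvan' : ∀ x, ∀ᶠ n in atTop, κ n (s n) x = 0 ∧ m n (s n) x = 0 := fun x => by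
    obtain ⟨i, hi⟩ := (hexh x).exists
    exact eventually_atTop.2 ⟨i + 1, fun n hn => hvan n (s n) i hn x hi⟩
  obtain ⟨κ', hκ'⟩ := exists_locallyFinite_sum _ fun x => (hvan' x).mono fun n hn => hn.1
  obtain ⟨m', hm'⟩ := exists_locallyFinite_sum _ fun x => (hvan' x).mono fun n hn => hn.2
  have hlim : ∀ x, ∀ᶠ n in atTop, (s n).1.1 x = 0 ∧ (s n).1.2 x = 0 := fun x => by
    obtain ⟨i, hi⟩ := (hexh x).exists
    exact eventually_atTop.2 ⟨i + 1, fun n hn => (s n).2.2 i hn x hi⟩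
  refine ⟨κ', derSub_of_eventually (fun n => sum_mem fun i _ => hκ i (s i)) hκ',
    m', derSub_of_eventually (fun n => sum_mem fun i _ => hm i (s i)) hm',
    LinearMap.ext fun x => ?_, LinearMap.ext fun x => ?_⟩
  -- A value of `homDiff` at `x` depends on the values of the map at `x` and at `W.d x` only, so a
  -- single large `n` serves.
  · obtain ⟨n, ⟨h1, -⟩, h2, h3⟩ := ((hlim x).and ((hκ' x).and (hκ' (W.d x)))).exists
    rw [hsum] at h1
    rw [homDiff_apply, h2, h3, ← homDiff_apply, ← sub_eq_zero, ← neg_eq_zero, ← h1]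
    simp
  · obtain ⟨n, ⟨-, h1⟩, h2, h3, h4⟩ :=
      ((hlim x).and ((hκ' x).and ((hm' x).and (hm' (W.d x))))).exists
    rw [hsum] at h1
    rw [homDiff_apply, h3, h4, ← homDiff_apply, LinearMap.sub_apply, LinearMap.comp_apply, h2,
      ← sub_eq_zero, ← neg_eq_zero, ← h1]
    simp only [LinearMap.add_apply, LinearMap.sub_apply, LinearMap.comp_apply]
    abel

end derivations

/-! ### Homotopies between brackets -/

section brackets

variable {k : Type u} [Field k] {M N : Type*} [AddCommGroup M] [Module k M] [AddCommGroup N]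
  [Module k N]

/-- The homotopy between brackets induced by two homotopies. -/
def bracketHomotopy (p q : ℤ) (η₁ η₂ : Module.End k M) (θ₁ θ₂ : Module.End k N)
    (h₁ h₂ : M →ₗ[k] N) : M →ₗ[k] N :=
  h₁ ∘ₗ η₂ + (-1 : k) ^ p • θ₁ ∘ₗ h₂ -
    (-1 : k) ^ (p * q) • (h₂ ∘ₗ η₁ + (-1 : k) ^ q • θ₂ ∘ₗ h₁)

/-- One has `f η₁ η₂ - θ₁ θ₂ f = (f η₁ - θ₁ f) η₂ + θ₁ (f η₂ - θ₂ f)`. As `η₂` and `θ₁` are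
cocycles, this is the differential of `h₁ η₂ + (-1) ^ p θ₁ h₂`. The other half of the commutator is
the same with the indices exchanged. -/
theorem homDiff_bracketHomotopy {dM : M →ₗ[k] M} {dN : N →ₗ[k] N} {f : M →ₗ[k] N} {p q r : ℤ}
    (hr : p + q - 1 = r) {η₁ η₂ : Module.End k M} {θ₁ θ₂ : Module.End k N} {h₁ h₂ : M →ₗ[k] N}
    (hη₁ : homDiff dM dM p η₁ = 0) (hη₂ : homDiff dM dM q η₂ = 0)
    (hθ₁ : homDiff dN dN p θ₁ = 0) (hθ₂ : homDiff dN dN q θ₂ = 0)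
    (hh₁ : f ∘ₗ η₁ - θ₁ ∘ₗ f = homDiff dM dN (p - 1) h₁)
    (hh₂ : f ∘ₗ η₂ - θ₂ ∘ₗ f = homDiff dM dN (q - 1) h₂) :
    f ∘ₗ bracket p q η₁ η₂ - bracket p q θ₁ θ₂ ∘ₗ f =
      homDiff dM dN r (bracketHomotopy p q η₁ η₂ θ₁ θ₂ h₁ h₂) := by
  subst hr
  rw [bracketHomotopy, map_sub, map_add, map_smul, map_smul, map_add, map_smul,
    homDiff_comp dM dM dN (q := p - 1) (p := q) (by ring),
    homDiff_comp dM dN dN (q := p) (p := q - 1) (by ring),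
    homDiff_comp dM dM dN (q := q - 1) (p := p) (by ring),
    homDiff_comp dM dN dN (q := q) (p := p - 1) (by ring), hη₁, hη₂, hθ₁, hθ₂, ← hh₁, ← hh₂]
  ext x
  simp only [bracket, LinearMap.add_apply, LinearMap.sub_apply, LinearMap.smul_apply,
    LinearMap.comp_apply, Module.End.mul_apply, LinearMap.zero_apply, map_sub, map_smul, smul_smul,
    negOnePow_mul_self, smul_sub, smul_add, smul_zero, add_zero, zero_add, map_zero, one_smul]
  abel

theorem bracketHomotopy_mem {gM : ℤ → Submodule k M} {gN : ℤ → Submodule k N} {p q r : ℤ}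
    (hr : p + q - 1 = r) {η₁ η₂ : Module.End k M} {θ₁ θ₂ : Module.End k N} {h₁ h₂ : M →ₗ[k] N}
    (hη₁ : η₁ ∈ homDeg gM gM p) (hη₂ : η₂ ∈ homDeg gM gM q) (hθ₁ : θ₁ ∈ homDeg gN gN p)
    (hθ₂ : θ₂ ∈ homDeg gN gN q) (hh₁ : h₁ ∈ homDeg gM gN (p - 1))
    (hh₂ : h₂ ∈ homDeg gM gN (q - 1)) :
    bracketHomotopy p q η₁ η₂ θ₁ θ₂ h₁ h₂ ∈ homDeg gM gN r := by
  subst hr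
  exact sub_mem (add_mem (homDeg_comp hh₁ hη₂ (by ring))
    (Submodule.smul_mem _ _ (homDeg_comp hθ₁ hh₂ (by ring))))
    (Submodule.smul_mem _ _ (add_mem (homDeg_comp hh₂ hη₁ (by ring))
      (Submodule.smul_mem _ _ (homDeg_comp hθ₂ hh₁ (by ring)))))

variable {W : AugDGA.{u, v} k} {A : AugDGA.{u, w} k} {φ : DGHom W A}

/-- The last summand measures how far the homotopy is from a derivation. Composites such as `h₁ η₂`
have cross terms in their product rule; collected, these pair one `h` with a difference `φ η - θ φ`
for the other index, that is, with the differential of the other `h`. -/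
theorem bracketHomotopy_mul {p q r : ℤ} (hr : p + q - 1 = r) {η₁ η₂ : Module.End k W}
    {θ₁ θ₂ : Module.End k A} {h₁ h₂ : W →ₗ[k] A}
    (hη₁ : η₁ ∈ derSub (DGHom.id W) p) (hη₂ : η₂ ∈ derSub (DGHom.id W) q)
    (hθ₁ : θ₁ ∈ derSub (DGHom.id A) p) (hθ₂ : θ₂ ∈ derSub (DGHom.id A) q)
    (hh₁ : h₁ ∈ derSub φ (p - 1)) (hh₂ : h₂ ∈ derSub φ (q - 1))
    (e₁ : φ.toAlgHom.toLinearMap ∘ₗ η₁ - θ₁ ∘ₗ φ.toAlgHom.toLinearMap =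
      homDiff W.d A.d (p - 1) h₁)
    (e₂ : φ.toAlgHom.toLinearMap ∘ₗ η₂ - θ₂ ∘ₗ φ.toAlgHom.toLinearMap =
      homDiff W.d A.d (q - 1) h₂) (a b : W) :
    bracketHomotopy p q η₁ η₂ θ₁ θ₂ h₁ h₂ (a * b) =
      bracketHomotopy p q η₁ η₂ θ₁ θ₂ h₁ h₂ a * φ b +
      φ (W.sgn r a) * bracketHomotopy p q η₁ η₂ θ₁ θ₂ h₁ h₂ b +
      ((-1 : k) ^ (p * q + q) • (homDiff W.d A.d (q - 1) h₂ (W.sgn (p - 1) a) * h₁ b) -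
        (-1 : k) ^ p • (homDiff W.d A.d (p - 1) h₁ (W.sgn (q - 1) a) * h₂ b) +
        h₁ (W.sgn q a) * homDiff W.d A.d (q - 1) h₂ b -
        (-1 : k) ^ (p * q) • (h₂ (W.sgn p a) * homDiff W.d A.d (p - 1) h₁ b)) := by
  subst hr
  have i1 : ∀ x : W, (DGHom.id W) x = x := fun _ => rfl
  have i2 : ∀ x : A, (DGHom.id A) x = x := fun _ => rfl
  have c1 : ∀ x, φ.toAlgHom.toLinearMap x = φ x := fun _ => rfl
  rw [← e₁, ← e₂]
  simp only [bracketHomotopy, LinearMap.add_apply, LinearMap.sub_apply, LinearMap.smul_apply,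
    LinearMap.comp_apply, derSub_mul hη₁, derSub_mul hη₂, derSub_mul hh₁, derSub_mul hh₂, i1, i2,
    c1, map_add, derSub_mul hθ₁, derSub_mul hθ₂, φ.map_sgn, homDeg_sgn (derSub_homDeg hη₁),
    homDeg_sgn (derSub_homDeg hη₂), homDeg_sgn (derSub_homDeg hh₁), map_smul,
    homDeg_sgn (derSub_homDeg hh₂), W.sgn_sgn]
  rw [show q + (p - 1) = p + q - 1 by ring, show p + (q - 1) = p + q - 1 by ring]
  by_cases hp : Even p <;> by_cases hq : Even q <;>
    simp [neg_one_zpow_eq_ite, Int.even_add, Int.even_mul, Int.even_sub,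
      hp, hq, mul_sub, sub_mul, mul_add, add_mul] <;> abel

/-- Differentiating the cross terms of `Z` produces products of one `h` with the differential of the
other, the same products as in `bracketHomotopy_mul`. The degree of `Z` is `p + q - 2`; writing `p +
q` in `homDiff` is harmless since only the parity counts. -/
theorem homDiff_secondOrder_mul {p q : ℤ} {h₁ h₂ Z : W →ₗ[k] A}
    (hh₁ : h₁ ∈ derSub φ (p - 1)) (hh₂ : h₂ ∈ derSub φ (q - 1))
    (hZd : Z ∈ homDeg W.gr A.gr (p - 1 + (q - 1))) (hZ : ∀ a b, Z (a * b) = Z a * φ b + φ (W.sgn (p - 1 + (q - 1)) a) * Z b +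
      h₁ (W.sgn (q - 1) a) * h₂ b +
      (-1 : k) ^ ((p - 1) * (q - 1)) • (h₂ (W.sgn (p - 1) a) * h₁ b)) (a b : W) :
    homDiff W.d A.d (p + q) Z (a * b) = homDiff W.d A.d (p + q) Z a * φ b +
      φ (W.sgn (p + q - 1) a) * homDiff W.d A.d (p + q) Z b +
      (homDiff W.d A.d (p - 1) h₁ (W.sgn (q - 1) a) * h₂ b -
        (-1 : k) ^ p • (h₁ (W.sgn q a) * homDiff W.d A.d (q - 1) h₂ b) +
        (-1 : k) ^ ((p - 1) * (q - 1)) •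
          (homDiff W.d A.d (q - 1) h₂ (W.sgn (p - 1) a) * h₁ b -
            (-1 : k) ^ q • (h₂ (W.sgn p a) * homDiff W.d A.d (p - 1) h₁ b))) := by
  have hp1 : (1 : ℤ) + (p - 1) = p := by ring
  have hq1 : (1 : ℤ) + (q - 1) = q := by ring
  have hp2 : p - 1 + 1 = p := by ring
  have hq2 : q - 1 + 1 = q := by ring
  have hpq : p - 1 + (q - 1) + 1 = p + q - 1 := by ring
  have hpq' : 1 + (p - 1 + (q - 1)) = p + q - 1 := by ring
  simp only [homDiff_apply, hZ, W.d_mul, A.d_mul, map_add, map_smul, φ.map_sgn, ← φ.map_d,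
    homDeg_sgn (derSub_homDeg hh₁), homDeg_sgn (derSub_homDeg hh₂), homDeg_sgn (d_mem_homDeg W),
    homDeg_sgn hZd, W.sgn_sgn, hp1, hq1, hp2, hq2, hpq, hpq']
  by_cases hp : Even p <;> by_cases hq : Even q <;>
    simp [neg_one_zpow_eq_ite, Int.even_add, Int.even_mul, Int.even_sub,
      ← Int.not_even_iff_odd, hp, hq, mul_sub, sub_mul,
      mul_add, add_mul] <;> abel

/-- Derivations of a Sullivan algebra that correspond to derivations of `A` up to homotopy have
brackets that correspond up to homotopy. -/
theorem exists_bracket_homotopy {V : Submodule k W} (hV : W.IsFreeGCOn V) (hA : A.IsGradedComm)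
    {p q : ℤ} {η₁ η₂ : Module.End k W} {θ₁ θ₂ : Module.End k A} {h₁ h₂ : W →ₗ[k] A}
    (hη₁ : η₁ ∈ derSub (DGHom.id W) p) (hη₂ : η₂ ∈ derSub (DGHom.id W) q)
    (hθ₁ : θ₁ ∈ derSub (DGHom.id A) p) (hθ₂ : θ₂ ∈ derSub (DGHom.id A) q)
    (hh₁ : h₁ ∈ derSub φ (p - 1)) (hh₂ : h₂ ∈ derSub φ (q - 1))
    (dη₁ : homDiff W.d W.d p η₁ = 0) (dη₂ : homDiff W.d W.d q η₂ = 0)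
    (dθ₁ : homDiff A.d A.d p θ₁ = 0) (dθ₂ : homDiff A.d A.d q θ₂ = 0)
    (e₁ : φ.toAlgHom.toLinearMap ∘ₗ η₁ - θ₁ ∘ₗ φ.toAlgHom.toLinearMap =
      homDiff W.d A.d (p - 1) h₁)
    (e₂ : φ.toAlgHom.toLinearMap ∘ₗ η₂ - θ₂ ∘ₗ φ.toAlgHom.toLinearMap =
      homDiff W.d A.d (q - 1) h₂) :
    ∃ h ∈ derSub φ (p + q - 1), φ.toAlgHom.toLinearMap ∘ₗ bracket p q η₁ η₂ -
      bracket p q θ₁ θ₂ ∘ₗ φ.toAlgHom.toLinearMap = homDiff W.d A.d (p + q - 1) h := by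
  obtain ⟨Z, hZd, hZ⟩ := hV.exists_secondOrder hA φ hh₁ hh₂
  have hX := homDiff_bracketHomotopy (f := φ.toAlgHom.toLinearMap) rfl dη₁ dη₂ dθ₁ dθ₂ e₁ e₂
  have hXmul := bracketHomotopy_mul rfl hη₁ hη₂ hθ₁ hθ₂ hh₁ hh₂ e₁ e₂
  have hZmul := homDiff_secondOrder_mul hh₁ hh₂ hZd hZ
  set X := bracketHomotopy p q η₁ η₂ θ₁ θ₂ h₁ h₂ with hXdef
  -- The square of the differential is zero also with these indices, because `p + q + 1` and `p + q
  -- - 1` give the same sign.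
  have hdZ : homDiff W.d A.d (p + q - 1) (homDiff W.d A.d (p + q) Z) = 0 := by
    have := homDiff_homDiff W.d_d A.d_d rfl Z (p := p + q)
    rw [homDiff_def, negOnePow_add_one] at this
    rwa [homDiff_def, negOnePow_sub_one]
  -- The added coboundary does not affect the differential of `X`, and with the sign `(-1) ^ p` it
  -- cancels the defect of `X` in the Leibniz rule.
  let Y := X + (-1 : k) ^ p • homDiff W.d A.d (p + q) Z
  have hYd : homDiff W.d A.d (p + q - 1) Y = homDiff W.d A.d (p + q - 1) X := by
    rw [map_add, map_smul, hdZ, smul_zero, add_zero]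
  refine ⟨Y, mem_derSub (add_mem ?_ (Submodule.smul_mem _ _ (sub_mem ?_
    (Submodule.smul_mem _ _ ?_)))) fun a b => ?_, by rw [hX, hYd]⟩
  · exact bracketHomotopy_mem rfl (derSub_homDeg hη₁) (derSub_homDeg hη₂) (derSub_homDeg hθ₁)
      (derSub_homDeg hθ₂) (derSub_homDeg hh₁) (derSub_homDeg hh₂)
  · exact homDeg_comp (d_mem_homDeg A) hZd (by ring)
  · exact homDeg_comp hZd (d_mem_homDeg W) (by ring)
  · simp only [Y, LinearMap.add_apply, LinearMap.smul_apply, hXmul, hZmul]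
    by_cases hp : Even p <;> by_cases hq : Even q <;>
      simp [neg_one_zpow_eq_ite, Int.even_add, Int.even_mul, ← Int.not_even_iff_odd,
        hp, hq, mul_add, add_mul] <;> abel

end brackets

/-! ### Perturbations of contractible complexes -/

section perturbation

variable {k : Type u} [Field k] {X : Type*} [AddCommGroup X] [Module k X]

/-- A differential that differs from a contractible one by terms which lower an exhaustive
filtration is acyclic. -/
theorem acyclic_of_filtered_contraction {D D₁ K : X →ₗ[k] X} (Q : ℕ → Submodule k X)
    (hQ0 : Q 0 = ⊥) (hQ : ∀ x, ∃ n, x ∈ Q n) (hD : ∀ x, D (D x) = 0)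
    (hK : ∀ x, D₁ (K x) + K (D₁ x) = x) (hKQ : ∀ n, ∀ x ∈ Q n, K x ∈ Q n)
    (hDQ : ∀ n, ∀ x ∈ Q (n + 1), D x - D₁ x ∈ Q n) (x : X) (hx : D x = 0) : ∃ y, x = D y := by
  obtain ⟨n, hn⟩ := hQ x
  induction n generalizing x with
  | zero =>
    rw [hQ0, Submodule.mem_bot] at hn
    exact ⟨0, by rw [hn, map_zero]⟩
  | succ n ih =>
    -- For a cocycle `x`, the element `K x` is a primitive up to errors involving `D - D₁`, and
    -- these lie one step lower in the filtration.
    have e : x - D (K x) = -(D (K x) - D₁ (K x)) - K (D x - D₁ x) := by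
      rw [hx, zero_sub, map_neg]
      nth_rewrite 1 [← hK x]
      abel
    obtain ⟨y, hy⟩ := ih (x - D (K x)) (by rw [map_sub, hx, hD, sub_zero]) (by
      rw [e]
      exact sub_mem (neg_mem (hDQ n _ (hKQ _ _ hn))) (hKQ _ _ (hDQ n _ hn)))
    exact ⟨y + K x, by rw [map_add, ← hy, sub_add_cancel]⟩

end perturbation

/-! ### Words in complexes -/

section words

variable {k : Type u} [Field k] {A E A' E' : Type*} [AddCommGroup A] [Module k A] [AddCommGroup E]
  [Module k E] [AddCommGroup A'] [Module k A'] [AddCommGroup E'] [Module k E']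

/-- The sign `w ↦ (-1) ^ |w| w` on words, in terms of those on the entries. -/
def wSign (s : A →ₗ[k] A) (s' : E →ₗ[k] E) : Words k A E →ₗ[k] Words k A E :=
  wordRec (nil ∘ₗ s) 0 (-(snoc ∘ₗ s'))

/-- The extension of operators `h`, `h'` of odd degree on the entries to words, as a derivation
along `P`, where `τ` is the sign operator. -/
def wDer (h : A →ₗ[k] A) (h' : E →ₗ[k] E) (τ P : Words k A E →ₗ[k] Words k A E) :
    Words k A E →ₗ[k] Words k A E :=
  wordRec (nil ∘ₗ h) (-((snoc ∘ₗ h').compl₂ (τ ∘ₗ P))) snoc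

/-- Maps on words induced by maps on entries. -/
def wMap (f : A →ₗ[k] A') (f' : E →ₗ[k] E') : Words k A E →ₗ[k] Words k A' E' :=
  wordRec (nil ∘ₗ f) 0 (snoc ∘ₗ f')

@[simp] theorem wSign_nil (s : A →ₗ[k] A) (s' : E →ₗ[k] E) (a : A) :
    wSign s s' (nil a) = nil (s a) := by simp [wSign, wordRec_nil]

@[simp] theorem wSign_snoc (s : A →ₗ[k] A) (s' : E →ₗ[k] E) (e : E) (w : Words k A E) :
    wSign s s' (snoc e w) = -snoc (s' e) (wSign s s' w) := by simp [wSign, wordRec_snoc]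

@[simp] theorem wDer_nil (h : A →ₗ[k] A) (h' : E →ₗ[k] E) (τ P : Words k A E →ₗ[k] Words k A E)
    (a : A) : wDer h h' τ P (nil a) = nil (h a) := by simp [wDer, wordRec_nil]

@[simp] theorem wDer_snoc (h : A →ₗ[k] A) (h' : E →ₗ[k] E) (τ P : Words k A E →ₗ[k] Words k A E)
    (e : E) (w : Words k A E) :
    wDer h h' τ P (snoc e w) = snoc e (wDer h h' τ P w) - snoc (h' e) (τ (P w)) := by
  simp [wDer, wordRec_snoc]; abel

@[simp] theorem wMap_nil (f : A →ₗ[k] A') (f' : E →ₗ[k] E') (a : A) :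
    wMap f f' (nil a) = nil (f a) := by simp [wMap, wordRec_nil]

@[simp] theorem wMap_snoc (f : A →ₗ[k] A') (f' : E →ₗ[k] E') (e : E) (w : Words k A E) :
    wMap f f' (snoc e w) = snoc (f' e) (wMap f f' w) := by simp [wMap, wordRec_snoc]

theorem wMap_wMap {A'' E'' : Type*} [AddCommGroup A''] [Module k A''] [AddCommGroup E'']
    [Module k E''] (g : A' →ₗ[k] A'') (g' : E' →ₗ[k] E'') (f : A →ₗ[k] A') (f' : E →ₗ[k] E')
    (w : Words k A E) : wMap g g' (wMap f f' w) = wMap (g ∘ₗ f) (g' ∘ₗ f') w := by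
  induction w using word_induction with
  | h₀ a => simp
  | h₁ w e ih => simp [ih]
  | hadd x y hx hy => simp only [map_add, hx, hy]
  | hsmul c x hx => simp only [map_smul, hx]

theorem wSign_wSign {s : A →ₗ[k] A} {s' : E →ₗ[k] E} (hs : ∀ a, s (s a) = a)
    (hs' : ∀ a, s' (s' a) = a) (w : Words k A E) : wSign s s' (wSign s s' w) = w := by
  induction w using word_induction with
  | h₀ a => simp [hs]
  | h₁ w e ih => simp [ih, hs']
  | hadd x y hx hy => simp only [map_add, hx, hy]
  | hsmul c x hx => simp only [map_smul, hx]

theorem wMap_wSign {s : A →ₗ[k] A} {s' : E →ₗ[k] E} {t : A' →ₗ[k] A'} {t' : E' →ₗ[k] E'}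
    {f : A →ₗ[k] A'} {f' : E →ₗ[k] E'} (hf : ∀ a, f (s a) = t (f a))
    (hf' : ∀ a, f' (s' a) = t' (f' a)) (w : Words k A E) :
    wMap f f' (wSign s s' w) = wSign t t' (wMap f f' w) := by
  induction w using word_induction with
  | h₀ a => simp [hf]
  | h₁ w e ih => simp [ih, hf']
  | hadd x y hx hy => simp only [map_add, hx, hy]
  | hsmul c x hx => simp only [map_smul, hx]

theorem wDer_wSign {s : A →ₗ[k] A} {s' : E →ₗ[k] E} (hs : ∀ a, s (s a) = a)
    (hs' : ∀ a, s' (s' a) = a) {h : A →ₗ[k] A} {h' : E →ₗ[k] E} (hh : ∀ a, h (s a) = -s (h a))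
    (hh' : ∀ a, h' (s' a) = -s' (h' a)) {P : Words k A E →ₗ[k] Words k A E}
    (hP : ∀ w, P (wSign s s' w) = wSign s s' (P w)) (w : Words k A E) :
    wDer h h' (wSign s s') P (wSign s s' w) = -wSign s s' (wDer h h' (wSign s s') P w) := by
  induction w using word_induction with
  | h₀ a => simp [hh]
  | h₁ w e ih => simp [ih, hh', hP, wSign_wSign hs hs']
  | hadd x y hx hy => simp only [map_add, hx, hy]; abel
  | hsmul c x hx => simp only [map_smul, hx, smul_neg]

theorem wDer_wMap {τ : Words k A E →ₗ[k] Words k A E} {τ' : Words k A' E' →ₗ[k] Words k A' E'}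
    {f : A →ₗ[k] A'} {f' : E →ₗ[k] E'} (hτ : ∀ w, wMap f f' (τ w) = τ' (wMap f f' w))
    {d : A →ₗ[k] A} {d' : E →ₗ[k] E} {δ : A' →ₗ[k] A'} {δ' : E' →ₗ[k] E'}
    (hf : ∀ a, f (d a) = δ (f a)) (hf' : ∀ a, f' (d' a) = δ' (f' a)) (w : Words k A E) :
    wMap f f' (wDer d d' τ LinearMap.id w) = wDer δ δ' τ' LinearMap.id (wMap f f' w) := by
  induction w using word_induction with
  | h₀ a => simp [hf]
  | h₁ w e ih => simp [ih, hf', hτ]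
  | hadd x y hx hy => simp only [map_add, hx, hy]
  | hsmul c x hx => simp only [map_smul, hx]

/-- Homotopies on the entries induce homotopies on words. -/
theorem wDer_homotopy {s : A →ₗ[k] A} {s' : E →ₗ[k] E} (hs : ∀ a, s (s a) = a)
    (hs' : ∀ a, s' (s' a) = a) {d h p : A →ₗ[k] A} {d' h' p' : E →ₗ[k] E}
    (hd : ∀ a, d (s a) = -s (d a)) (hd' : ∀ a, d' (s' a) = -s' (d' a))
    (hh : ∀ a, h (s a) = -s (h a)) (hh' : ∀ a, h' (s' a) = -s' (h' a))
    (hps : ∀ a, p (s a) = s (p a)) (hps' : ∀ a, p' (s' a) = s' (p' a))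
    (hpd : ∀ a, p (d a) = d (p a)) (hpd' : ∀ a, p' (d' a) = d' (p' a))
    (hp : ∀ a, p a = a + d (h a) + h (d a)) (hp' : ∀ a, p' a = a + d' (h' a) + h' (d' a))
    (w : Words k A E) :
    wMap p p' w = w +
      wDer d d' (wSign s s') LinearMap.id (wDer h h' (wSign s s') (wMap p p') w) +
      wDer h h' (wSign s s') (wMap p p') (wDer d d' (wSign s s') LinearMap.id w) := by
  -- This is the tensor trick. The entries to the left of the place where the homotopy acts are
  -- replaced by their images under `p`, `p'`, those to the right are left alone, and the commutator
  -- with the differential telescopes as in `p ⊗ p' - 1 = (p - 1) ⊗ 1 + p ⊗ (p' - 1)`.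
  have hP := wMap_wSign (k := k) hps hps'
  induction w using word_induction with
  | h₀ a => simp only [wMap_nil, wDer_nil, ← map_add, ← hp]
  | h₁ w e ih =>
    have e1 := wDer_wSign (P := LinearMap.id) hs hs' hd hd' (fun _ => rfl)
    have e2 := wDer_wSign hs hs' hh hh' hP
    have e3 := wDer_wMap hP hpd hpd'
    simp only [wDer_snoc, wMap_snoc, map_sub, LinearMap.id_apply, e1, e2, e3, hP,
      wSign_wSign hs hs']
    have e4 : snoc (p' e) (wMap p p' w) = snoc e (wMap p p' w) +
        snoc (d' (h' e)) (wMap p p' w) + snoc (h' (d' e)) (wMap p p' w) := by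
      rw [hp' e, map_add, map_add]; rfl
    have e5 := congrArg (snoc e) ih
    rw [map_add, map_add] at e5
    rw [e4, e5]
    simp only [map_neg]
    abel
  | hadd x y hx hy => simp only [map_add]; rw [hx, hy]; abel
  | hsmul c x hx => simp only [map_smul]; rw [hx]; simp only [smul_add]

/-! Length -/

/-- The words of length less than `n`. -/
def lengthLT (k : Type u) [Field k] (A E : Type*) [AddCommGroup A] [Module k A] [AddCommGroup E]
    [Module k E] : ℕ → Submodule k (Words k A E)
  | 0 => ⊥
  | n + 1 => LinearMap.range (nil : A →ₗ[k] Words k A E) ⊔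
      Submodule.map₂ snoc ⊤ (lengthLT k A E n)

theorem nil_mem_lengthLT (n : ℕ) (a : A) : (nil a : Words k A E) ∈ lengthLT k A E (n + 1) :=
  Submodule.mem_sup_left ⟨a, rfl⟩

theorem snoc_mem_lengthLT {n : ℕ} (e : E) {w : Words k A E} (hw : w ∈ lengthLT k A E n) :
    snoc e w ∈ lengthLT k A E (n + 1) :=
  Submodule.mem_sup_right (Submodule.apply_mem_map₂ _ trivial hw)

theorem mem_of_lengthLT_succ {N : Type*} [AddCommGroup N] [Module k N] (T : Words k A E →ₗ[k] N)
    (Y : Submodule k N) {n : ℕ} (h₀ : ∀ a, T (nil a) ∈ Y)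
    (h₁ : ∀ e, ∀ w ∈ lengthLT k A E n, T (snoc e w) ∈ Y) {w : Words k A E}
    (hw : w ∈ lengthLT k A E (n + 1)) : T w ∈ Y := by
  have : lengthLT k A E (n + 1) ≤ Y.comap T := by
    refine sup_le ?_ (Submodule.map₂_le.2 fun e _ w hw => h₁ e w hw)
    rintro _ ⟨a, rfl⟩
    exact h₀ a
  exact this hw

theorem lengthLT_mono : Monotone (lengthLT k A E) := by
  refine monotone_nat_of_le_succ fun n => ?_
  induction n with
  | zero => exact bot_le
  | succ n ih =>
    exact sup_le_sup_left (Submodule.map₂_le_map₂_right ih) _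

theorem exists_mem_lengthLT (w : Words k A E) : ∃ n, w ∈ lengthLT k A E n := by
  induction w using word_induction with
  | h₀ a => exact ⟨1, nil_mem_lengthLT 0 a⟩
  | h₁ w e ih =>
    obtain ⟨n, hn⟩ := ih
    exact ⟨n + 1, snoc_mem_lengthLT e hn⟩
  | hadd x y hx hy =>
    obtain ⟨n, hn⟩ := hx
    obtain ⟨m, hm⟩ := hy
    exact ⟨max n m, add_mem (lengthLT_mono (le_max_left n m) hn)
      (lengthLT_mono (le_max_right n m) hm)⟩
  | hsmul c x hx =>
    obtain ⟨n, hn⟩ := hx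
    exact ⟨n, Submodule.smul_mem _ c hn⟩

/-- Operators that are defined by recursion without increasing the length. -/
theorem lengthLT_of_recursive (T : Words k A E →ₗ[k] Words k A' E')
    (h₀ : ∀ a, ∃ a', T (nil a) = nil a')
    (h₁ : ∀ n e, ∀ w ∈ lengthLT k A E n, T w ∈ lengthLT k A' E' n →
      T (snoc e w) ∈ lengthLT k A' E' (n + 1)) {n : ℕ} {w : Words k A E}
    (hw : w ∈ lengthLT k A E n) : T w ∈ lengthLT k A' E' n := by
  induction n generalizing w with
  | zero =>
    rw [show w = 0 from hw, map_zero]; exact zero_mem _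
  | succ n ih =>
    refine mem_of_lengthLT_succ T _ (fun a => ?_) (fun e w hw => h₁ n e w hw (ih hw)) hw
    obtain ⟨a', ha'⟩ := h₀ a
    rw [ha']; exact nil_mem_lengthLT n a'

theorem wSign_lengthLT (s : A →ₗ[k] A) (s' : E →ₗ[k] E) {n : ℕ} {w : Words k A E}
    (hw : w ∈ lengthLT k A E n) : wSign s s' w ∈ lengthLT k A E n :=
  lengthLT_of_recursive _ (fun a => ⟨_, wSign_nil s s' a⟩) (fun n e w _ ih => by
    rw [wSign_snoc]; exact neg_mem (snoc_mem_lengthLT _ ih)) hw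

theorem wMap_lengthLT (f : A →ₗ[k] A') (f' : E →ₗ[k] E') {n : ℕ} {w : Words k A E}
    (hw : w ∈ lengthLT k A E n) : wMap f f' w ∈ lengthLT k A' E' n :=
  lengthLT_of_recursive _ (fun a => ⟨_, wMap_nil f f' a⟩) (fun n e w _ ih => by
    rw [wMap_snoc]; exact snoc_mem_lengthLT _ ih) hw

theorem wDer_lengthLT (h : A →ₗ[k] A) (h' : E →ₗ[k] E) {τ P : Words k A E →ₗ[k] Words k A E}
    (hτ : ∀ n, ∀ w ∈ lengthLT k A E n, τ w ∈ lengthLT k A E n)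
    (hP : ∀ n, ∀ w ∈ lengthLT k A E n, P w ∈ lengthLT k A E n) {n : ℕ} {w : Words k A E}
    (hw : w ∈ lengthLT k A E n) : wDer h h' τ P w ∈ lengthLT k A E n :=
  lengthLT_of_recursive _ (fun a => ⟨_, wDer_nil h h' τ P a⟩) (fun n e w hw ih => by
    rw [wDer_snoc]
    exact sub_mem (snoc_mem_lengthLT _ ih) (snoc_mem_lengthLT _ (hτ _ _ (hP _ _ hw)))) hw

end words

/-! ### Hochschild chains of a quasi-isomorphism -/

section hochschild

variable {k : Type u} [Field k]

theorem AugDGA.aug_sgn (A : AugDGA.{u, v} k) (p : ℤ) (a : A) : A.aug (A.sgn p a) = A.aug a := by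
  have : A.aug.toLinearMap ∘ₗ A.sgn p = A.aug.toLinearMap :=
    linearMap_ext_of_graded A.gr fun n x hx => by
      rw [LinearMap.comp_apply, A.sgn_apply p hx]
      by_cases hn : n = 0
      · simp [hn]
      · have : A.aug.toLinearMap x = 0 := A.aug_gr hn hx
        rw [map_smul, this, smul_zero]
  exact LinearMap.congr_fun this a

section bar

variable {A : AugDGA.{u, v} k} {B : AugDGA.{u, w} k}

/-- The map between augmentation ideals induced by a linear map. -/
def barMap (T : A →ₗ[k] B) : A.bar →ₗ[k] B.bar := B.proj ∘ₗ T ∘ₗ A.bar.subtype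

theorem barMap_apply (T : A →ₗ[k] B) (e : A.bar) : barMap T e = B.proj (T e) := rfl

/-- In general `barMap` is not functorial, since the inner projection subtracts a multiple of `1`.
This does no harm if the outer map sends `1` to a scalar, as `φ`, the differential and the sign
operator do. -/
theorem barMap_comp_of_one {C : AugDGA.{u, x} k} (S : B →ₗ[k] C) (T : A →ₗ[k] B)
    (h : C.proj (S 1) = 0) (e : A.bar) : barMap S (barMap T e) = barMap (S ∘ₗ T) e := by
  simp [barMap_apply, coe_proj', h]

/-- Here nothing is subtracted, because the inner map preserves the augmentation ideals. Either this
or `barMap_comp_of_one` applies to every composite needed, even though the homotopy inverse and the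
homotopies of a contraction need not respect `1` or the augmentation. -/
theorem barMap_comp_of_aug {C : AugDGA.{u, x} k} (S : B →ₗ[k] C) (T : A →ₗ[k] B)
    (h : ∀ a, A.aug a = 0 → B.aug (T a) = 0) (e : A.bar) :
    barMap S (barMap T e) = barMap (S ∘ₗ T) e := by
  have : B.aug (T e) = 0 := h e e.2
  simp [barMap_apply, coe_proj', this]

theorem proj_d_one (A : AugDGA.{u, v} k) : A.proj (A.d 1) = 0 := by rw [d_one, map_zero]

theorem proj_sgn_one (A : AugDGA.{u, v} k) : A.proj (A.sgn 1 1) = 0 := by rw [sgn_one, proj_one]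

theorem aug_d_of_aug (A : AugDGA.{u, v} k) (a : A) (_ : A.aug a = 0) : A.aug (A.d a) = 0 :=
  A.aug_d a

theorem aug_sgn_of_aug (A : AugDGA.{u, v} k) (a : A) (h : A.aug a = 0) :
    A.aug (A.sgn 1 a) = 0 := by rw [A.aug_sgn, h]

theorem sgn_one_sgn_one (A : AugDGA.{u, v} k) (a : A) : A.sgn 1 (A.sgn 1 a) = a := by
  rw [A.sgn_sgn, A.sgn_even (by decide)]

theorem barMap_sgn_sgn (A : AugDGA.{u, v} k) (e : A.bar) :
    barMap (A.sgn 1) (barMap (A.sgn 1) e) = e := by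
  rw [barMap_comp_of_one _ _ (proj_sgn_one A), barMap_apply, LinearMap.comp_apply,
    sgn_one_sgn_one, proj_coe]

theorem odd_sgn {f : A →ₗ[k] B} {q : ℤ} (hf : f ∈ homDeg A.gr B.gr q) (hq : Odd q) (a : A) :
    f (A.sgn 1 a) = -B.sgn 1 (f a) := by
  rw [homDeg_sgn hf, one_mul, hq.neg_one_zpow, neg_smul, one_smul, neg_neg]

theorem even_sgn {f : A →ₗ[k] B} (hf : f ∈ homDeg A.gr B.gr 0) (a : A) :
    f (A.sgn 1 a) = B.sgn 1 (f a) := by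
  rw [homDeg_sgn hf, mul_zero, zpow_zero, one_smul]

theorem barMap_odd_sgn {f : A →ₗ[k] B} {q : ℤ} (hf : f ∈ homDeg A.gr B.gr q) (hq : Odd q)
    (e : A.bar) : barMap f (barMap (A.sgn 1) e) = -barMap (B.sgn 1) (barMap f e) := by
  rw [barMap_comp_of_aug _ _ (aug_sgn_of_aug A), barMap_comp_of_one _ _ (proj_sgn_one B)]
  simp only [barMap_apply, LinearMap.comp_apply, odd_sgn hf hq, map_neg]

theorem barMap_even_sgn {f : A →ₗ[k] B} (hf : f ∈ homDeg A.gr B.gr 0) (e : A.bar) :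
    barMap f (barMap (A.sgn 1) e) = barMap (B.sgn 1) (barMap f e) := by
  rw [barMap_comp_of_aug _ _ (aug_sgn_of_aug A), barMap_comp_of_one _ _ (proj_sgn_one B)]
  simp only [barMap_apply, LinearMap.comp_apply, even_sgn hf]

theorem barMap_d {f : A →ₗ[k] B} (hf : ∀ a, f (A.d a) = B.d (f a)) (e : A.bar) :
    barMap f (barMap A.d e) = barMap B.d (barMap f e) := by
  rw [barMap_comp_of_aug _ _ (aug_d_of_aug A), barMap_comp_of_one _ _ (proj_d_one B)]
  simp only [barMap_apply, LinearMap.comp_apply, hf]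

/-- The differential kills `1` and takes values in the augmentation ideal, so it composes correctly
with `h` on both sides. -/
theorem barMap_homotopy {p h : A →ₗ[k] A} (hp : ∀ a, p a = a + A.d (h a) + h (A.d a))
    (e : A.bar) :
    barMap p e = e + barMap A.d (barMap h e) + barMap h (barMap A.d e) := by
  rw [barMap_comp_of_one _ _ (proj_d_one A), barMap_comp_of_aug _ _ (aug_d_of_aug A)]
  simp only [barMap_apply, LinearMap.comp_apply, hp, map_add, proj_coe]

end bar

variable {A : AugDGA.{u, v} k} {B : AugDGA.{u, w} k}

/-! The part of the Hochschild differential that preserves the length of words -/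

variable (A) in
/-- The sign operator on Hochschild chains. -/
def hochSign : Hoch A →ₗ[k] Hoch A := wSign (A.sgn 1) (barMap (A.sgn 1))

variable (A) in
/-- The differential of the tensor product `A ⊗ T(sĀ)`. -/
def hochLin : Hoch A →ₗ[k] Hoch A := wDer A.d (barMap A.d) (hochSign A) LinearMap.id

theorem hochMap_eq (φ : DGHom A B) :
    hochMap φ = wMap φ.toAlgHom.toLinearMap (barMap φ.toAlgHom.toLinearMap) := by
  ext w
  induction w using word_induction with
  | h₀ a => simp [hochMap]
  | h₁ w e ih =>
    rw [wMap_snoc, ← ih]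
    simp [hochMap, barMap_apply]
  | hadd x y hx hy => simp only [map_add, hx, hy]
  | hsmul c x hx => simp only [map_smul, hx]

theorem hochSign_eq (w : Hoch A) : hochProj A (signU A 1 (hochIncl A w)) = hochSign A w := by
  rw [hochSign]
  induction w using word_induction with
  | h₀ a => simp
  | h₁ w e ih => simp [ih, barMap_apply]
  | hadd x y hx hy => simp only [map_add, hx, hy]
  | hsmul c x hx => simp only [map_smul, hx]

theorem hochIncl_lengthLT {n : ℕ} {w : Hoch A} (hw : w ∈ lengthLT k A A.bar n) :
    hochIncl A w ∈ lengthLT k A A n :=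
  lengthLT_of_recursive _ (fun a => ⟨_, hochIncl_nil a⟩) (fun n e w _ ih => by
    rw [hochIncl_snoc]; exact snoc_mem_lengthLT _ ih) hw

theorem hochProj_lengthLT {n : ℕ} {w : UHoch A} (hw : w ∈ lengthLT k A A n) :
    hochProj A w ∈ lengthLT k A A.bar n :=
  lengthLT_of_recursive _ (fun a => ⟨_, hochProj_nil a⟩) (fun n e w _ ih => by
    rw [hochProj_snoc]; exact snoc_mem_lengthLT _ ih) hw

theorem signU_lengthLT (p : ℤ) {n : ℕ} {w : UHoch A} (hw : w ∈ lengthLT k A A n) :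
    signU A p w ∈ lengthLT k A A n :=
  lengthLT_of_recursive _ (fun a => ⟨_, signU_nil A p a⟩) (fun n e w _ ih => by
    rw [signU_snoc]; exact Submodule.smul_mem _ _ (snoc_mem_lengthLT _ ih)) hw

theorem lmulU_lengthLT (a : A) {n : ℕ} {w : UHoch A} (hw : w ∈ lengthLT k A A n) :
    lmulU A a w ∈ lengthLT k A A n :=
  lengthLT_of_recursive _ (fun b => ⟨_, lmulU_nil A a b⟩) (fun n e w _ ih => by
    rw [lmulU_snoc]; exact snoc_mem_lengthLT _ ih) hw

theorem mergeU_lengthLT (a : A) {n : ℕ} {w : UHoch A} (hw : w ∈ lengthLT k A A n) :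
    mergeU A w a ∈ lengthLT k A A n :=
  lengthLT_of_recursive ((mergeU A).flip a) (fun b => ⟨_, mergeU_nil A b a⟩) (fun n e w hw _ => by
    rw [LinearMap.flip_apply, mergeU_snoc]
    exact neg_mem (snoc_mem_lengthLT _ (signU_lengthLT 1 hw))) hw

theorem rotU_lengthLT (a : A) {n : ℕ} {w : UHoch A} (hw : w ∈ lengthLT k A A n) :
    rotU A a w ∈ lengthLT k A A n := by
  induction a using DirectSum.Decomposition.inductionOn A.gr with
  | zero => simp
  | homogeneous a => rw [rotU_apply A a.2]; exact lmulU_lengthLT _ (signU_lengthLT _ hw)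
  | add a b ha hb => rw [map_add, LinearMap.add_apply]; exact add_mem ha hb

/-- The remaining part of the Hochschild differential decreases the length. -/
theorem hochD_sub_hochLin_lengthLT {n : ℕ} {w : Hoch A} (hw : w ∈ lengthLT k A A.bar (n + 1)) :
    hochD A w - hochLin A w ∈ lengthLT k A A.bar n := by
  -- The cyclic term uses up the last letter.
  have h1 : hochProj A (cycU A (hochIncl A w)) ∈ lengthLT k A A.bar n := by
    refine mem_of_lengthLT_succ (hochProj A ∘ₗ cycU A ∘ₗ hochIncl A) _ (fun a => ?_)
      (fun e w hw => ?_) hw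
    · simp
    · simp only [LinearMap.comp_apply, hochIncl_snoc, cycU_snoc, map_neg]
      exact neg_mem (hochProj_lengthLT (rotU_lengthLT _ (hochIncl_lengthLT hw)))
  have h2 : hochProj A (dbarU A (hochIncl A w)) - hochLin A w ∈ lengthLT k A A.bar n := by
    clear h1
    induction n generalizing w with
    | zero =>
      refine mem_of_lengthLT_succ (hochProj A ∘ₗ dbarU A ∘ₗ hochIncl A - hochLin A) _
        (fun a => ?_) (fun e w hw => ?_) hw
      · simp [hochLin]
      · rw [show w = 0 from hw]; simp
    | succ n ih =>
      refine mem_of_lengthLT_succ (hochProj A ∘ₗ dbarU A ∘ₗ hochIncl A - hochLin A) _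
        (fun a => ?_) (fun e w hw => ?_) hw
      · simp [hochLin]
      -- The tensor differential cancels. There remain the difference for the shorter word and the
      -- product of `e` into the last entry of `w`, which does not make `w` longer.
      · have e1 : (hochProj A ∘ₗ dbarU A ∘ₗ hochIncl A - hochLin A) (snoc e w) =
            snoc e (hochProj A (dbarU A (hochIncl A w)) - hochLin A w) +
              hochProj A (mergeU A (hochIncl A w) e) := by
          simp only [hochLin, LinearMap.sub_apply, LinearMap.comp_apply, hochIncl_snoc, dbarU_snoc,
            map_add, map_sub, hochProj_snoc, proj_coe, hochSign_eq, wDer_snoc, barMap_apply,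
            LinearMap.id_apply]
          abel
        rw [e1]
        exact add_mem (snoc_mem_lengthLT _ (ih hw))
          (hochProj_lengthLT (mergeU_lengthLT _ (hochIncl_lengthLT hw)))
  have e : hochD A w - hochLin A w =
      hochProj A (dbarU A (hochIncl A w)) - hochLin A w + hochProj A (cycU A (hochIncl A w)) := by
    simp only [hochD, dU, LinearMap.comp_apply, LinearMap.add_apply, map_add]
    abel
  rw [e]
  exact add_mem h2 h1

/-- Naturality is checked for words with letters in the whole algebra; `norm_map` and `norm_d` then
absorb the intermediate projections of letters. -/
theorem hochMap_hochD (φ : DGHom A B) (w : Hoch A) :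
    hochMap φ (hochD A w) = hochD B (hochMap φ w) := by
  have h : mapU φ ∘ₗ dU A = dU B ∘ₗ mapU φ := hword_ext fun n w hw => by
    simp only [LinearMap.comp_apply, dU, LinearMap.add_apply, map_add, dbarU_mapU φ hw,
      cycU_mapU φ hw]
  have h' := congrArg (hochProj B) (LinearMap.congr_fun h (hochIncl A w))
  simp only [LinearMap.comp_apply] at h'
  simp only [hochD, hochMap, LinearMap.comp_apply, norm_map, norm_d, h']

theorem hochMap_mem (φ : DGHom A B) : hochMap φ ∈ homDeg (hochGr A) (hochGr B) 0 := fun n x hx => by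
  rw [add_zero]
  exact hochProj_mem (mapU_mem φ (hochIncl_mem hx))

/-- Quasi-isomorphisms induce quasi-isomorphisms on Hochschild chains. -/
theorem hochMap_coneAcyclic {φ : DGHom A B}
    (c : ConeContraction A.gr B.gr A.d B.d φ.toAlgHom.toLinearMap) :
    ConeAcyclic (hochD A) (hochD B) (hochMap φ) := by
  have hdA : ∀ a, A.d (A.sgn 1 a) = -A.sgn 1 (A.d a) := odd_sgn (d_mem_homDeg A) odd_one
  have hdA' := barMap_odd_sgn (d_mem_homDeg A) odd_one
  have hdB : ∀ a, B.d (B.sgn 1 a) = -B.sgn 1 (B.d a) := odd_sgn (d_mem_homDeg B) odd_one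
  have hdB' := barMap_odd_sgn (d_mem_homDeg B) odd_one
  have hfd : ∀ a, φ.toAlgHom.toLinearMap (A.d a) = B.d (φ.toAlgHom.toLinearMap a) := φ.map_d
  have hone : B.proj (φ.toAlgHom.toLinearMap 1) = 0 := by simp
  have haug : ∀ a, A.aug a = 0 → B.aug (φ.toAlgHom.toLinearMap a) = 0 := fun a ha => by
    rw [← ha]; exact φ.map_aug a
  have hodd : Odd (-1 : ℤ) := by decide
  -- The homotopy inverse is applied to each entry. As it need not be multiplicative, `g` is only
  -- claimed to be compatible with `hochLin`, not with `hochD`.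
  let g := wMap c.inv (barMap c.inv)
  let pA := c.inv ∘ₗ φ.toAlgHom.toLinearMap
  let pB := φ.toAlgHom.toLinearMap ∘ₗ c.inv
  have hpA : pA ∈ homDeg A.gr A.gr 0 := homDeg_comp c.inv_mem φ.toLinearMap_mem (add_zero 0)
  have hpB : pB ∈ homDeg B.gr B.gr 0 := homDeg_comp φ.toLinearMap_mem c.inv_mem (add_zero 0)
  have hpAd : ∀ a, pA (A.d a) = A.d (pA a) := fun a => by
    simp only [pA, LinearMap.comp_apply, hfd, c.inv_d]
  have hpBd : ∀ a, pB (B.d a) = B.d (pB a) := fun a => by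
    simp only [pB, LinearMap.comp_apply, hfd, c.inv_d]
  -- The homotopy in `ConeContraction.f_inv` has the sign opposite to that in `wDer_homotopy`; hence
  -- `-c.hN` here and `-HB` below.
  have hhN : -c.hN ∈ homDeg B.gr B.gr (-1) := neg_mem c.hN_mem
  have hpA' : ∀ a, pA a = a + A.d (c.hM a) + c.hM (A.d a) := c.inv_f
  have hpB' : ∀ a, pB a = a + B.d ((-c.hN) a) + (-c.hN) (B.d a) := fun a => by
    refine (c.f_inv a).trans ?_
    simp only [LinearMap.neg_apply, map_neg]; abel
  let HA := wDer c.hM (barMap c.hM) (hochSign A) (wMap pA (barMap pA))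
  let HB := wDer (-c.hN) (barMap (-c.hN)) (hochSign B) (wMap pB (barMap pB))
  have hgf : ∀ w, g (hochMap φ w) = w + hochLin A (HA w) + HA (hochLin A w) := fun w => by
    have e : barMap c.inv ∘ₗ barMap φ.toAlgHom.toLinearMap = barMap pA :=
      LinearMap.ext fun e => barMap_comp_of_aug _ _ haug e
    rw [hochMap_eq, wMap_wMap, e]
    exact wDer_homotopy (sgn_one_sgn_one A) (barMap_sgn_sgn A) hdA hdA'
      (odd_sgn c.hM_mem hodd) (barMap_odd_sgn c.hM_mem hodd) (even_sgn hpA)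
      (barMap_even_sgn hpA) hpAd (barMap_d hpAd) hpA' (barMap_homotopy hpA') w
  have hfg : ∀ w, hochMap φ (g w) = w - hochLin B ((-HB) w) - (-HB) (hochLin B w) := fun w => by
    have e : barMap φ.toAlgHom.toLinearMap ∘ₗ barMap c.inv = barMap pB :=
      LinearMap.ext fun e => barMap_comp_of_one _ _ hone e
    rw [hochMap_eq, wMap_wMap, e]
    have := wDer_homotopy (sgn_one_sgn_one B) (barMap_sgn_sgn B) hdB hdB'
      (odd_sgn hhN hodd) (barMap_odd_sgn hhN hodd) (even_sgn hpB)
      (barMap_even_sgn hpB) hpBd (barMap_d hpBd) hpB' (barMap_homotopy hpB') w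
    refine this.trans ?_
    simp only [LinearMap.neg_apply, map_neg, sub_neg_eq_add]
    rfl
  have hgd : ∀ w, g (hochLin B w) = hochLin A (g w) :=
    wDer_wMap (wMap_wSign (even_sgn c.inv_mem) (barMap_even_sgn c.inv_mem)) c.inv_d
      (barMap_d c.inv_d)
  have hfd' : ∀ w, hochMap φ (hochLin A w) = hochLin B (hochMap φ w) := by
    rw [hochMap_eq]
    exact wDer_wMap (wMap_wSign (even_sgn φ.toLinearMap_mem) (barMap_even_sgn φ.toLinearMap_mem))
      hfd (barMap_d hfd)
  -- This contracts the cone with respect to `hochLin`. All entries of the contraction preserve the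
  -- length filtration, and `hochD` differs from `hochLin` by terms that lower it.
  have hK := coneD_contraction_of_homotopyEquiv hfd' g HA (-HB) hgd hgf hfg
  set u := -((-HB) ∘ₗ hochMap φ + hochMap φ ∘ₗ HA) with hu
  have sA : ∀ n, ∀ w ∈ lengthLT k A A.bar n, hochSign A w ∈ lengthLT k A A.bar n :=
    fun n w hw => wSign_lengthLT _ _ hw
  have sB : ∀ n, ∀ w ∈ lengthLT k B B.bar n, hochSign B w ∈ lengthLT k B B.bar n :=
    fun n w hw => wSign_lengthLT _ _ hw
  have lA : ∀ n, ∀ w ∈ lengthLT k A A.bar n, HA w ∈ lengthLT k A A.bar n :=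
    fun n w hw => wDer_lengthLT _ _ sA (fun n w hw => wMap_lengthLT _ _ hw) hw
  have lB : ∀ n, ∀ w ∈ lengthLT k B B.bar n, (-HB) w ∈ lengthLT k B B.bar n :=
    fun n w hw => neg_mem (wDer_lengthLT _ _ sB (fun n w hw => wMap_lengthLT _ _ hw) hw)
  have lf : ∀ n, ∀ w ∈ lengthLT k A A.bar n, hochMap φ w ∈ lengthLT k B B.bar n :=
    fun n w hw => by rw [hochMap_eq]; exact wMap_lengthLT _ _ hw
  have lg : ∀ n, ∀ w ∈ lengthLT k B B.bar n, g w ∈ lengthLT k A A.bar n :=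
    fun n w hw => wMap_lengthLT _ _ hw
  have lu : ∀ n, ∀ w ∈ lengthLT k A A.bar n, u w ∈ lengthLT k B B.bar n :=
    fun n w hw => neg_mem (add_mem (lB n _ (lf n w hw)) (lf n _ (lA n w hw)))
  have hdd : ∀ w, hochD A (hochD A w) = 0 := LinearMap.congr_fun hochD_hochD
  have hdd' : ∀ w, hochD B (hochD B w) = 0 := LinearMap.congr_fun hochD_hochD
  refine acyclic_of_filtered_contraction
    (fun n => (lengthLT k A A.bar n).prod (lengthLT k B B.bar n)) ?_ (fun z => ?_) (fun z => ?_)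
    hK (fun n z hz => ?_) (fun n z hz => ?_)
  · exact Submodule.prod_bot
  · obtain ⟨n, hn⟩ := exists_mem_lengthLT z.1
    obtain ⟨m, hm⟩ := exists_mem_lengthLT z.2
    exact ⟨max n m, lengthLT_mono (le_max_left n m) hn, lengthLT_mono (le_max_right n m) hm⟩
  · simp [hdd, hdd', hochMap_hochD]
  · exact ⟨add_mem (add_mem (lA _ _ hz.1) (lg _ _ (lu _ _ hz.1))) (lg _ _ hz.2),
      add_mem (lB _ _ (lu _ _ hz.1)) (lB _ _ hz.2)⟩
  · have e : coneD (hochD A) (hochD B) (hochMap φ) z -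
        coneD (hochLin A) (hochLin B) (hochMap φ) z =
        (-(hochD A z.1 - hochLin A z.1), hochD B z.2 - hochLin B z.2) := by
      ext <;> simp [coneD_apply]; abel
    rw [e]
    exact ⟨neg_mem (hochD_sub_hochLin_lengthLT hz.1), hochD_sub_hochLin_lengthLT hz.2⟩

/-! The grading of Hochschild chains -/

/-- The operator `Δ` multiplies a homogeneous word by its total degree, each letter counting one
less than its degree. In characteristic zero distinct integers are distinct eigenvalues, so the
graded parts are independent; homogeneous words span. The decomposition is needed to glue linear
maps degree by degree in `ConeAcyclic.exists_contraction`. -/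
theorem hochGr_isInternal [CharZero k] (A : AugDGA.{u, v} k) :
    DirectSum.IsInternal (hochGr A) := by
  rw [DirectSum.isInternal_submodule_iff_iSupIndep_and_iSup_eq_top]
  constructor
  · obtain ⟨δ, hδ⟩ := exists_linearMap_of_graded A.gr
      (fun n => (n : k) • (LinearMap.id : A →ₗ[k] A))
    let Δ : UHoch A →ₗ[k] UHoch A :=
      wordRec (nil ∘ₗ δ) (snoc ∘ₗ (δ - LinearMap.id)) snoc
    have hΔ : ∀ n w, HWord A.gr A.gr n w → Δ w = (n : k) • w := by
      intro n w hw
      induction hw with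
      | nil ha => simp [Δ, wordRec_nil, hδ _ _ ha]
      | @snoc n m w e hw he ih =>
        have e1 : Δ (snoc e w) = snoc (δ e - e) w + snoc e (Δ w) := by
          simp [Δ, wordRec_snoc]
        rw [e1, ih, hδ _ _ he]
        simp only [LinearMap.smul_apply, LinearMap.id_apply, map_sub, map_smul,
          LinearMap.sub_apply, Int.cast_sub, Int.cast_add, Int.cast_one, add_smul, sub_smul,
          one_smul]
        abel
    have hΔ' : ∀ n, hochGr A n ≤
        Module.End.eigenspace (hochProj A ∘ₗ Δ ∘ₗ hochIncl A : Module.End k (Hoch A)) (n : k) := by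
      intro n x hx
      have hle : wgr A.gr A.gr n ≤ LinearMap.eqLocus Δ ((n : k) • LinearMap.id) :=
        Submodule.span_le.2 fun w hw => hΔ n w hw
      have h1 : Δ (hochIncl A x) = (n : k) • hochIncl A x := hle (hochIncl_mem hx)
      rw [Module.End.mem_eigenspace_iff, LinearMap.comp_apply, LinearMap.comp_apply, h1, map_smul,
        hochProj_incl]
    exact ((Module.End.eigenspaces_iSupIndep _).comp
      (Int.cast_injective (α := k))).mono hΔ'
  · have h : (⨆ n, hochGr A n).mkQ ∘ₗ hochProj A = 0 := hword_ext fun n w hw => by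
      rw [LinearMap.comp_apply, LinearMap.zero_apply, Submodule.mkQ_apply,
        Submodule.Quotient.mk_eq_zero]
      exact Submodule.mem_iSup_of_mem n (hochProj_mem hw.mem)
    rw [eq_top_iff]
    intro x _
    have := LinearMap.congr_fun h (hochIncl A x)
    rwa [LinearMap.comp_apply, hochProj_incl, LinearMap.zero_apply, Submodule.mkQ_apply,
      Submodule.Quotient.mk_eq_zero] at this

theorem hochD_mem_homDeg (A : AugDGA.{u, v} k) : hochD A ∈ homDeg (hochGr A) (hochGr A) 1 :=
  fun _ _ hx => hochD_mem hx

/-! Lie derivatives and contractions along morphisms -/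

/-- With `hochL_comp_hochMap`, this moves the comparison of Lie derivatives of `A` and of `B` to Lie
derivatives along `φ`, where a homotopy of derivations can be applied. -/
theorem hochMap_comp_hochL (φ : DGHom A B) (p : ℤ) (η : A →ₗ[k] A) :
    hochMap φ ∘ₗ hochL (DGHom.id A) p η = hochL φ p (φ.toAlgHom.toLinearMap ∘ₗ η) := by
  have hid : ∀ w : UHoch A, mapU (DGHom.id A) w = w := fun w => by
    induction w using word_induction with
    | h₀ a => simp [DGHom.id]
    | h₁ w e ih => simp [ih]; simp [DGHom.id]
    | hadd x y hx hy => simp only [map_add, hx, hy]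
    | hsmul c x hx => simp only [map_smul, hx]
  have h : ∀ w : UHoch A, mapU φ (LU (DGHom.id A) p η w) =
      LU φ p (φ.toAlgHom.toLinearMap ∘ₗ η) w := fun w => by
    induction w using word_induction with
    | h₀ a => simp
    | h₁ w e ih => simp [ih, hid]; simp [DGHom.id]
    | hadd x y hx hy => simp only [map_add, hx, hy]
    | hsmul c x hx => simp only [map_smul, hx]
  ext w
  simp only [hochMap, hochL, LinearMap.comp_apply, norm_map, h]

/-- That `θ` is a derivation enters through `norm_L`: because `θ 1 = 0`, the projection of letters
performed by `hochMap` can be dropped. -/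
theorem hochL_comp_hochMap (φ : DGHom A B) {p : ℤ} {θ : B →ₗ[k] B}
    (hθ : θ ∈ derSub (DGHom.id B) p) :
    hochL (DGHom.id B) p θ ∘ₗ hochMap φ = hochL φ p (θ ∘ₗ φ.toAlgHom.toLinearMap) := by
  have hs : ∀ w : UHoch A, signU B p (mapU φ w) = mapU φ (signU A p w) := fun w => by
    induction w using word_induction with
    | h₀ a => simp [φ.map_sgn]
    | h₁ w e ih => simp [ih, φ.map_sgn]
    | hadd x y hx hy => simp only [map_add, hx, hy]
    | hsmul c x hx => simp only [map_smul, hx]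
  have hid : ∀ w : UHoch B, mapU (DGHom.id B) w = w := fun w => by
    induction w using word_induction with
    | h₀ a => simp [DGHom.id]
    | h₁ w e ih => simp [ih]; simp [DGHom.id]
    | hadd x y hx hy => simp only [map_add, hx, hy]
    | hsmul c x hx => simp only [map_smul, hx]
  have h : ∀ w : UHoch A, LU (DGHom.id B) p θ (mapU φ w) =
      LU φ p (θ ∘ₗ φ.toAlgHom.toLinearMap) w := fun w => by
    induction w using word_induction with
    | h₀ a => simp
    | h₁ w e ih => simp [ih, hid, hs]; simp [DGHom.id]
    | hadd x y hx hy => simp only [map_add, hx, hy]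
    | hsmul c x hx => simp only [map_smul, hx]
  ext w
  simp only [hochMap, hochL, LinearMap.comp_apply, norm_L _ hθ, h]

theorem hochMap_comp_hochE (φ : DGHom A B) (p : ℤ) (η : A →ₗ[k] A) :
    hochMap φ ∘ₗ hochE (DGHom.id A) p η = hochE φ p (φ.toAlgHom.toLinearMap ∘ₗ η) := by
  have h : ∀ w : UHoch A, mapU φ (eU (DGHom.id A) p η w) =
      eU φ p (φ.toAlgHom.toLinearMap ∘ₗ η) w := fun w => by
    induction w using word_induction with
    | h₀ a => simp
    | h₁ w e ih => simp [ih]; simp [DGHom.id]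
    | hadd x y hx hy => simp only [map_add, hx, hy]
    | hsmul c x hx => simp only [map_smul, hx]
  ext w
  simp only [hochMap, hochE, LinearMap.comp_apply, norm_map, h]

theorem hochE_comp_hochMap (φ : DGHom A B) {p : ℤ} {θ : B →ₗ[k] B}
    (hθ : θ ∈ derSub (DGHom.id B) p) :
    hochE (DGHom.id B) p θ ∘ₗ hochMap φ = hochE φ p (θ ∘ₗ φ.toAlgHom.toLinearMap) := by
  have hhead : ∀ w : UHoch A, headU B (mapU φ w) = φ (headU A w) := fun w => by
    induction w using word_induction with
    | h₀ a => simp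
    | h₁ w e ih => simp
    | hadd x y hx hy => simp only [map_add, hx, hy]
    | hsmul c x hx => simp only [map_smul, hx]
  have h : ∀ w : UHoch A, eU (DGHom.id B) p θ (mapU φ w) =
      eU φ p (θ ∘ₗ φ.toAlgHom.toLinearMap) w := fun w => by
    induction w using word_induction with
    | h₀ a => simp
    | h₁ w e ih => simp [ih, hhead, φ.map_sgn]; simp [DGHom.id]
    | hadd x y hx hy => simp only [map_add, hx, hy]
    | hsmul c x hx => simp only [map_smul, hx]
  ext w
  simp only [hochMap, hochE, LinearMap.comp_apply, norm_e _ hθ, h]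

end hochschild

/-! ### Endomorphisms of homotopy equivalent complexes -/

section transfer

variable {k : Type u} [Field k] {M N : Type*} [AddCommGroup M] [Module k M] [AddCommGroup N]
  [Module k N] {gM : ℤ → Submodule k M} {gN : ℤ → Submodule k N} {dM : M →ₗ[k] M}
  {dN : N →ₗ[k] N} {f : M →ₗ[k] N}

theorem homDiff_zero_of_comm (h : ∀ x, f (dM x) = dN (f x)) : homDiff dM dN 0 f = 0 := by
  ext x; simp [homDiff_apply, h]

namespace ConeContraction

theorem f_comp_inv (c : ConeContraction gM gN dM dN f) :
    f ∘ₗ c.inv = LinearMap.id - homDiff dN dN (-1) c.hN := by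
  ext x
  simp only [LinearMap.comp_apply, c.f_inv, LinearMap.sub_apply, homDiff_apply, LinearMap.id_apply]
  simp; abel

theorem inv_comp_f (c : ConeContraction gM gN dM dN f) :
    c.inv ∘ₗ f = LinearMap.id + homDiff dM dM (-1) c.hM := by
  ext x
  simp only [LinearMap.comp_apply, c.inv_f, LinearMap.add_apply, homDiff_apply, LinearMap.id_apply]
  simp; abel

theorem homDiff_inv (c : ConeContraction gM gN dM dN f) : homDiff dN dM 0 c.inv = 0 :=
  homDiff_zero_of_comm c.inv_d

variable {p : ℤ}

/-- Conjugation: `η = inv θ f`. The homotopy comes from `hN`, which joins `f inv` to the identity.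
-/
theorem exists_of_target (c : ConeContraction gM gN dM dN f) (hf : f ∈ homDeg gM gN 0)
    (hfd : homDiff dM dN 0 f = 0) {θ : N →ₗ[k] N} (hθ : θ ∈ homDeg gN gN p)
    (dθ : homDiff dN dN p θ = 0) :
    ∃ η ∈ homDeg gM gM p, homDiff dM dM p η = 0 ∧
      ∃ h ∈ homDeg gM gN (p - 1), f ∘ₗ η - θ ∘ₗ f = homDiff dM dN (p - 1) h := by
  have h1 := homDeg_comp hθ hf (zero_add p)
  have h2 : homDiff dM dN p (θ ∘ₗ f) = 0 := by
    rw [homDiff_comp dM dN dN (add_zero p), dθ, hfd]; simp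
  refine ⟨c.inv ∘ₗ (θ ∘ₗ f), homDeg_comp c.inv_mem h1 (add_zero p), ?_, -(c.hN ∘ₗ (θ ∘ₗ f)),
    neg_mem (homDeg_comp c.hN_mem h1 rfl), ?_⟩
  · rw [homDiff_comp dM dN dM (zero_add p), h2, c.homDiff_inv]; simp
  · rw [map_neg, homDiff_comp dM dN dN (q := -1) (p := p) (by ring), h2, ← LinearMap.comp_assoc,
      c.f_comp_inv, LinearMap.sub_comp, LinearMap.id_comp, LinearMap.comp_zero, smul_zero]
    abel

/-- Conjugation in the other direction: `θ = f η inv`, with `hM` joining `inv f` to the identity.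
The sign of the homotopy comes from moving the differential past `f η`. -/
theorem exists_of_source (c : ConeContraction gM gN dM dN f) (hf : f ∈ homDeg gM gN 0)
    (hfd : homDiff dM dN 0 f = 0) {η : M →ₗ[k] M} (hη : η ∈ homDeg gM gM p)
    (dη : homDiff dM dM p η = 0) :
    ∃ θ ∈ homDeg gN gN p, homDiff dN dN p θ = 0 ∧
      ∃ h ∈ homDeg gM gN (p - 1), f ∘ₗ η - θ ∘ₗ f = homDiff dM dN (p - 1) h := by
  have h1 := homDeg_comp hf hη (add_zero p)
  have h2 : homDiff dM dN p (f ∘ₗ η) = 0 := by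
    rw [homDiff_comp dM dM dN (zero_add p), dη, hfd]; simp
  refine ⟨(f ∘ₗ η) ∘ₗ c.inv, homDeg_comp h1 c.inv_mem (zero_add p), ?_,
    -((-1 : k) ^ p • (f ∘ₗ η) ∘ₗ c.hM),
    neg_mem (Submodule.smul_mem _ _ (homDeg_comp h1 c.hM_mem (by ring))), ?_⟩
  · rw [homDiff_comp dN dM dN (add_zero p), h2, c.homDiff_inv]; simp
  · rw [map_neg, map_smul, homDiff_comp dM dM dN (q := p) (p := -1) (by ring), h2,
      LinearMap.comp_assoc, c.inv_comp_f, LinearMap.comp_add, LinearMap.comp_id,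
      LinearMap.zero_comp, zero_add, smul_smul, negOnePow_mul_self, one_smul]
    abel

/-- Composition with `f` on the left is injective on homology: `inv` carries the primitive `h` back,
and `hM` corrects the difference between `inv f` and the identity. -/
theorem source_exact (c : ConeContraction gM gN dM dN f) {η : M →ₗ[k] M}
    (hη : η ∈ homDeg gM gM p) (dη : homDiff dM dM p η = 0) {h : M →ₗ[k] N}
    (hh : h ∈ homDeg gM gN (p - 1)) (e : f ∘ₗ η = homDiff dM dN (p - 1) h) :
    ∃ κ ∈ homDeg gM gM (p - 1), homDiff dM dM (p - 1) κ = η := by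
  refine ⟨c.inv ∘ₗ h - c.hM ∘ₗ η, sub_mem (homDeg_comp c.inv_mem hh (add_zero _))
    (homDeg_comp c.hM_mem hη rfl), ?_⟩
  rw [map_sub, homDiff_comp dM dN dM (zero_add _), homDiff_comp dM dM dM (q := -1) (p := p)
    (by ring), dη, c.homDiff_inv, ← e, ← LinearMap.comp_assoc, c.inv_comp_f, LinearMap.add_comp]
  simp

/-- The counterpart of `source_exact` for composition with `f` on the right, with `hN` as the
correction. -/
theorem target_exact (c : ConeContraction gM gN dM dN f) {θ : N →ₗ[k] N}
    (hθ : θ ∈ homDeg gN gN p) (dθ : homDiff dN dN p θ = 0) {h : M →ₗ[k] N}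
    (hh : h ∈ homDeg gM gN (p - 1)) (e : θ ∘ₗ f = homDiff dM dN (p - 1) h) :
    ∃ κ ∈ homDeg gN gN (p - 1), homDiff dN dN (p - 1) κ = θ := by
  refine ⟨h ∘ₗ c.inv + (-1 : k) ^ p • θ ∘ₗ c.hN, add_mem (homDeg_comp hh c.inv_mem (zero_add _))
    (Submodule.smul_mem _ _ (homDeg_comp hθ c.hN_mem (by ring))), ?_⟩
  rw [map_add, map_smul, homDiff_comp dN dM dN (add_zero _), homDiff_comp dN dN dN (q := p)
    (p := -1) (by ring), dθ, c.homDiff_inv, ← e, LinearMap.comp_assoc, c.f_comp_inv,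
    LinearMap.comp_sub, smul_add, smul_smul, negOnePow_mul_self]
  simp

end ConeContraction

end transfer

/-! ### Corresponding cocycles -/

namespace OperatorDGLie

variable {k : Type u} [Field k]

/-- The pairs of cocycles that correspond under `f` up to coboundaries of maps in `S`. -/
def corr (G : OperatorDGLie.{u, v} k) (G' : OperatorDGLie.{u, w} k) (f : G'.M →ₗ[k] G.M) (p : ℤ)
    (S : Submodule k (G'.M →ₗ[k] G.M)) : Submodule k (G.Z p × G'.Z p) :=
  (S.map (homDiff G'.d G.d (p - 1))).comap
    (show G.Z p × G'.Z p →ₗ[k] G'.M →ₗ[k] G.M from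
    { toFun := fun z => f ∘ₗ (z.2 : Module.End k G'.M) - (z.1 : Module.End k G.M) ∘ₗ f
      map_add' := fun x y => by ext; simp; abel
      map_smul' := fun c x => by ext; simp [smul_sub] })

theorem mem_corr {G : OperatorDGLie.{u, v} k} {G' : OperatorDGLie.{u, w} k}
    {f : G'.M →ₗ[k] G.M} {p : ℤ} {S : Submodule k (G'.M →ₗ[k] G.M)} {θ : G.Z p} {η : G'.Z p} :
    (θ, η) ∈ corr G G' f p S ↔
      ∃ h ∈ S, f ∘ₗ (η : Module.End k G'.M) - (θ : Module.End k G.M) ∘ₗ f =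
        homDiff G'.d G.d (p - 1) h := by
  simp only [corr, Submodule.mem_comap, Submodule.mem_map, LinearMap.coe_mk, AddHom.coe_mk]
  exact exists_congr fun h => and_congr_right fun _ => eq_comm

theorem mem_bdZ {G : OperatorDGLie.{u, v} k} {p : ℤ} {θ : G.Z p} :
    θ ∈ (G.bd p).submoduleOf (G.Z p) ↔
      ∃ κ ∈ G.S (p - 1), homDiff G.d G.d (p - 1) κ = (θ : Module.End k G.M) := by
  simp only [Submodule.submoduleOf, Submodule.mem_comap, bd, Submodule.mem_map,
    Submodule.subtype_apply]

end OperatorDGLie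

/-! ### The transfer maps on homology -/

section assembly

variable {k : Type u} [Field k] {W : AugDGA.{u, v} k} {A : AugDGA.{u, w} k} {φ : DGHom W A}

theorem DGHom.homDiff_zero (φ : DGHom W A) : homDiff W.d A.d 0 φ.toAlgHom.toLinearMap = 0 :=
  homDiff_zero_of_comm φ.map_d

theorem homDiff_hochMap (φ : DGHom W A) : homDiff (hochD W) (hochD A) 0 (hochMap φ) = 0 :=
  homDiff_zero_of_comm (hochMap_hochD φ)

/-- A cocycle `(c, x)` of the cone has `c` closed and `φ c = -d x`. Injectivity on homology gives `c
= d a'`, surjectivity writes the closed element `x + φ a'` as `φ a + d b`, and `(a - a', b)` is a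
primitive. -/
theorem DGHom.IsQuasiIso.exists_contraction (hφ : φ.IsQuasiIso) :
    Nonempty (ConeContraction W.gr A.gr W.d A.d φ.toAlgHom.toLinearMap) := by
  refine ConeAcyclic.exists_contraction (d_mem_homDeg W) (d_mem_homDeg A) φ.toLinearMap_mem
    W.d_d A.d_d φ.map_d fun z hz => ?_
  obtain ⟨c, x⟩ := z
  have h1 : W.d c = 0 := neg_eq_zero.1 (congrArg Prod.fst hz)
  have h2 : φ c + A.d x = 0 := congrArg Prod.snd hz
  obtain ⟨a', ha'⟩ := hφ.1 c h1 ⟨-x, by rw [map_neg]; exact eq_neg_of_add_eq_zero_left h2⟩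
  obtain ⟨a, ha, b, hb⟩ := hφ.2 (x + φ a') (by
    rw [map_add, ← φ.map_d, ← ha', add_comm]; exact h2)
  refine ⟨(a - a', b), ?_⟩
  ext
  · simp [ha, ha']
  · have : x = φ a - φ a' + A.d b := by rw [← hb]; abel
    simpa using this

/-- Cocycles of `Der(A)` and `Der(W)` that correspond under `φ`. -/
def derCorr (φ : DGHom W A) (p : ℤ) : Submodule k ((derLie A).Z p × (derLie W).Z p) :=
  OperatorDGLie.corr (derLie A) (derLie W) φ.toAlgHom.toLinearMap p (derSub φ (p - 1))

theorem mem_derCorr {p : ℤ} {θ : (derLie A).Z p} {η : (derLie W).Z p} :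
    (θ, η) ∈ derCorr φ p ↔ ∃ h ∈ derSub φ (p - 1), φ.toAlgHom.toLinearMap ∘ₗ derMap W η -
      derMap A θ ∘ₗ φ.toAlgHom.toLinearMap = homDiff W.d A.d (p - 1) h :=
  OperatorDGLie.mem_corr

/-- Cocycles of `End(C_*(A))` and `End(C_*(W))` that correspond under `C_*(φ)`. -/
def endCorr (φ : DGHom W A) (p : ℤ) : Submodule k ((endLie A).Z p × (endLie W).Z p) :=
  OperatorDGLie.corr (endLie A) (endLie W) (hochMap φ) p (homDeg (hochGr W) (hochGr A) (p - 1))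

theorem mem_endCorr {p : ℤ} {f : (endLie A).Z p} {g : (endLie W).Z p} :
    (f, g) ∈ endCorr φ p ↔ ∃ h ∈ homDeg (hochGr W) (hochGr A) (p - 1),
      hochMap φ ∘ₗ endMap W g - endMap A f ∘ₗ hochMap φ =
        homDiff (hochD W) (hochD A) (p - 1) h :=
  OperatorDGLie.mem_corr

/-- The map `H^p(Der(A)) → H^p(Der(W))` induced by a quasi-isomorphism `W → A` from a Sullivan
algebra. -/
theorem exists_derivation_transfer (hA : A.IsGradedComm) (hW : W.IsSullivan) (hφ : φ.IsQuasiIso)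
    (p : ℤ) : ∃ F : (derLie A).H p →ₗ[k] (derLie W).H p, ∀ θ η,
      F ((derLie A).cls p θ) = (derLie W).cls p η ↔ (θ, η) ∈ derCorr φ p := by
  obtain ⟨c⟩ := hφ.exists_contraction
  refine exists_quotient_map_of_rel _ _ (derCorr φ p) (fun θ => ?_) (fun η => ⟨fun h => ?_,
    fun h => ?_⟩) (fun θ h => ?_)
  · have hθ : derMap A θ ∈ derSub (DGHom.id A) p := θ.2.1
    have dθ : homDiff A.d A.d p (derMap A θ) = 0 := θ.2.2
    -- As the first entry of this cocycle is zero, the first entry of a primitive is itself a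
    -- cocycle of `Der(W)`, and the second entry is the homotopy relating it to `θ`.
    have H : DerConeCocycle φ p 0 (derMap A θ ∘ₗ φ.toAlgHom.toLinearMap) :=
      ⟨zero_mem _, derSub_comp_right hθ, map_zero _, by
        rw [homDiff_comp W.d A.d A.d (add_zero p), dθ, φ.homDiff_zero]; simp⟩
    obtain ⟨κ, hκ, m, hm, e1, e2⟩ := H.exists_primitive hW hA c
    exact ⟨⟨κ, hκ, e1⟩, mem_derCorr.2 ⟨m, hm, e2⟩⟩
  · obtain ⟨h, hh, e⟩ := mem_derCorr.1 h
    have hη : derMap W η ∈ derSub (DGHom.id W) p := η.2.1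
    have dη : homDiff W.d W.d p (derMap W η) = 0 := η.2.2
    -- If `η` corresponds to zero through `h`, the pair `(η, h)` is a cocycle of the cone one degree
    -- lower, and a primitive exhibits `η` as a coboundary.
    have H : DerConeCocycle φ (p - 1) (derMap W η) h :=
      ⟨by rwa [sub_add_cancel], hh, by rwa [sub_add_cancel], by
        rw [← e]
        change _ - (0 : A →ₗ[k] A) ∘ₗ _ = _
        rw [LinearMap.zero_comp, sub_zero]⟩
    obtain ⟨κ, hκ, m, hm, e1, e2⟩ := H.exists_primitive hW hA c
    exact OperatorDGLie.mem_bdZ.2 ⟨κ, hκ, e1⟩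
  · obtain ⟨κ, hκ, e⟩ : ∃ κ ∈ derSub (DGHom.id W) (p - 1), homDiff W.d W.d (p - 1) κ = derMap W η :=
      OperatorDGLie.mem_bdZ.1 h
    refine mem_derCorr.2 ⟨φ.toAlgHom.toLinearMap ∘ₗ κ, derSub_comp_left hκ, ?_⟩
    rw [homDiff_comp W.d W.d A.d (zero_add (p - 1)), φ.homDiff_zero, e]
    change _ - (0 : A →ₗ[k] A) ∘ₗ _ = _
    simp
  · obtain ⟨κ, hκ, e⟩ : ∃ κ ∈ derSub (DGHom.id A) (p - 1), homDiff A.d A.d (p - 1) κ = derMap A θ :=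
      OperatorDGLie.mem_bdZ.1 h
    refine mem_derCorr.2 ⟨-(κ ∘ₗ φ.toAlgHom.toLinearMap), neg_mem (derSub_comp_right hκ), ?_⟩
    rw [map_neg, homDiff_comp W.d A.d A.d (add_zero (p - 1)), φ.homDiff_zero, e]
    change _ ∘ₗ (0 : W →ₗ[k] W) - _ = _
    simp

/-- The isomorphism `H^p(End(C_*(A))) ≅ H^p(End(C_*(W)))` induced by a quasi-isomorphism
`W → A`. -/
theorem exists_end_transfer [CharZero k] (hφ : φ.IsQuasiIso) (p : ℤ) :
    ∃ G : (endLie A).H p ≃ₗ[k] (endLie W).H p, ∀ f g,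
      G ((endLie A).cls p f) = (endLie W).cls p g ↔ (f, g) ∈ endCorr φ p := by
  obtain ⟨c⟩ := hφ.exists_contraction
  -- Characteristic zero is used here, to obtain the decompositions of Hochschild chains by degree.
  let _ := (hochGr_isInternal W).chooseDecomposition
  let _ := (hochGr_isInternal A).chooseDecomposition
  -- The contraction for `φ` is traded for one for `C_*(φ)`.
  obtain ⟨c⟩ := ConeAcyclic.exists_contraction (hochD_mem_homDeg W) (hochD_mem_homDeg A)
    (hochMap_mem φ) (LinearMap.congr_fun hochD_hochD) (LinearMap.congr_fun hochD_hochD)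
    (hochMap_hochD φ) (hochMap_coneAcyclic c)
  refine exists_quotient_equiv_of_rel _ _ (endCorr φ p) (fun f => ?_) (fun g => ?_)
    (fun g => ⟨fun h => ?_, fun h => ?_⟩) (fun f => ⟨fun h => ?_, fun h => ?_⟩)
  · obtain ⟨η, hη, dη, h⟩ := c.exists_of_target (hochMap_mem φ) (homDiff_hochMap φ)
      (θ := endMap A f) (p := p) f.2.1 f.2.2
    exact ⟨⟨η, hη, dη⟩, mem_endCorr.2 h⟩
  · obtain ⟨θ, hθ, dθ, h⟩ := c.exists_of_source (hochMap_mem φ) (homDiff_hochMap φ)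
      (η := endMap W g) (p := p) g.2.1 g.2.2
    exact ⟨⟨θ, hθ, dθ⟩, mem_endCorr.2 h⟩
  · obtain ⟨h, hh, e⟩ := mem_endCorr.1 h
    refine OperatorDGLie.mem_bdZ.2 (c.source_exact (η := endMap W g) g.2.1 g.2.2 hh ?_)
    rw [← e]
    change _ = _ - (0 : Hoch A →ₗ[k] Hoch A) ∘ₗ _
    rw [LinearMap.zero_comp, sub_zero]
  · obtain ⟨κ, hκ, e⟩ : ∃ κ ∈ homDeg (hochGr W) (hochGr W) (p - 1),
        homDiff (hochD W) (hochD W) (p - 1) κ = endMap W g := OperatorDGLie.mem_bdZ.1 h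
    refine mem_endCorr.2 ⟨hochMap φ ∘ₗ κ, homDeg_comp (hochMap_mem φ) hκ (add_zero _), ?_⟩
    rw [homDiff_comp (hochD W) (hochD W) (hochD A) (zero_add (p - 1)), homDiff_hochMap, e]
    change _ - (0 : Hoch A →ₗ[k] Hoch A) ∘ₗ _ = _
    simp
  · obtain ⟨h, hh, e⟩ := mem_endCorr.1 h
    refine OperatorDGLie.mem_bdZ.2 (c.target_exact (θ := endMap A f) f.2.1 f.2.2 (neg_mem hh) ?_)
    rw [map_neg, ← e]
    change _ = -(_ ∘ₗ (0 : Hoch W →ₗ[k] Hoch W) - _)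
    rw [LinearMap.comp_zero, zero_sub, neg_neg]
  · obtain ⟨κ, hκ, e⟩ : ∃ κ ∈ homDeg (hochGr A) (hochGr A) (p - 1),
        homDiff (hochD A) (hochD A) (p - 1) κ = endMap A f := OperatorDGLie.mem_bdZ.1 h
    refine mem_endCorr.2 ⟨-(κ ∘ₗ hochMap φ), neg_mem (homDeg_comp hκ (hochMap_mem φ)
      (zero_add _)), ?_⟩
    rw [map_neg, homDiff_comp (hochD W) (hochD A) (hochD A) (add_zero (p - 1)), homDiff_hochMap,
      e]
    change _ ∘ₗ (0 : Hoch W →ₗ[k] Hoch W) - _ = _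
    simp

theorem HL_cls (A : AugDGA.{u, v} k) {p : ℤ} (θ : (derLie A).Z p) : ∃ f : (endLie A).Z p,
    endMap A f = hochL (DGHom.id A) p (derMap A θ) ∧
      HL A p ((derLie A).cls p θ) = (endLie A).cls p f :=
  ⟨_, rfl, rfl⟩

theorem He_cls (A : AugDGA.{u, v} k) {p : ℤ} (θ : (derLie A).Z p) : ∃ f : (endLie A).Z (p + 1),
    endMap A f = hochE (DGHom.id A) p (derMap A θ) ∧
      He A p ((derLie A).cls p θ) = (endLie A).cls (p + 1) f :=
  ⟨_, rfl, rfl⟩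

theorem hochL_sub (φ : DGHom W A) (p : ℤ) (θ η : W →ₗ[k] A) :
    hochL φ p (θ - η) = hochL φ p θ - hochL φ p η := by
  rw [eq_sub_iff_add_eq]
  simp only [hochL, ← LinearMap.comp_add, ← LinearMap.add_comp, ← LU_add, sub_add_cancel]

theorem hochE_sub (φ : DGHom W A) (p : ℤ) (θ η : W →ₗ[k] A) :
    hochE φ p (θ - η) = hochE φ p θ - hochE φ p η := by
  rw [eq_sub_iff_add_eq]
  simp only [hochE, ← LinearMap.comp_add, ← LinearMap.add_comp, ← eU_add, sub_add_cancel]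

end assembly

end HochCartan
end

/-! ### Compatibility of the transfer maps with brackets, Lie derivatives and contractions -/

theorem proposition3p4 {k : Type*} [Field k] [CharZero k]
    (A : AugDGA k) (hA : A.IsGradedComm) (W : AugDGA k) (hW : W.IsSullivan)
    (φ : DGHom W A) (hφ : φ.IsQuasiIso) :
    ∃ (F : ∀ p : ℤ, (derLie A).H p →ₗ[k] (derLie W).H p)
      (G : ∀ p : ℤ, (endLie A).H p ≃ₗ[k] (endLie W).H p),
      (∀ (p q : ℤ) (x : (derLie A).H p) (y : (derLie A).H q),
        F (p + q) ((derLie A).lie p q x y) = (derLie W).lie p q (F p x) (F q y)) ∧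
      (∀ (p q : ℤ) (x : (endLie A).H p) (y : (endLie A).H q),
        G (p + q) ((endLie A).lie p q x y) = (endLie W).lie p q (G p x) (G q y)) ∧
      (∀ (p : ℤ) (x : (derLie A).H p), G p (HL A p x) = HL W p (F p x)) ∧
      (∀ (p : ℤ) (x : (derLie A).H p), G (p + 1) (He A p x) = He W p (F p x)) ∧
      (∀ (p : ℤ) (θ : (derLie A).Z p) (η : (derLie W).Z p),
        F p ((derLie A).cls p θ) = (derLie W).cls p η ↔
          ∃ h ∈ derSub φ (p - 1),
            φ.toAlgHom.toLinearMap ∘ₗ derMap W η -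
              derMap A θ ∘ₗ φ.toAlgHom.toLinearMap = homDiff W.d A.d (p - 1) h) ∧
      (∀ (p : ℤ) (f : (endLie A).Z p) (g : (endLie W).Z p),
        G p ((endLie A).cls p f) = (endLie W).cls p g ↔
          ∃ h ∈ homDeg (hochGr W) (hochGr A) (p - 1),
            hochMap φ ∘ₗ endMap W g -
              endMap A f ∘ₗ hochMap φ =
                homDiff (hochD W) (hochD A) (p - 1) h) := by
  choose F hF using exists_derivation_transfer hA hW hφ
  choose G hG using exists_end_transfer hφ
  refine ⟨F, G, fun p q x y => ?_, fun p q x y => ?_, fun p x => ?_, fun p x => ?_,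
    fun p θ η => (hF p θ η).trans mem_derCorr, fun p f g => (hG p f g).trans mem_endCorr⟩
  · obtain ⟨θ₁, rfl⟩ := Submodule.mkQ_surjective _ x
    obtain ⟨θ₂, rfl⟩ := Submodule.mkQ_surjective _ y
    obtain ⟨η₁, e₁⟩ := Submodule.mkQ_surjective _ (F p ((derLie A).cls p θ₁))
    obtain ⟨η₂, e₂⟩ := Submodule.mkQ_surjective _ (F q ((derLie A).cls q θ₂))
    obtain ⟨h₁, hh₁, c₁⟩ := mem_derCorr.1 ((hF p θ₁ η₁).1 e₁.symm)
    obtain ⟨h₂, hh₂, c₂⟩ := mem_derCorr.1 ((hF q θ₂ η₂).1 e₂.symm)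
    rw [← e₁, ← e₂]
    -- A homotopy in `Der(W, A)` must be a derivation, which is why freeness of `W` is called upon
    -- again.
    obtain ⟨V, -, hV, -⟩ := hW
    exact (hF (p + q) ((derLie A).bracketZ p q θ₁ θ₂) ((derLie W).bracketZ p q η₁ η₂)).2
      (mem_derCorr.2 (exists_bracket_homotopy hV hA η₁.2.1 η₂.2.1 θ₁.2.1 θ₂.2.1 hh₁ hh₂
        η₁.2.2 η₂.2.2 θ₁.2.2 θ₂.2.2 c₁ c₂))
  · obtain ⟨θ₁, rfl⟩ := Submodule.mkQ_surjective _ x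
    obtain ⟨θ₂, rfl⟩ := Submodule.mkQ_surjective _ y
    obtain ⟨η₁, e₁⟩ := Submodule.mkQ_surjective _ (G p ((endLie A).cls p θ₁))
    obtain ⟨η₂, e₂⟩ := Submodule.mkQ_surjective _ (G q ((endLie A).cls q θ₂))
    obtain ⟨h₁, hh₁, c₁⟩ := mem_endCorr.1 ((hG p θ₁ η₁).1 e₁.symm)
    obtain ⟨h₂, hh₂, c₂⟩ := mem_endCorr.1 ((hG q θ₂ η₂).1 e₂.symm)
    rw [← e₁, ← e₂]
    -- In `Hom` no Leibniz rule is required, so the explicit homotopy can be used without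
    -- correction.
    exact (hG (p + q) ((endLie A).bracketZ p q θ₁ θ₂) ((endLie W).bracketZ p q η₁ η₂)).2
      (mem_endCorr.2 ⟨_, bracketHomotopy_mem rfl η₁.2.1 η₂.2.1 θ₁.2.1 θ₂.2.1 hh₁ hh₂,
        homDiff_bracketHomotopy rfl η₁.2.2 η₂.2.2 θ₁.2.2 θ₂.2.2 c₁ c₂⟩)
  · obtain ⟨θ, rfl⟩ := Submodule.mkQ_surjective _ x
    obtain ⟨η, e⟩ := Submodule.mkQ_surjective _ (F p ((derLie A).cls p θ))
    obtain ⟨h, hh, c⟩ := mem_derCorr.1 ((hF p θ η).1 e.symm)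
    obtain ⟨f, hf, ef⟩ := HL_cls A θ
    obtain ⟨g, hg, eg⟩ := HL_cls W η
    rw [← e, ef, eg]
    -- The Lie derivative along `φ` commutes with the differentials and so carries the homotopy `h`
    -- between derivations to one between operators.
    refine (hG p f g).2 (mem_endCorr.2 ⟨hochL φ (p - 1) h, fun n x hx => hochL_mem φ hh hx, ?_⟩)
    have e' := hochD_hochL φ hh
    rw [sub_add_cancel] at e'
    rw [hf, hg, hochMap_comp_hochL, hochL_comp_hochMap φ (θ := derMap A θ) θ.2.1, ← hochL_sub, c]
    exact e'.symm
  · obtain ⟨θ, rfl⟩ := Submodule.mkQ_surjective _ x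
    obtain ⟨η, e⟩ := Submodule.mkQ_surjective _ (F p ((derLie A).cls p θ))
    obtain ⟨h, hh, c⟩ := mem_derCorr.1 ((hF p θ η).1 e.symm)
    obtain ⟨f, hf, ef⟩ := He_cls A θ
    obtain ⟨g, hg, eg⟩ := He_cls W η
    rw [← e, ef, eg]
    have hp : p - 1 + 1 = p := sub_add_cancel p 1
    have hp' : p + 1 - 1 = p - 1 + 1 := by ring
    -- The sign of the homotopy reflects `[d, e_h] = -e_{δh}`.
    refine (hG (p + 1) f g).2 (mem_endCorr.2 ⟨-hochE φ (p - 1) h,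
      neg_mem fun n x hx => by rw [hp']; exact hochE_mem φ hh hx, ?_⟩)
    have e' := hochD_hochE φ hh
    rw [hp] at e'
    rw [hf, hg, hochMap_comp_hochE, hochE_comp_hochMap φ (θ := derMap A θ) θ.2.1, ← hochE_sub, c, map_neg,
      add_sub_cancel_right]
    exact (neg_eq_iff_eq_neg.2 e').symm
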